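/- Let $d\ge 1$ be an integer and $r>0$ a real number; write $r=k+\alpha$ with an integer $k\ge 0$ and $0<\alpha\le 1$. Let $F_{r,d}$ be the unit ball of the Hölder space $C^{k,\alpha}([0,1]^d)$, i.e. the set of all $k$ times continuously differentiable $f:[0,1]^d\to\mathbb R$ such that $|D^{\mathbf k}f(\mathbf x)|\le 1$ for all $|\mathbf k|\le k$ and $|D^{\mathbf k}f(\mathbf x)-D^{\mathbf k}f(\mathbf y)|\le\|\mathbf x-\mathbf y\|^{\alpha}$ for all $|\mathbf k|=k$ and all $\mathbf x,\mathbf y\in[0,1]^d$ (with the Euclidean norm). A network architecture $\eta$ with $d$ inputs is a finite directed acyclic graph of hidden units and a single output unit, with arbitrary connections from inputs and hidden units to later units. In a $\sigma$-network with architecture $\eta$, a hidden unit with incoming signals $z_1,\dots,z_K$ computes $\sigma(\sum_{j=1}^K w_jz_j+h)$, and the output unit computes $\sum_{j=1}^K w_jz_j+h$. The weights are all the numbers $w_j$ and $h$ of all the units. The number of layers of $\eta$ is the maximal number of units (hidden or output) on a directed path. There is a constant $c_{r,d}>0$ such that for every $p\in(\frac rd,\frac{2r}d)$ there is a constant $C_{r,d,p}>0$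 with the following property. Let $\sigma:\mathbb R\to\mathbb R$ be any function that has a point $x_0$ at which the second derivative $\sigma''(x_0)$ exists and is nonzero. Then for every integer $W\ge 1$ there are an architecture $\eta_W$ with $W$ weights and at most $c_{r,d}W^{pd/r-1}$ layers, and a weight assignment $G_W:F_{r,d}\to\mathbb R^W$, such that for every $f\in F_{r,d}$ the function $\widetilde f$ computed by the $\sigma$-network with architecture $\eta_W$ and weights $G_W(f)$ satisfies $$\sup_{\mathbf x\in[0,1]^d}|f(\mathbf x)-\widetilde f(\mathbf x)|\le C_{r,d,p}\,W^{-p}.$$ -/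

import Mathlib

noncomputable section

namespace DeepNet

/-! ### Hölder balls -/

/-- The cube `[0,1]^d`, in `ℝ^d` with the Euclidean norm. -/
def cube (d : ℕ) : Set (EuclideanSpace ℝ (Fin d)) :=
  {x | ∀ i, x i ∈ Set.Icc (0 : ℝ) 1}

/-- The integer `k ≥ 0` in the unique decomposition `r = k + α`, `0 < α ≤ 1`, of `r > 0`. -/
def intPart (r : ℝ) : ℕ := ⌈r⌉₊ - 1

/-- The number `α ∈ (0,1]` in the unique decomposition `r = k + α` of `r > 0`. -/
def holderExp (r : ℝ) : ℝ := r - intPart r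

theorem intPart_add_holderExp (r : ℝ) : (intPart r : ℝ) + holderExp r = r := by
  simp [holderExp]

theorem holderExp_mem {r : ℝ} (hr : 0 < r) : holderExp r ∈ Set.Ioc (0 : ℝ) 1 := by
  have h1 : 1 ≤ ⌈r⌉₊ := Nat.one_le_iff_ne_zero.mpr (Nat.ceil_pos.mpr hr).ne'
  have h2 := Nat.ceil_lt_add_one hr.le
  have h3 := Nat.le_ceil r
  simp only [holderExp, intPart, Set.mem_Ioc, Nat.cast_sub h1, Nat.cast_one]
  constructor <;> linarith

/-- The partial derivative of `f`, taken on the cube, of order `m` in the coordinate directions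
`ι 0, …, ι (m - 1)`. When `f` is `C^m` on the cube, these are exactly the partial derivatives
`D^κ f` over multi-indices `κ` with `|κ| = m` (`κ i` is the number of `j` with `ι j = i`). -/
def partialDeriv {d m : ℕ} (f : EuclideanSpace ℝ (Fin d) → ℝ) (ι : Fin m → Fin d)
    (x : EuclideanSpace ℝ (Fin d)) : ℝ :=
  iteratedFDerivWithin ℝ m f (cube d) x (fun j => EuclideanSpace.single (ι j) (1 : ℝ))

/-- The closed unit ball `F_{r,d}` of the Hölder space `C^{k,α}([0,1]^d)`, `r = k + α`. Only the
values of `f` on the cube matter. -/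
def holderBall (d : ℕ) (r : ℝ) : Set (EuclideanSpace ℝ (Fin d) → ℝ) :=
  {f | ContDiffOn ℝ (intPart r) f (cube d) ∧
    (∀ m ≤ intPart r, ∀ ι : Fin m → Fin d, ∀ x ∈ cube d, |partialDeriv f ι x| ≤ 1) ∧
    (∀ ι : Fin (intPart r) → Fin d, ∀ x ∈ cube d, ∀ y ∈ cube d,
      |partialDeriv f ι x - partialDeriv f ι y| ≤ ‖x - y‖ ^ holderExp r)}

/-! ### Feedforward networks -/

/-- A network architecture with `d` inputs and one output: a finite directed acyclic graph, whose
hidden units are listed in a topological order. Units are connected to inputs and to hidden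
units; arbitrary skip connections are allowed. -/
structure Architecture (d : ℕ) where
  /-- the number of hidden units -/
  numHidden : ℕ
  /-- the sources of the incoming connections of each hidden unit -/
  preds : Fin numHidden → Finset (Fin d ⊕ Fin numHidden)
  /-- the sources of the incoming connections of the output unit -/
  outPreds : Finset (Fin d ⊕ Fin numHidden)
  /-- connections between hidden units respect the order -/
  acyclic : ∀ i j, Sum.inr j ∈ preds i → j < i

namespace Architecture

variable {d : ℕ}

/-- The index set of the weights: for each hidden unit and for the output unit, one weight per
incoming connection (`some s`) and the bias (`none`). -/
abbrev Param (η : Architecture d) : Type :=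
  (Σ i : Fin η.numHidden, Option {s // s ∈ η.preds i}) ⊕ Option {s // s ∈ η.outPreds}

/-- The total number of weights. -/
def numWeights (η : Architecture d) : ℕ := Fintype.card η.Param

/-- The value `σ (∑ w_k z_k + h)` computed by a hidden unit of the `σ`-network with architecture
`η` and weights `w` on the input `x`. -/
def hidden (η : Architecture d) (σ : ℝ → ℝ) (w : η.Param → ℝ) (x : EuclideanSpace ℝ (Fin d))
    (i : Fin η.numHidden) : ℝ :=
  σ ((∑ s : {s // s ∈ η.preds i}, w (Sum.inl ⟨i, some s⟩) *
      (match s with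
        | ⟨Sum.inl k, _⟩ => x k
        | ⟨Sum.inr j, _⟩ => hidden η σ w x j)) + w (Sum.inl ⟨i, none⟩))
termination_by i
decreasing_by exact η.acyclic _ _ (by assumption)

theorem hidden_eq (η : Architecture d) (σ : ℝ → ℝ) (w : η.Param → ℝ)
    (x : EuclideanSpace ℝ (Fin d)) (i : Fin η.numHidden) :
    η.hidden σ w x i = σ ((∑ s : {s // s ∈ η.preds i}, w (Sum.inl ⟨i, some s⟩) *
      Sum.elim (fun k => x k) (η.hidden σ w x) s.1) + w (Sum.inl ⟨i, none⟩)) := by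
  rw [hidden]
  congr 2
  refine Finset.sum_congr rfl fun s _ => ?_
  rcases s with ⟨k | j, hs⟩ <;> rfl

/-- The output of the network; the output unit has no activation function. -/
def eval (η : Architecture d) (σ : ℝ → ℝ) (w : η.Param → ℝ) (x : EuclideanSpace ℝ (Fin d)) : ℝ :=
  (∑ s : {s // s ∈ η.outPreds}, w (Sum.inr (some s)) *
    Sum.elim (fun k => x k) (η.hidden σ w x) s.1) + w (Sum.inr none)

/-- The layer of a hidden unit: inputs have layer `0`, and a unit lies one layer above the
highest of its sources. -/
def layer (η : Architecture d) (i : Fin η.numHidden) : ℕ :=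
  1 + Finset.univ.sup (fun s : {s // s ∈ η.preds i} =>
      (match s with
        | ⟨Sum.inl _, _⟩ => 0
        | ⟨Sum.inr j, _⟩ => layer η j))
termination_by i
decreasing_by exact η.acyclic _ _ (by assumption)

theorem layer_eq (η : Architecture d) (i : Fin η.numHidden) :
    η.layer i = 1 + (η.preds i).sup (Sum.elim (fun _ => 0) η.layer) := by
  rw [layer, ← Finset.sup_attach (η.preds i) (Sum.elim (fun _ => 0) η.layer)]
  refine congrArg (1 + ·) (Finset.sup_congr rfl fun s _ => ?_)
  rcases s with ⟨k | j, hs⟩ <;> rfl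

/-- The layer of the output unit. -/
def outLayer (η : Architecture d) : ℕ :=
  1 + η.outPreds.sup (Sum.elim (fun _ => 0) η.layer)

/-- The number `L` of layers (the layer of inputs not counted, the output layer counted): the
length of a longest directed path, where all units count, also those which do not influence the
output. -/
def depth (η : Architecture d) : ℕ :=
  max η.outLayer (Finset.univ.sup η.layer)

end Architecture

/-- The second derivative of `σ` at `x₀` exists (in particular, `σ` is differentiable near `x₀`)
and is equal to `s`. -/
def HasSecondDerivAt (σ : ℝ → ℝ) (s x₀ : ℝ) : Prop :=
  (∀ᶠ x in nhds x₀, DifferentiableAt ℝ σ x) ∧ HasDerivAt (deriv σ) s x₀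

end DeepNet

end

noncomputable section

namespace DeepNet

open Set Polynomial
open scoped Pointwise

/-! ### Local polynomial approximation of Hölder functions -/

/-! Split n = q + J dyadic levels. For each of the 2^(dq) coarse cells the network stores, among its
weights, the values of f at (k+1)^d interpolation nodes and one further real number, a code. Inside
a coarse cell f is refined level by level. If the current error on a cell of level j is at most
A·2^(-rj), the residual is within O(2^(-rj)) of a polynomial. To improve it on a subcell it suffices
to interpolate it with nodal values of a fixed relative precision, that is, with a fixed number m of
signs per node (`exists_refine_bound`). The O(2^(dJ)) signs belonging to one coarse cell are packed
into its code, and the final error is O(2^(-rn)).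

Put a = pd/r - 1, which lies in (0,1), and take 2^(dq) ≍ W and 2^(dJ) ≍ W^a; then 2^(-rn) ≍ W^(-p).
The tables cost O(W) gates. Decoding is sequential and needs depth O(2^(dJ)) = O(W^a). All else
costs O(W^a log² W) = o(W) gates (`exists_levels`).

Every operation is polynomial. A code is read by iterating the Chebyshev polynomial T₄
(`exists_code`), and a sign is sharpened by iterating a cubic whose distance from ±1 is squared at
each step. Binary digits of a coordinate y are signs of sin(2π 2^j y), computed by repeated complex
squaring; table lookup is multilinear interpolation in the digits. Digits are unreliable near cell
boundaries, so 2^d grids are used, shifted by a quarter of a finest cell in some of the coordinates,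
and glued by weights that are tiny near the boundaries of their own grid. The digit errors are at
most exp(-L(2^(dJ) + n + 1)) with L at choice. This beats the factor 16^(O(2^(dJ))) lost by the
decoder and the factor 2^(O(n)) by which the polynomials grow where the digits are wrong
(`exists_netApprox`).

A gate of the resulting circuit is a product of two affine combinations of earlier nodes. Second
differences of σ at x₀ yield squares in the limit of small steps, and polarization yields products,
so each gate becomes four units (`exists_network_of_comp`). The circuit does not depend on f, hence
neither does the architecture; only coefficients and step size do. -/

/-- The span of the products of univariate polynomials of degree at most `k` in each variable. -/
def tensorPoly (d k : ℕ) : Submodule ℝ ((Fin d → ℝ) → ℝ) :=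
  Submodule.span ℝ {p | ∃ q : Fin d → ℝ[X], (∀ i, (q i).natDegree ≤ k) ∧
    p = fun y => ∏ i, (q i).eval (y i)}

theorem prod_eval_mem_tensorPoly {d k : ℕ} (q : Fin d → ℝ[X]) (hq : ∀ i, (q i).natDegree ≤ k) :
    (fun y : Fin d → ℝ => ∏ i, (q i).eval (y i)) ∈ tensorPoly d k :=
  Submodule.subset_span ⟨q, hq, rfl⟩

theorem prod_sub_mem_tensorPoly {d k m : ℕ} (hm : m ≤ k) (ι : Fin m → Fin d) (a : Fin d → ℝ) :
    (fun y : Fin d → ℝ => ∏ j, (y (ι j) - a (ι j))) ∈ tensorPoly d k := by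
  have h : (fun y : Fin d → ℝ => ∏ j, (y (ι j) - a (ι j))) = fun y => ∏ i,
      ((X - C (a i)) ^ (Finset.univ.filter fun j => ι j = i).card : ℝ[X]).eval (y i) := by
    funext y
    rw [← Finset.prod_fiberwise Finset.univ ι]
    refine Finset.prod_congr rfl fun i _ => ?_
    rw [Finset.prod_congr rfl (g := fun _ => y i - a i)
      (fun j hj => by rw [(Finset.mem_filter.mp hj).2])]
    simp
  rw [h]
  refine prod_eval_mem_tensorPoly _ fun i => ?_
  rw [natDegree_pow, natDegree_X_sub_C, mul_one]
  exact ((Finset.card_le_univ _).trans (by simp)).trans hm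

theorem convex_cube (d : ℕ) : Convex ℝ (cube d) := by
  intro x hx y hy a b ha hb hab i
  have := hx i
  have := hy i
  simp only [PiLp.add_apply, PiLp.smul_apply, smul_eq_mul]
  exact (convex_Icc (0 : ℝ) 1) (hx i) (hy i) ha hb hab

theorem interior_cube_nonempty (d : ℕ) : (interior (cube d)).Nonempty := by
  refine ⟨WithLp.toLp 2 fun _ => 1 / 2, ?_⟩
  rw [mem_interior]
  refine ⟨{x | ∀ i, x i ∈ Ioo (0 : ℝ) 1}, fun x hx i => Ioo_subset_Icc_self (hx i), ?_, ?_⟩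
  · simp only [ofPred_forall]
    refine isOpen_iInter_of_finite fun i => isOpen_Ioo.preimage ?_
    fun_prop
  · intro i
    norm_num

/-- Diagonal values of the iterated derivative in terms of partial derivatives. -/
theorem iteratedFDerivWithin_diag {d m : ℕ} (f : EuclideanSpace ℝ (Fin d) → ℝ)
    (x v : EuclideanSpace ℝ (Fin d)) :
    iteratedFDerivWithin ℝ m f (cube d) x (fun _ => v) =
      ∑ ι : Fin m → Fin d, (∏ j, v (ι j)) * partialDeriv f ι x := by
  have hv : v = ∑ i, v i • EuclideanSpace.single i (1 : ℝ) := by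
    ext j
    simp [Finset.sum_apply, Pi.single_apply]
  conv_lhs => rw [hv]
  rw [ContinuousMultilinearMap.map_sum]
  refine Finset.sum_congr rfl fun ι _ => ?_
  rw [ContinuousMultilinearMap.map_smul_univ]
  rfl

/-- Derivatives of a function along a segment in the cube. -/
theorem iteratedDerivWithin_segment {d m k : ℕ} {f : EuclideanSpace ℝ (Fin d) → ℝ}
    (hf : ContDiffOn ℝ k f (cube d)) (hm : m ≤ k) {x y : EuclideanSpace ℝ (Fin d)}
    (hx : x ∈ cube d) (hy : y ∈ cube d) {t : ℝ} (ht : t ∈ Icc (0 : ℝ) 1) :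
    iteratedDerivWithin m (fun t : ℝ => f (x + t • (y - x))) (Icc 0 1) t =
      iteratedFDerivWithin ℝ m f (cube d) (x + t • (y - x)) (fun _ => y - x) := by
  -- The affine path splits into a translation and the linear map t ↦ t(y - x); each has its own
  -- chain rule for iterated derivatives.
  set g : EuclideanSpace ℝ (Fin d) → ℝ := fun z => f (x + z) with hg
  set s : Set (EuclideanSpace ℝ (Fin d)) := (fun z => x + z) ⁻¹' cube d with hs
  have hvs : x +ᵥ s = cube d := by
    ext z
    simp [hs, Set.mem_vadd_set_iff_neg_vadd_mem]
  set L : ℝ →L[ℝ] EuclideanSpace ℝ (Fin d) := ContinuousLinearMap.toSpanSingleton ℝ (y - x)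
  have hL : ∀ t, L t = t • (y - x) := fun t => by simp [L]
  have hmem : ∀ t ∈ Icc (0 : ℝ) 1, x + L t ∈ cube d := by
    intro t ht
    have := convex_cube d hx hy (sub_nonneg.mpr ht.2) ht.1 (by ring)
    rw [hL]
    convert this using 1
    module
  have hcs : Convex ℝ s := by
    have := (convex_cube d).translate_preimage_right x
    simpa [hs] using this
  have hsi : (interior s).Nonempty := by
    obtain ⟨z, hz⟩ := interior_cube_nonempty d
    refine ⟨z - x, ?_⟩
    have hc : Continuous fun z : EuclideanSpace ℝ (Fin d) => x + z := by fun_prop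
    exact preimage_interior_subset_interior_preimage hc (by simpa using hz)
  have hsu : UniqueDiffOn ℝ s := uniqueDiffOn_convex hcs hsi
  have hsub : Icc (0 : ℝ) 1 ⊆ L ⁻¹' s := fun t ht => hmem t ht
  have hpu : UniqueDiffOn ℝ (L ⁻¹' s) := by
    refine uniqueDiffOn_convex (hcs.linear_preimage (L : ℝ →ₗ[ℝ] _)) ?_
    refine ⟨1 / 2, interior_mono hsub ?_⟩
    rw [interior_Icc]
    norm_num
  have hgs : ContDiffOn ℝ k g s :=
    hf.comp (contDiffOn_const.add contDiffOn_id) (fun z hz => hz)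
  have hcomp : (fun t : ℝ => f (x + t • (y - x))) = g ∘ L := by
    funext t
    simp [hg, hL]
  have hgL : ContDiffOn ℝ k (g ∘ L) (L ⁻¹' s) := hgs.comp L.contDiff.contDiffOn fun z hz => hz
  have hmk : ((m : ℕ) : WithTop ℕ∞) ≤ k := by exact_mod_cast hm
  rw [iteratedDerivWithin_eq_iteratedFDerivWithin, hcomp,
    iteratedFDerivWithin_subset hsub (uniqueDiffOn_Icc zero_lt_one) hpu (hgL.of_le hmk) ht,
    L.iteratedFDerivWithin_comp_right hgs hsu hpu (hsub ht) hmk, hg,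
    iteratedFDerivWithin_comp_add_left, hvs]
  simp [ContinuousMultilinearMap.compContinuousLinearMap_apply, hL]

/-- Taylor's formula on `[0,1]` with the increment of the highest derivative as remainder. -/
theorem exists_taylor_increment {k : ℕ} {g : ℝ → ℝ} (hg : ContDiffOn ℝ k g (Icc 0 1)) :
    ∃ ξ ∈ Icc (0 : ℝ) 1, g 1 - ∑ m ∈ Finset.range (k + 1),
        ((m.factorial : ℝ)⁻¹ * iteratedDerivWithin m g (Icc 0 1) 0) =
      (iteratedDerivWithin k g (Icc 0 1) ξ - iteratedDerivWithin k g (Icc 0 1) 0) /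
        k.factorial := by
  rcases k with _ | k
  · exact ⟨1, by simp, by simp⟩
  · have huI : uIcc (0 : ℝ) 1 = Icc 0 1 := uIcc_of_le zero_le_one
    have hd : DifferentiableOn ℝ (iteratedDerivWithin k g (uIcc 0 1)) (uIoo 0 1) := by
      rw [huI]
      refine (hg.differentiableOn_iteratedDerivWithin ?_ (uniqueDiffOn_Icc zero_lt_one)).mono ?_
      · exact_mod_cast Nat.lt_succ_self k
      · rw [uIoo_of_le zero_le_one]
        exact Ioo_subset_Icc_self
    obtain ⟨ξ, hξ, h⟩ := taylor_mean_remainder_lagrange (f := g) (x := 1) (x₀ := 0) (n := k)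
      zero_ne_one (by rw [huI]; exact hg.of_le (by exact_mod_cast Nat.le_succ k)) hd
    rw [uIoo_of_le zero_le_one] at hξ
    refine ⟨ξ, Ioo_subset_Icc_self hξ, ?_⟩
    rw [huI, taylor_within_apply] at h
    simp only [sub_zero, one_pow, mul_one, smul_eq_mul] at h
    -- The Lagrange remainder is the derivative of order k + 1 at ξ over (k+1)!; subtracting the
    -- Taylor term of that order makes it an increment.
    rw [Finset.sum_range_succ, ← sub_sub, h]
    ring

/-- Local approximation of functions in a Hölder ball by polynomials. -/
theorem exists_tensorPoly_approx {d : ℕ} (hd : 0 < d) {r : ℝ} (hr : 0 < r)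
    {f : EuclideanSpace ℝ (Fin d) → ℝ} (hf : f ∈ holderBall d r)
    {x : EuclideanSpace ℝ (Fin d)} (hx : x ∈ cube d) :
    ∃ T ∈ tensorPoly d (intPart r), ∀ y ∈ cube d, ∀ δ : ℝ, (∀ i, |y i - x i| ≤ δ) →
      |f y - T (fun i => y i)| ≤ (d : ℝ) ^ (intPart r + 1) * δ ^ r := by
  obtain ⟨hC, -, hH⟩ := hf
  set k := intPart r
  refine ⟨fun z => ∑ m ∈ Finset.range (k + 1), ((m.factorial : ℝ)⁻¹ *
    ∑ ι : Fin m → Fin d, (∏ j, (z (ι j) - x (ι j))) * partialDeriv f ι x), ?_, ?_⟩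
  · have : (fun z : Fin d → ℝ => ∑ m ∈ Finset.range (k + 1), ((m.factorial : ℝ)⁻¹ *
        ∑ ι : Fin m → Fin d, (∏ j, (z (ι j) - x (ι j))) * partialDeriv f ι x)) =
        ∑ m ∈ Finset.range (k + 1), ((m.factorial : ℝ)⁻¹ •
          ∑ ι : Fin m → Fin d, partialDeriv f ι x •
            (fun z : Fin d → ℝ => ∏ j, (z (ι j) - x (ι j)))) := by
      funext z
      simp [Finset.sum_apply, mul_comm]
    rw [this]
    refine Submodule.sum_mem _ fun m hm => Submodule.smul_mem _ _ (Submodule.sum_mem _ fun ι _ =>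
      Submodule.smul_mem _ _ (prod_sub_mem_tensorPoly ?_ ι _))
    exact Nat.lt_succ_iff.mp (Finset.mem_range.mp hm)
  · intro y hy δ hδ
    have hδ0 : 0 ≤ δ := (abs_nonneg _).trans (hδ ⟨0, hd⟩)
    set g : ℝ → ℝ := fun t => f (x + t • (y - x)) with hg
    have hmem : ∀ t ∈ Icc (0 : ℝ) 1, x + t • (y - x) ∈ cube d := by
      intro t ht
      have := convex_cube d hx hy (sub_nonneg.mpr ht.2) ht.1 (by ring)
      convert this using 1
      module
    have hgC : ContDiffOn ℝ k g (Icc 0 1) := by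
      refine hC.comp ?_ hmem
      fun_prop
    obtain ⟨ξ, hξ, h⟩ := exists_taylor_increment hgC
    have h0 : (0 : ℝ) ∈ Icc (0 : ℝ) 1 := by simp
    have hsum : ∑ m ∈ Finset.range (k + 1), ((m.factorial : ℝ)⁻¹ *
        iteratedDerivWithin m g (Icc 0 1) 0) = ∑ m ∈ Finset.range (k + 1), ((m.factorial : ℝ)⁻¹ *
        ∑ ι : Fin m → Fin d, (∏ j, (y (ι j) - x (ι j))) * partialDeriv f ι x) := by
      refine Finset.sum_congr rfl fun m hm => ?_
      rw [hg, iteratedDerivWithin_segment hC (Nat.lt_succ_iff.mp (Finset.mem_range.mp hm)) hx hy h0,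
        iteratedFDerivWithin_diag]
      simp
    have hg1 : g 1 = f y := by simp [hg]
    beta_reduce
    rw [← hsum, ← hg1, h, hg, iteratedDerivWithin_segment hC le_rfl hx hy hξ,
      iteratedDerivWithin_segment hC le_rfl hx hy h0, iteratedFDerivWithin_diag,
      iteratedFDerivWithin_diag, ← Finset.sum_sub_distrib, abs_div]
    have hα := holderExp_mem hr
    have hnorm : ‖y - x‖ ≤ d * δ := by
      rw [EuclideanSpace.norm_eq]
      refine Real.sqrt_le_iff.mpr ⟨by positivity, ?_⟩
      calc ∑ i, ‖(y - x) i‖ ^ 2 ≤ ∑ _i : Fin d, δ ^ 2 := by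
            refine Finset.sum_le_sum fun i _ => ?_
            have := hδ i
            rw [Real.norm_eq_abs]
            gcongr
            simpa using this
        _ = d * δ ^ 2 := by simp
        _ ≤ (d * δ) ^ 2 := by
            have : (1 : ℝ) ≤ d := by exact_mod_cast hd
            rw [mul_pow]
            gcongr
            nlinarith
    -- The monomial gives δ^k, and the Hölder condition gives (dδ)^α ≤ dδ^α because α ≤ 1. There are
    -- d^k such terms.
    have hterm : ∀ ι : Fin k → Fin d, |(∏ j, (y - x) (ι j)) *
        partialDeriv f ι (x + ξ • (y - x)) - (∏ j, (y - x) (ι j)) *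
        partialDeriv f ι (x + (0 : ℝ) • (y - x))| ≤ d * δ ^ r := by
      intro ι
      rw [← mul_sub, abs_mul, Finset.abs_prod]
      have h1 : ∏ j, |(y - x) (ι j)| ≤ δ ^ k := by
        calc ∏ j, |(y - x) (ι j)| ≤ ∏ _j : Fin k, δ :=
              Finset.prod_le_prod (fun _ _ => abs_nonneg _) fun j _ => by simpa using hδ (ι j)
          _ = δ ^ k := by simp
      have h2 := hH ι _ (hmem ξ hξ) _ (hmem 0 h0)
      have h3 : ‖x + ξ • (y - x) - (x + (0 : ℝ) • (y - x))‖ ≤ d * δ := by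
        have : x + ξ • (y - x) - (x + (0 : ℝ) • (y - x)) = ξ • (y - x) := by module
        rw [this, norm_smul, Real.norm_eq_abs, abs_of_nonneg hξ.1]
        exact (mul_le_of_le_one_left (norm_nonneg _) hξ.2).trans hnorm
      have h4 : ‖x + ξ • (y - x) - (x + (0 : ℝ) • (y - x))‖ ^ holderExp r ≤
          d * δ ^ holderExp r := by
        refine (Real.rpow_le_rpow (norm_nonneg _) h3 hα.1.le).trans ?_
        rw [Real.mul_rpow (by positivity) hδ0]
        gcongr
        calc (d : ℝ) ^ holderExp r ≤ (d : ℝ) ^ (1 : ℝ) :=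
              Real.rpow_le_rpow_of_exponent_le (by exact_mod_cast hd) hα.2
          _ = d := Real.rpow_one _
      calc _ ≤ δ ^ k * (d * δ ^ holderExp r) :=
            mul_le_mul h1 (h2.trans h4) (abs_nonneg _) (by positivity)
        _ = d * (δ ^ (k : ℝ) * δ ^ holderExp r) := by rw [Real.rpow_natCast]; ring
        _ = d * δ ^ r := by
            -- For δ = 0 exponents do not add (k may be 0), but both sides vanish since α and r are
            -- positive.
            rcases hδ0.eq_or_lt with h | h
            · have hα0 := hα.1.ne'
              rw [← h, Real.zero_rpow hα0, Real.zero_rpow hr.ne', mul_zero]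
            · rw [← Real.rpow_add h, intPart_add_holderExp]
    calc _ ≤ |∑ ι : Fin k → Fin d, ((∏ j, (y - x) (ι j)) *
        partialDeriv f ι (x + ξ • (y - x)) - (∏ j, (y - x) (ι j)) *
        partialDeriv f ι (x + (0 : ℝ) • (y - x)))| := by
          refine div_le_self (abs_nonneg _) ?_
          rw [Nat.abs_cast]
          exact_mod_cast Nat.one_le_iff_ne_zero.mpr (Nat.factorial_ne_zero k)
      _ ≤ ∑ _ι : Fin k → Fin d, d * δ ^ r :=
          (Finset.abs_sum_le_sum_abs _ _).trans (Finset.sum_le_sum fun ι _ => hterm ι)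
      _ = (d : ℝ) ^ (k + 1) * δ ^ r := by
          simp
          ring

theorem abs_le_one_of_mem_holderBall {d : ℕ} {r : ℝ} {f : EuclideanSpace ℝ (Fin d) → ℝ}
    (hf : f ∈ holderBall d r) {x : EuclideanSpace ℝ (Fin d)} (hx : x ∈ cube d) : |f x| ≤ 1 := by
  have := hf.2.1 0 (Nat.zero_le _) Fin.elim0 x hx
  simpa [partialDeriv, iteratedFDerivWithin_zero_apply] using this

end DeepNet

end

noncomputable section

namespace DeepNet

open Set Polynomial

/-! ### Dyadic cells -/

/-- A binary digit as a real number. -/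
def bit (b : Bool) : ℝ := if b then 1 else 0

/-- The value `±1` of a sign. -/
def sgn (b : Bool) : ℝ := if b then 1 else -1

theorem bit_mem (b : Bool) : bit b ∈ Icc (0 : ℝ) 1 := by
  cases b <;> simp [bit]

theorem abs_sgn (b : Bool) : |sgn b| = 1 := by
  cases b <;> simp [sgn]

/-- The local coordinates of `y` with respect to the dyadic cell whose binary digits are listed
in `l`, the last digits first. -/
def loc {d : ℕ} : List (Fin d → Bool) → (Fin d → ℝ) → Fin d → ℝ
  | [], y => y
  | v :: l, y => fun i => 2 * loc l y i - bit (v i)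

theorem loc_eq {d : ℕ} (l : List (Fin d → Bool)) (y : Fin d → ℝ) (i : Fin d) :
    loc l y i = 2 ^ l.length * y i + loc l 0 i := by
  induction l with
  | nil => simp [loc]
  | cons v l ih =>
    simp only [loc, List.length_cons]
    rw [ih]
    ring

/-- Dropping the finest digit averages the local coordinate with a bit, so cells are nested. Thus
nodes of a subcell lie in its parent, where the inductive error bound holds. -/
theorem loc_mem_of_append {d : ℕ} (w c : List (Fin d → Bool)) {y : Fin d → ℝ}
    (h : ∀ i, loc (w ++ c) y i ∈ Icc (0 : ℝ) 1) (i : Fin d) : loc c y i ∈ Icc (0 : ℝ) 1 := by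
  induction w with
  | nil => exact h i
  | cons v w ih =>
    refine ih fun i => ?_
    have h1 := h i
    have h2 := bit_mem (v i)
    simp only [List.cons_append, loc, mem_Icc] at h1 h2 ⊢
    constructor <;> linarith

/-- A margin from the cell boundary halves at each coarser level. -/
theorem coord_mem_of_loc_mem {d : ℕ} (l : List (Fin d → Bool)) {y : Fin d → ℝ} {i : Fin d} {μ : ℝ}
    (h : loc l y i ∈ Icc μ (1 - μ)) :
    y i ∈ Icc (μ / 2 ^ l.length) (1 - μ / 2 ^ l.length) := by
  induction l generalizing μ with
  | nil => simpa [loc] using h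
  | cons v l ih =>
    have h2 := bit_mem (v i)
    have := @ih (μ / 2) (by
      simp only [loc, mem_Icc] at h h2 ⊢
      constructor <;> linarith)
    rw [div_div, ← pow_succ'] at this
    simpa using this

/-! ### Tensor product Lagrange interpolation -/

/-- Interpolation nodes in the middle of the unit interval. -/
def node (k : ℕ) (a : Fin (k + 1)) : ℝ := 1 / 4 + a / (2 * (k + 1))

/-- The margin 1/4 is a quarter of a cell, the amount by which the finest grid is shifted; this
keeps nodes of all shifted grids inside the cube. -/
theorem node_mem (k : ℕ) (a : Fin (k + 1)) : node k a ∈ Icc (1 / 4 : ℝ) (1 - 1 / 4) := by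
  have h1 : (a : ℝ) ≤ k + 1 := by exact_mod_cast a.2.le
  have h2 : (0 : ℝ) < k + 1 := by positivity
  have h3 : (a : ℝ) / (2 * (k + 1)) ≤ 1 / 2 := by
    rw [div_le_iff₀ (by positivity)]
    linarith
  have h4 : (0 : ℝ) ≤ a / (2 * (k + 1)) := by positivity
  simp only [node, mem_Icc]
  constructor <;> linarith

theorem node_injective (k : ℕ) : Function.Injective (node k) := by
  intro a b h
  have h2 : (2 * ((k : ℝ) + 1)) ≠ 0 := by positivity
  simp only [node, add_right_inj, div_left_inj' h2, Nat.cast_inj] at h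
  exact Fin.ext h

/-- The Lagrange basis polynomials in one variable. -/
def lag (k : ℕ) (a : Fin (k + 1)) : ℝ[X] := Lagrange.basis Finset.univ (node k) a

theorem natDegree_lag (k : ℕ) (a : Fin (k + 1)) : (lag k a).natDegree ≤ k := by
  rw [lag, Lagrange.natDegree_basis (node_injective k).injOn (Finset.mem_univ a)]
  simp

theorem eval_eq_sum_lag {k : ℕ} {q : ℝ[X]} (hq : q.natDegree ≤ k) (t : ℝ) :
    q.eval t = ∑ a, q.eval (node k a) * (lag k a).eval t := by
  have h := Lagrange.eq_interpolate (s := Finset.univ) (v := node k) (f := q)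
    (node_injective k).injOn (by
      refine (degree_le_natDegree).trans_lt ?_
      rw [Finset.card_univ, Fintype.card_fin]
      exact_mod_cast Nat.lt_succ_of_le hq)
  conv_lhs => rw [h]
  rw [Lagrange.interpolate_apply, eval_finsetSum]
  simp [lag]

/-- The tensor products of Lagrange basis polynomials. -/
def tlag {d k : ℕ} (a : Fin d → Fin (k + 1)) (ξ : Fin d → ℝ) : ℝ := ∏ i, (lag k (a i)).eval (ξ i)

/-- The interpolation nodes in a dyadic cell. -/
def cellNode {d k : ℕ} (l : List (Fin d → Bool)) (a : Fin d → Fin (k + 1)) (i : Fin d) : ℝ :=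
  (node k (a i) - loc l 0 i) / 2 ^ l.length

theorem loc_cellNode {d k : ℕ} (l : List (Fin d → Bool)) (a : Fin d → Fin (k + 1)) (i : Fin d) :
    loc l (cellNode l a) i = node k (a i) := by
  have : (2 : ℝ) ^ l.length ≠ 0 := by positivity
  rw [loc_eq, cellNode]
  field_simp
  ring

/-- By linearity it suffices to treat products of univariate polynomials. There one-variable
Lagrange interpolation is exact in each factor, also after the affine change to local coordinates,
and the product of sums expands into the tensor basis. -/
theorem interpolation_eq {d k : ℕ} (l : List (Fin d → Bool)) {p : (Fin d → ℝ) → ℝ}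
    (hp : p ∈ tensorPoly d k) (y : Fin d → ℝ) :
    p y = ∑ a : Fin d → Fin (k + 1), p (cellNode l a) * tlag a (loc l y) := by
  induction hp using Submodule.span_induction with
  | mem p hp =>
    obtain ⟨q, hq, rfl⟩ := hp
    have h2 : (2 : ℝ) ^ l.length ≠ 0 := by positivity
    set Q : Fin d → ℝ[X] := fun i => (q i).comp (C ((2 : ℝ) ^ l.length)⁻¹ * X +
      C (-loc l 0 i / 2 ^ l.length)) with hQ
    have hQd : ∀ i, (Q i).natDegree ≤ k := by
      intro i
      refine natDegree_comp_le.trans ?_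
      exact (Nat.mul_le_mul (hq i) (natDegree_linear_le)).trans (by simp)
    have hQ1 : ∀ i t, (Q i).eval t = (q i).eval ((t - loc l 0 i) / 2 ^ l.length) := by
      intro i t
      simp only [hQ, eval_comp, eval_add, eval_mul, eval_C, eval_X]
      congr 1
      field_simp
      ring
    have hQ2 : ∀ i, (q i).eval (y i) = (Q i).eval (loc l y i) := by
      intro i
      rw [hQ1, loc_eq]
      congr 1
      field_simp
      ring
    simp only
    rw [Finset.prod_congr rfl fun i _ => (hQ2 i).trans (eval_eq_sum_lag (hQd i) _),
      Finset.prod_univ_sum]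
    simp only [Fintype.piFinset_univ]
    refine Finset.sum_congr rfl fun a _ => ?_
    rw [Finset.prod_mul_distrib, tlag]
    congr 1
    exact Finset.prod_congr rfl fun i _ => by rw [hQ1]; rfl
  | zero => simp
  | add p p' _ _ h h' =>
    simp only [Pi.add_apply, add_mul, Finset.sum_add_distrib]
    rw [h, h']
  | smul c p _ h =>
    simp only [Pi.smul_apply, smul_eq_mul, mul_assoc]
    rw [h, Finset.mul_sum]

theorem tlag_loc_mem {d k : ℕ} (l : List (Fin d → Bool)) (a : Fin d → Fin (k + 1)) :
    (fun y => tlag a (loc l y)) ∈ tensorPoly d k := by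
  have : (fun y => tlag a (loc l y)) = fun y : Fin d → ℝ => ∏ i,
      ((lag k (a i)).comp (C ((2 : ℝ) ^ l.length) * X + C (loc l 0 i))).eval (y i) := by
    funext y
    refine Finset.prod_congr rfl fun i _ => ?_
    rw [loc_eq]
    simp [eval_comp]
  rw [this]
  refine prod_eval_mem_tensorPoly _ fun i => natDegree_comp_le.trans ?_
  exact (Nat.mul_le_mul (natDegree_lag k _) (natDegree_linear_le)).trans (by simp)

/-! ### Bounds for the basis polynomials -/

theorem exists_abs_eval_le {k : ℕ} {p : ℝ[X]} (hp : p.natDegree ≤ k) :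
    ∃ C : ℝ, 0 ≤ C ∧ ∀ t, |p.eval t| ≤ C * (1 + |t|) ^ k := by
  refine ⟨∑ i ∈ Finset.range (k + 1), |p.coeff i|, by positivity, fun t => ?_⟩
  rw [eval_eq_sum_range' (Nat.lt_succ_of_le hp), Finset.sum_mul]
  refine (Finset.abs_sum_le_sum_abs _ _).trans (Finset.sum_le_sum fun i hi => ?_)
  rw [abs_mul, abs_pow]
  have h1 : |t| ^ i ≤ (1 + |t|) ^ i := by
    gcongr
    linarith
  have h2 : (1 + |t|) ^ i ≤ (1 + |t|) ^ k :=
    pow_le_pow_right₀ (by linarith [abs_nonneg t]) (Nat.lt_succ_iff.mp (Finset.mem_range.mp hi))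
  gcongr
  exact h1.trans h2

/-- Mean value inequality. The interval exceeds [0,1] by one unit on each side, which leaves room
for the error of approximate local coordinates. -/
theorem exists_abs_eval_sub_le (p : ℝ[X]) :
    ∃ C : ℝ, 0 ≤ C ∧ ∀ t ∈ Icc (-1 : ℝ) 2, ∀ u ∈ Icc (-1 : ℝ) 2,
      |p.eval t - p.eval u| ≤ C * |t - u| := by
  obtain ⟨C, hC, h⟩ := exists_abs_eval_le (p := derivative p) le_rfl
  refine ⟨C * 3 ^ (derivative p).natDegree, by positivity, fun t ht u hu => ?_⟩
  refine (convex_Icc (-1 : ℝ) 2).norm_image_sub_le_of_norm_deriv_le (f := fun x => p.eval x)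
    (fun x _ => p.differentiableAt) (fun x hx => ?_) hu ht
  rw [Polynomial.deriv, Real.norm_eq_abs]
  refine (h x).trans ?_
  have : |x| ≤ 2 := abs_le.mpr ⟨by linarith [hx.1], hx.2⟩
  gcongr
  linarith

/-- A constant that controls the basis polynomials. -/
theorem exists_lag_bound (k : ℕ) : ∃ Λ : ℝ, 1 ≤ Λ ∧ ∀ a : Fin (k + 1),
    (∀ t, |(lag k a).eval t| ≤ Λ * (1 + |t|) ^ k) ∧
    (∀ t ∈ Icc (-1 : ℝ) 2, |(lag k a).eval t| ≤ Λ) ∧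
    ∀ t ∈ Icc (-1 : ℝ) 2, ∀ u ∈ Icc (-1 : ℝ) 2,
      |(lag k a).eval t - (lag k a).eval u| ≤ Λ * |t - u| := by
  choose C hC0 hC using fun a => exists_abs_eval_le (natDegree_lag k a)
  choose C' hC'0 hC' using fun a => exists_abs_eval_sub_le (lag k a)
  have hs1 : ∀ a, C a ≤ ∑ a, C a := fun a =>
    Finset.single_le_sum (fun i _ => hC0 i) (Finset.mem_univ a)
  have hs2 : ∀ a, C' a ≤ ∑ a, C' a := fun a =>
    Finset.single_le_sum (fun i _ => hC'0 i) (Finset.mem_univ a)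
  have hs3 : 0 ≤ ∑ a, C a := Finset.sum_nonneg fun i _ => hC0 i
  have hs4 : 0 ≤ ∑ a, C' a := Finset.sum_nonneg fun i _ => hC'0 i
  have h3k : (1 : ℝ) ≤ 3 ^ k := one_le_pow₀ (by norm_num)
  refine ⟨1 + (∑ a, C a) * 3 ^ k + ∑ a, C' a, ?_, fun a => ⟨fun t => (hC a t).trans ?_,
    fun t ht => (hC a t).trans ?_, fun t ht u hu => (hC' a t ht u hu).trans ?_⟩⟩
  · have : 0 ≤ (∑ a, C a) * 3 ^ k := by positivity
    linarith
  · gcongr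
    nlinarith [hs1 a]
  · have h2 : |t| ≤ 2 := abs_le.mpr ⟨by linarith [ht.1], ht.2⟩
    have h3 : (1 + |t|) ^ k ≤ 3 ^ k := by
      gcongr
      linarith
    have : C a * (1 + |t|) ^ k ≤ (∑ a, C a) * 3 ^ k :=
      mul_le_mul (hs1 a) h3 (by positivity) hs3
    linarith
  · gcongr
    have : 0 ≤ (∑ a, C a) * 3 ^ k := by positivity
    linarith [hs2 a]

/-! ### Quantization -/

/-- The signs of the greedy binary expansion of `x ∈ [-1,1]`. -/
def quantizer : (m : ℕ) → ℝ → Fin m → Bool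
  | 0, _ => Fin.elim0
  | m + 1, x => Fin.cons (decide (0 ≤ x)) (quantizer m (2 * x - sgn (decide (0 ≤ x))))

/-- The dyadic number with a given sequence of signs. -/
def quantValue {m : ℕ} (s : Fin m → ℝ) : ℝ :=
  ∑ e : Fin m, (1 / 2) ^ ((e : ℕ) + 1) * s e

/-- The rescaled remainder 2x - sgn x stays in [-1,1], so every further sign halves the error. -/
theorem abs_sub_quantValue_le (m : ℕ) {x : ℝ} (hx : |x| ≤ 1) :
    |x - quantValue (fun e => sgn (quantizer m x e))| ≤ (1 / 2) ^ m := by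
  induction m generalizing x with
  | zero => simpa [quantValue] using hx
  | succ m ih =>
    have hx' : |2 * x - sgn (decide (0 ≤ x))| ≤ 1 := by
      rw [abs_le] at hx ⊢
      by_cases h : 0 ≤ x
      · simp only [h, sgn]
        constructor <;> simp <;> linarith
      · simp only [h, sgn]
        push Not at h
        constructor <;> simp <;> linarith
    have h := ih hx'
    set x' := 2 * x - sgn (decide (0 ≤ x))
    have h2 : quantValue (fun e => sgn (quantizer (m + 1) x e)) =
        (sgn (decide (0 ≤ x)) + quantValue (fun e => sgn (quantizer m x' e))) / 2 := by
      rw [quantValue, Fin.sum_univ_succ, quantValue, add_div, Finset.sum_div]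
      congr 1
      · simp [quantizer]
        ring
      · refine Finset.sum_congr rfl fun e _ => ?_
        simp only [quantizer, Fin.cons_succ, Fin.val_succ, x']
        ring
    rw [h2]
    have h3 : x - (sgn (decide (0 ≤ x)) + quantValue (fun e => sgn (quantizer m x' e))) / 2 =
        (x' - quantValue (fun e => sgn (quantizer m x' e))) / 2 := by
      simp only [x']
      ring
    rw [h3, abs_div, abs_two, pow_succ]
    linarith

theorem abs_quantValue_sub_le {m : ℕ} {s t : Fin m → ℝ} {ε : ℝ} (hε : 0 ≤ ε)
    (h : ∀ e, |s e - t e| ≤ ε) : |quantValue s - quantValue t| ≤ ε := by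
  have hs : ∀ m : ℕ, ∑ e : Fin m, (1 / 2 : ℝ) ^ ((e : ℕ) + 1) ≤ 1 := by
    intro m
    rw [Fin.sum_univ_eq_sum_range (fun e => (1 / 2 : ℝ) ^ (e + 1))]
    have : ∑ e ∈ Finset.range m, (1 / 2 : ℝ) ^ (e + 1) = 1 - (1 / 2) ^ m := by
      induction m with
      | zero => simp
      | succ m ih => rw [Finset.sum_range_succ, ih]; ring
    rw [this]
    linarith [show (0 : ℝ) ≤ (1 / 2) ^ m by positivity]
  rw [quantValue, quantValue, ← Finset.sum_sub_distrib]
  calc _ ≤ ∑ e : Fin m, (1 / 2 : ℝ) ^ ((e : ℕ) + 1) * ε := by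
        refine (Finset.abs_sum_le_sum_abs _ _).trans (Finset.sum_le_sum fun e _ => ?_)
        rw [← mul_sub, abs_mul, abs_of_nonneg (by positivity)]
        gcongr
        exact h e
    _ ≤ ε := by
        rw [← Finset.sum_mul]
        exact mul_le_of_le_one_left hε (hs m)

/-! ### Multilevel approximation with quantized coefficients -/

/-- The size of the coefficients used to refine the approximation on cells of level `j`. -/
def refScale (r K : ℝ) (j : ℕ) : ℝ := K * (2 : ℝ) ^ (-(r * j))

/-- The multilevel approximation of `g` on the cell with the digits `w ++ c`: interpolation on
the coarse cell `c`, followed by quantized corrections. -/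
def refine {d : ℕ} (k m : ℕ) (r K : ℝ) (g : (Fin d → ℝ) → ℝ) (c : List (Fin d → Bool)) :
    List (Fin d → Bool) → (Fin d → ℝ) → ℝ
  | [], y => ∑ a : Fin d → Fin (k + 1), g (cellNode c a) * tlag a (loc c y)
  | v :: w, y => refine k m r K g c w y + ∑ a : Fin d → Fin (k + 1),
      refScale r K (w ++ c).length * quantValue (fun e => sgn (quantizer m
        ((g (cellNode (v :: w ++ c) a) - refine k m r K g c w (cellNode (v :: w ++ c) a)) /
          refScale r K (w ++ c).length) e)) * tlag a (loc (v :: w ++ c) y)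

/-- The signs of the corrections. -/
def refSign {d : ℕ} (k m : ℕ) (r K : ℝ) (g : (Fin d → ℝ) → ℝ) (c : List (Fin d → Bool)) :
    List (Fin d → Bool) → (Fin d → Fin (k + 1)) → Fin m → Bool
  | [], _, _ => true
  | v :: w, a, e => quantizer m
      ((g (cellNode (v :: w ++ c) a) - refine k m r K g c w (cellNode (v :: w ++ c) a)) /
          refScale r K (w ++ c).length) e

theorem refine_cons {d : ℕ} (k m : ℕ) (r K : ℝ) (g : (Fin d → ℝ) → ℝ) (c w : List (Fin d → Bool))
    (v : Fin d → Bool) (y : Fin d → ℝ) :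
    refine k m r K g c (v :: w) y = refine k m r K g c w y + ∑ a : Fin d → Fin (k + 1),
      refScale r K (w ++ c).length *
        quantValue (fun e => sgn (refSign k m r K g c (v :: w) a e)) *
          tlag a (loc (v :: w ++ c) y) := rfl

theorem refine_mem {d : ℕ} (k m : ℕ) (r K : ℝ) (g : (Fin d → ℝ) → ℝ) (c w : List (Fin d → Bool)) :
    refine k m r K g c w ∈ tensorPoly d k := by
  induction w with
  | nil =>
    have : refine k m r K g c [] = ∑ a : Fin d → Fin (k + 1), g (cellNode c a) •
        fun y => tlag a (loc c y) := by
      funext y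
      simp [refine, Finset.sum_apply]
    rw [this]
    exact Submodule.sum_mem _ fun a _ => Submodule.smul_mem _ _ (tlag_loc_mem c a)
  | cons v w ih =>
    have : refine k m r K g c (v :: w) = refine k m r K g c w + ∑ a : Fin d → Fin (k + 1),
        (refScale r K (w ++ c).length *
          quantValue (fun e => sgn (refSign k m r K g c (v :: w) a e))) •
        fun y => tlag a (loc (v :: w ++ c) y) := by
      funext y
      simp only [refine_cons, Pi.add_apply, Finset.sum_apply, Pi.smul_apply, smul_eq_mul]
    rw [this]
    exact Submodule.add_mem _ ih
      (Submodule.sum_mem _ fun a _ => Submodule.smul_mem _ _ (tlag_loc_mem _ a))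

/-- An approximation by interpolation with perturbed nodal values. -/
theorem abs_sub_interpolation_le {d k : ℕ} {l : List (Fin d → Bool)} {h T : (Fin d → ℝ) → ℝ}
    (hT : T ∈ tensorPoly d k) {u : (Fin d → Fin (k + 1)) → ℝ} {y : Fin d → ℝ} {S A B : ℝ}
    (hA0 : 0 ≤ A) (hB0 : 0 ≤ B)
    (hS : ∑ a : Fin d → Fin (k + 1), |tlag a (loc l y)| ≤ S) (hy : |h y - T y| ≤ A)
    (ha : ∀ a : Fin d → Fin (k + 1), |h (cellNode l a) - T (cellNode l a)| ≤ A)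
    (hu : ∀ a, |h (cellNode l a) - u a| ≤ B) :
    |h y - ∑ a, u a * tlag a (loc l y)| ≤ A + S * (A + B) := by
  have h1 : h y - ∑ a, u a * tlag a (loc l y) =
      (h y - T y) + ∑ a, (T (cellNode l a) - u a) * tlag a (loc l y) := by
    simp only [sub_mul, Finset.sum_sub_distrib]
    rw [← interpolation_eq l hT y]
    ring
  rw [h1]
  refine (abs_add_le _ _).trans (add_le_add hy ?_)
  calc _ ≤ ∑ a : Fin d → Fin (k + 1), |tlag a (loc l y)| * (A + B) := by
        refine (Finset.abs_sum_le_sum_abs _ _).trans (Finset.sum_le_sum fun a _ => ?_)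
        rw [abs_mul, mul_comm]
        gcongr
        have h2 : T (cellNode l a) - u a =
          -(h (cellNode l a) - T (cellNode l a)) + (h (cellNode l a) - u a) := by ring
        rw [h2]
        refine (abs_add_le _ _).trans (add_le_add ?_ (hu a))
        rw [abs_neg]
        exact ha a
    _ ≤ S * (A + B) := by
        rw [← Finset.sum_mul]
        gcongr

/-- Induction over levels with error bound K·2^(-rj) as invariant. S bounds the Lebesgue constant.
Passing to a subcell leaves two errors: the distance to polynomials, (1+S)C, and the quantization
error, S·2^(-m)·2^r·K, both relative to the finer scale. `hK` and `hm` make each at most K/2. -/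
theorem abs_sub_refine_le {d k m n : ℕ} {r K S C : ℝ} {g : (Fin d → ℝ) → ℝ}
    {D : Set (Fin d → ℝ)} (hC0 : 0 ≤ C) (hK0 : 0 < K)
    (hg : ∀ l : List (Fin d → Bool), l.length ≤ n → ∃ T ∈ tensorPoly d k, ∀ y ∈ D,
      (∀ i, loc l y i ∈ Icc (0 : ℝ) 1) → |g y - T y| ≤ C * 2 ^ (-(r * l.length)))
    (hD : ∀ l : List (Fin d → Bool), l.length ≤ n → ∀ a : Fin d → Fin (k + 1), cellNode l a ∈ D)
    (hS : ∀ ξ : Fin d → ℝ, (∀ i, ξ i ∈ Icc (0 : ℝ) 1) →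
      ∑ a : Fin d → Fin (k + 1), |tlag a ξ| ≤ S)
    (hK : (1 + S) * C ≤ K / 2) (hm : S * ((1 / 2) ^ m * 2 ^ r) ≤ 1 / 2)
    (c w : List (Fin d → Bool)) (hl : (w ++ c).length ≤ n) {y : Fin d → ℝ} (hy : y ∈ D)
    (hy' : ∀ i, loc (w ++ c) y i ∈ Icc (0 : ℝ) 1) :
    |g y - refine k m r K g c w y| ≤ refScale r K (w ++ c).length := by
  have hS0 : 0 ≤ S := (Finset.sum_nonneg fun _ _ => abs_nonneg _).trans
    (hS (fun _ => 0) fun _ => by simp)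
  have hnode : ∀ l : List (Fin d → Bool), ∀ a : Fin d → Fin (k + 1), ∀ i,
      loc l (cellNode l a) i ∈ Icc (0 : ℝ) 1 := by
    intro l a i
    rw [loc_cellNode]
    have := node_mem k (a i)
    exact ⟨by linarith [this.1], by linarith [this.2]⟩
  induction w generalizing y with
  | nil =>
    obtain ⟨T, hT, h⟩ := hg c (by simpa using hl)
    have hp : (0 : ℝ) < 2 ^ (-(r * (c.length : ℝ))) := by positivity
    refine (abs_sub_interpolation_le hT (l := c) (A := C * 2 ^ (-(r * c.length))) (B := 0)
      (by positivity) le_rfl (hS _ hy') (h y hy hy')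
      (fun a => h _ (hD c (by simpa using hl) a) (hnode c a)) (fun a => by simp)).trans ?_
    simp only [refScale, List.nil_append, add_zero]
    nlinarith
  | cons v w ih =>
    set l := v :: w ++ c with hldef
    have hl' : (w ++ c).length ≤ n := by
      simp only [hldef, List.cons_append, List.length_cons] at hl
      omega
    obtain ⟨T, hT, h⟩ := hg l hl
    set κ := refScale r K (w ++ c).length with hκdef
    have hκ : 0 < κ := by
      rw [hκdef, refScale]
      positivity
    have hstep : (2 : ℝ) ^ (-(r * l.length)) * 2 ^ r = 2 ^ (-(r * (w ++ c).length)) := by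
      rw [← Real.rpow_add two_pos]
      congr 1
      simp only [hldef, List.cons_append, List.length_cons]
      push_cast
      ring
    have hp : (0 : ℝ) < 2 ^ (-(r * (l.length : ℝ))) := by positivity
    -- The nodes of the subcell lie in the parent cell, so by induction the residual divided by κ is
    -- in [-1,1] and can be quantized.
    have hu : ∀ a : Fin d → Fin (k + 1),
        |(g (cellNode l a) - refine k m r K g c w (cellNode l a)) -
          κ * quantValue (fun e => sgn (refSign k m r K g c (v :: w) a e))| ≤ κ * (1 / 2) ^ m := by
      intro a
      have hin : ∀ i, loc (w ++ c) (cellNode l a) i ∈ Icc (0 : ℝ) 1 := fun i =>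
        loc_mem_of_append [v] (w ++ c) (hnode l a) i
      have h1 := ih hl' (hD l hl a) hin
      set x := (g (cellNode l a) - refine k m r K g c w (cellNode l a)) / κ with hx
      have hx1 : |x| ≤ 1 := by
        rw [hx, abs_div, abs_of_pos hκ]
        exact (div_le_one hκ).mpr h1
      have h2 := abs_sub_quantValue_le m hx1
      have h3 : g (cellNode l a) - refine k m r K g c w (cellNode l a) = κ * x := by
        rw [hx]
        field_simp
      rw [h3, ← mul_sub, abs_mul, abs_of_pos hκ]
      gcongr
      exact h2
    -- The previous approximation is itself a polynomial, so the residual is as close to polynomials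
    -- as g is.
    have h4 := abs_sub_interpolation_le (h := fun y => g y - refine k m r K g c w y)
      (Submodule.sub_mem _ hT (refine_mem k m r K g c w)) (l := l)
      (A := C * 2 ^ (-(r * l.length))) (B := κ * (1 / 2) ^ m)
      (u := fun a => κ * quantValue (fun e => sgn (refSign k m r K g c (v :: w) a e)))
      (y := y) (by positivity) (by positivity) (hS _ hy')
      (by simpa using h y hy hy')
      (fun a => by simpa using h _ (hD l hl a) (hnode l a)) hu
    rw [refine_cons, ← sub_sub]
    refine h4.trans ?_
    have hκ' : κ = K * 2 ^ r * 2 ^ (-(r * (l.length : ℝ))) := by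
      rw [hκdef, refScale, ← hstep]
      ring
    have h5 : S * ((1 / 2) ^ m * 2 ^ r) * K ≤ 1 / 2 * K := by gcongr
    rw [hκ', refScale]
    calc _ = ((1 + S) * C + S * ((1 / 2) ^ m * 2 ^ r) * K) * 2 ^ (-(r * (l.length : ℝ))) := by ring
      _ ≤ (K / 2 + 1 / 2 * K) * 2 ^ (-(r * (l.length : ℝ))) := by gcongr
      _ = _ := by ring

end DeepNet

end

noncomputable section

namespace DeepNet

open Set Polynomial

/-! ### Multilevel approximation of Hölder functions on shifted grids -/

/-- The shift of the second grid. -/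
def gridShift (n : ℕ) : ℝ := 1 / 2 ^ (n + 2)

/-- The coordinates on the cube in which the grid with the shift `s` is the dyadic one. -/
def gridCoord {d : ℕ} (n : ℕ) (s : Fin d → Bool) (x : EuclideanSpace ℝ (Fin d)) (i : Fin d) : ℝ :=
  (1 - gridShift n) * x i + bit (s i) * gridShift n

/-- The inverse of `gridCoord`. -/
def gridPoint {d : ℕ} (n : ℕ) (s : Fin d → Bool) (y : Fin d → ℝ) : EuclideanSpace ℝ (Fin d) :=
  WithLp.toLp 2 fun i => (y i - bit (s i) * gridShift n) / (1 - gridShift n)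

theorem gridShift_pos (n : ℕ) : 0 < gridShift n := by
  rw [gridShift]
  positivity

theorem gridShift_le (n : ℕ) : gridShift n ≤ 1 / 4 := by
  have h : (2 : ℝ) ^ 2 ≤ 2 ^ (n + 2) := pow_le_pow_right₀ (by norm_num) (by omega)
  rw [gridShift, div_le_div_iff₀ (by positivity) (by norm_num)]
  linarith

theorem gridPoint_gridCoord {d : ℕ} (n : ℕ) (s : Fin d → Bool) (x : EuclideanSpace ℝ (Fin d)) :
    gridPoint n s (gridCoord n s x) = x := by
  have h : 1 - gridShift n ≠ 0 := by linarith [gridShift_le n]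
  ext i
  simp only [gridPoint, gridCoord]
  field_simp
  ring

theorem gridCoord_mem {d : ℕ} (n : ℕ) (s : Fin d → Bool) {x : EuclideanSpace ℝ (Fin d)}
    (hx : x ∈ cube d) (i : Fin d) : gridCoord n s x i ∈ Icc (0 : ℝ) 1 := by
  have h := gridShift_le n
  have h0 := gridShift_pos n
  obtain ⟨h1, h2⟩ := bit_mem (s i)
  obtain ⟨h3, h4⟩ := hx i
  rw [gridCoord, mem_Icc]
  constructor <;> nlinarith

/-- The nodes keep a distance of at least a quarter of a cell of level n from the boundary of the
unit cube, which is exactly `gridShift n`. -/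
theorem gridPoint_cellNode_mem {d k n : ℕ} (s : Fin d → Bool) {l : List (Fin d → Bool)}
    (hl : l.length ≤ n) (a : Fin d → Fin (k + 1)) : gridPoint n s (cellNode l a) ∈ cube d := by
  intro i
  have h := coord_mem_of_loc_mem l (y := cellNode l a) (i := i) (μ := 1 / 4) (by
    rw [loc_cellNode]
    exact node_mem k (a i))
  have h1 : gridShift n ≤ 1 / 4 / 2 ^ l.length := by
    have h2 : (2 : ℝ) ^ l.length ≤ 2 ^ n := pow_le_pow_right₀ (by norm_num) hl
    rw [gridShift, div_div]
    refine div_le_div_of_nonneg_left zero_le_one (by positivity) ?_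
    rw [pow_add]
    linarith
  have h0 := gridShift_pos n
  have h4 := gridShift_le n
  have h5 : 0 < 1 - gridShift n := by linarith
  simp only [gridPoint]
  rw [mem_Icc, le_div_iff₀ h5, div_le_iff₀ h5]
  obtain ⟨h6, h7⟩ := h
  cases s i <;> simp only [bit] <;> constructor <;> simp <;> linarith

theorem comp_affine_mem_tensorPoly {d k : ℕ} {T : (Fin d → ℝ) → ℝ} (hT : T ∈ tensorPoly d k)
    (b : Fin d → ℝ) (c : ℝ) : (fun y : Fin d → ℝ => T fun i => (y i - b i) / c) ∈ tensorPoly d k := by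
  induction hT using Submodule.span_induction with
  | mem p hp =>
    obtain ⟨q, hq, rfl⟩ := hp
    have : (fun y : Fin d → ℝ => ∏ i, (q i).eval ((y i - b i) / c)) = fun y : Fin d → ℝ => ∏ i,
        ((q i).comp (C c⁻¹ * X + C (-b i / c))).eval (y i) := by
      funext y
      refine Finset.prod_congr rfl fun i _ => ?_
      simp only [eval_comp, eval_add, eval_mul, eval_C, eval_X]
      congr 1
      ring
    simp only
    rw [this]
    refine prod_eval_mem_tensorPoly _ fun i => natDegree_comp_le.trans ?_
    exact (Nat.mul_le_mul (hq i) (natDegree_linear_le)).trans (by simp)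
  | zero => exact Submodule.zero_mem _
  | add p p' _ _ h h' => exact Submodule.add_mem _ h h'
  | smul e p _ h => exact Submodule.smul_mem _ e h

theorem exists_sum_abs_tlag_le (d k : ℕ) : ∃ S : ℝ, 1 ≤ S ∧ ∀ ξ : Fin d → ℝ,
    (∀ i, ξ i ∈ Icc (0 : ℝ) 1) → ∑ a : Fin d → Fin (k + 1), |tlag a ξ| ≤ S := by
  obtain ⟨Λ, hΛ, h⟩ := exists_lag_bound k
  refine ⟨1 + Fintype.card (Fin d → Fin (k + 1)) * Λ ^ d,
    by linarith [show 0 ≤ Fintype.card (Fin d → Fin (k + 1)) * Λ ^ d by positivity],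
    fun ξ hξ => ?_⟩
  calc ∑ a : Fin d → Fin (k + 1), |tlag a ξ| ≤ ∑ _a : Fin d → Fin (k + 1), Λ ^ d := by
        refine Finset.sum_le_sum fun a _ => ?_
        rw [tlag, Finset.abs_prod]
        calc _ ≤ ∏ _i : Fin d, Λ := Finset.prod_le_prod (fun _ _ => abs_nonneg _) fun i _ =>
              (h (a i)).2.1 _ ⟨by linarith [(hξ i).1], by linarith [(hξ i).2]⟩
          _ = Λ ^ d := by simp
    _ ≤ _ := by simp

/-- Quantized multilevel approximations of Hölder functions. -/
theorem exists_refine_bound {d : ℕ} (hd : 0 < d) {r : ℝ} (hr : 0 < r) :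
    ∃ K : ℝ, 0 < K ∧ ∃ m : ℕ, ∀ n : ℕ, ∀ s : Fin d → Bool, ∀ f ∈ holderBall d r,
      ∀ c w : List (Fin d → Bool), (w ++ c).length ≤ n → ∀ x ∈ cube d,
        (∀ i, loc (w ++ c) (gridCoord n s x) i ∈ Icc (0 : ℝ) 1) →
          |f x - refine (intPart r) m r K (fun y => f (gridPoint n s y)) c w (gridCoord n s x)| ≤
            refScale r K (w ++ c).length := by
  set k := intPart r
  obtain ⟨S, hS1, hS⟩ := exists_sum_abs_tlag_le d k
  set C : ℝ := (d : ℝ) ^ (k + 1) * 2 ^ r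
  have hC : 0 < C := by positivity
  -- The number of signs per coefficient depends only on d and r, not on the level.
  obtain ⟨m, hm⟩ := exists_pow_lt_of_lt_one (show (0 : ℝ) < 1 / (2 * S * 2 ^ r) by positivity)
    (show (1 / 2 : ℝ) < 1 by norm_num)
  refine ⟨2 * ((1 + S) * C), by positivity, m, fun n s f hf c w hl x hx hxl => ?_⟩
  have hm' : S * ((1 / 2) ^ m * 2 ^ r) ≤ 1 / 2 := by
    rw [lt_div_iff₀ (by positivity)] at hm
    linarith
  have h := abs_sub_refine_le (g := fun y => f (gridPoint n s y)) (k := k) (m := m) (n := n)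
    (r := r) (K := 2 * ((1 + S) * C)) (D := {y | gridPoint n s y ∈ cube d}) hC.le (by positivity)
    ?_ (fun l hl a => gridPoint_cellNode_mem s hl a) hS (by linarith) hm' c w hl
    (y := gridCoord n s x) (by simpa [gridPoint_gridCoord] using hx) hxl
  · simpa [gridPoint_gridCoord] using h
  · intro l hl
    set y₀ : Fin d → ℝ := cellNode l (fun _ => (0 : Fin (k + 1)))
    obtain ⟨T, hT, hfT⟩ := exists_tensorPoly_approx hd hr hf
      (gridPoint_cellNode_mem s hl (fun _ => (0 : Fin (k + 1))))
    refine ⟨_, comp_affine_mem_tensorPoly hT (fun i => bit (s i) * gridShift n)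
      (1 - gridShift n), fun y hy hyl => ?_⟩
    have h4 := gridShift_le n
    -- The factor 2 absorbs the stretching 1/(1 - `gridShift n`) ≤ 4/3 of the inverse coordinate
    -- change.
    have hclose : ∀ i, |gridPoint n s y i - gridPoint n s y₀ i| ≤ 2 * 2 ^ (-(l.length : ℝ)) := by
      intro i
      have h1 := hyl i
      have h2 : loc l y₀ i ∈ Icc (0 : ℝ) 1 := by
        rw [loc_cellNode]
        have := node_mem k 0
        exact ⟨by linarith [this.1], by linarith [this.2]⟩
      rw [loc_eq] at h1 h2
      have h3 : |2 ^ l.length * (y i - y₀ i)| ≤ 1 := by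
        rw [abs_le]
        constructor <;> linarith [h1.1, h1.2, h2.1, h2.2]
      rw [abs_mul, abs_of_pos (by positivity)] at h3
      have h5 : gridPoint n s y i - gridPoint n s y₀ i = (y i - y₀ i) / (1 - gridShift n) := by
        simp only [gridPoint]
        ring
      rw [h5, abs_div, abs_of_pos (show 0 < 1 - gridShift n by linarith),
        div_le_iff₀ (by linarith), Real.rpow_neg two_pos.le, Real.rpow_natCast]
      have h6 : |y i - y₀ i| ≤ (2 ^ l.length)⁻¹ := by
        rw [← one_div, le_div_iff₀ (by positivity)]
        linarith
      have h7 : (0 : ℝ) < (2 ^ l.length)⁻¹ := by positivity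
      nlinarith
    have h := hfT _ hy _ hclose
    have he : (d : ℝ) ^ (k + 1) * (2 * 2 ^ (-(l.length : ℝ))) ^ r =
        C * 2 ^ (-(r * l.length)) := by
      rw [Real.mul_rpow two_pos.le (by positivity), ← Real.rpow_mul two_pos.le]
      simp only [C]
      rw [show -(l.length : ℝ) * r = -(r * l.length) by ring]
      ring
    rw [← he]
    exact h

end DeepNet

end

noncomputable section

namespace DeepNet

open Set

/-! ### Amplification of signs -/

/-- A cubic polynomial whose iterates approximate the sign function on `[-1,1]`. -/
def amp (x : ℝ) : ℝ := (3 * x - x ^ 3) / 2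

/-- The factorization shows that the defect 1 - x² is at least squared by each step, so the iterates
converge doubly exponentially. -/
theorem one_sub_amp_sq (x : ℝ) :
    1 - amp x ^ 2 = (1 - x ^ 2) ^ 2 * (1 - x ^ 2 / 4) := by
  rw [amp]
  ring

theorem abs_amp_le {x : ℝ} (hx : |x| ≤ 1) : |amp x| ≤ 1 := by
  have h1 : x ^ 2 ≤ 1 := (sq_le_one_iff_abs_le_one x).mpr hx
  have h2 : 0 ≤ 1 - amp x ^ 2 := by
    rw [one_sub_amp_sq]
    have : 0 ≤ 1 - x ^ 2 / 4 := by linarith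
    positivity
  exact (sq_le_one_iff_abs_le_one _).mp (by linarith)

theorem abs_iterate_amp_le {x : ℝ} (hx : |x| ≤ 1) (K : ℕ) : |amp^[K] x| ≤ 1 := by
  induction K with
  | zero => simpa using hx
  | succ K ih =>
    rw [Function.iterate_succ_apply']
    exact abs_amp_le ih

theorem iterate_amp_nonneg {x : ℝ} (hx : |x| ≤ 1) (hx0 : 0 ≤ x) (K : ℕ) : 0 ≤ amp^[K] x := by
  induction K with
  | zero => simpa using hx0
  | succ K ih =>
    rw [Function.iterate_succ_apply', amp]
    have h1 := abs_iterate_amp_le hx K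
    have h2 : (amp^[K] x) ^ 2 ≤ 1 := (sq_le_one_iff_abs_le_one _).mpr h1
    nlinarith

theorem one_sub_iterate_amp_sq_le {x : ℝ} (hx : |x| ≤ 1) (K : ℕ) :
    1 - (amp^[K] x) ^ 2 ≤ (1 - x ^ 2) ^ 2 ^ K := by
  induction K with
  | zero => simp
  | succ K ih =>
    rw [Function.iterate_succ_apply', one_sub_amp_sq, pow_succ 2, pow_mul]
    have h2 : (amp^[K] x) ^ 2 ≤ 1 := (sq_le_one_iff_abs_le_one _).mpr (abs_iterate_amp_le hx K)
    have h3 := sq_nonneg (amp^[K] x)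
    calc _ ≤ (1 - (amp^[K] x) ^ 2) ^ 2 * 1 := by
          gcongr
          linarith
      _ ≤ ((1 - x ^ 2) ^ 2 ^ K) ^ 2 := by
          rw [mul_one]
          gcongr

theorem iterate_amp_neg (x : ℝ) (K : ℕ) : amp^[K] (-x) = -amp^[K] x := by
  induction K with
  | zero => simp
  | succ K ih =>
    rw [Function.iterate_succ_apply', Function.iterate_succ_apply', ih, amp, amp]
    ring

/-- The accuracy of the sign after `K` amplification steps with an initial margin `γ`. -/
def ampErr (γ : ℝ) (K : ℕ) : ℝ := Real.exp (-(γ ^ 2 * 2 ^ K))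

/-- For positive sign, 1 - y ≤ 1 - y² ≤ (1 - γ²)^(2^K) ≤ exp(-γ² 2^K) with y the K-th iterate; the
other sign follows because the cubic is odd. -/
theorem abs_iterate_amp_sub_sgn_le {x γ : ℝ} (hx : |x| ≤ 1) (hγ : 0 ≤ γ) (K : ℕ) {b : Bool}
    (h : γ ≤ sgn b * x) : |amp^[K] x - sgn b| ≤ ampErr γ K := by
  have key : ∀ x : ℝ, |x| ≤ 1 → γ ≤ x → |amp^[K] x - 1| ≤ ampErr γ K := by
    intro x hx h
    have h0 := iterate_amp_nonneg hx (hγ.trans h) K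
    have h1 := abs_le.mp (abs_iterate_amp_le hx K)
    have h2 := one_sub_iterate_amp_sq_le hx K
    rw [abs_sub_comm, abs_of_nonneg (by linarith [h1.2])]
    have h3 : 1 - amp^[K] x ≤ 1 - (amp^[K] x) ^ 2 := by nlinarith [h1.2]
    have h4 : 0 ≤ 1 - x ^ 2 := by
      have := (sq_le_one_iff_abs_le_one x).mpr hx
      linarith
    calc _ ≤ (1 - x ^ 2) ^ 2 ^ K := h3.trans h2
      _ ≤ Real.exp (-γ ^ 2) ^ 2 ^ K := by
          gcongr
          have h5 := Real.add_one_le_exp (-γ ^ 2)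
          have h6 : γ ^ 2 ≤ x ^ 2 := by gcongr
          linarith
      _ = ampErr γ K := by
          rw [ampErr, ← Real.exp_nat_mul]
          congr 1
          push_cast
          ring
  cases b
  · have h' := key (-x) (by simpa using hx) (by simpa [sgn] using h)
    rw [iterate_amp_neg] at h'
    rw [← abs_neg]
    convert h' using 2
    simp [sgn]
    ring
  · simpa [sgn] using key x hx (by simpa [sgn] using h)

theorem ampErr_anti {γ δ : ℝ} (hγ : 0 ≤ γ) (h : γ ≤ δ) (K : ℕ) : ampErr δ K ≤ ampErr γ K := by
  rw [ampErr, ampErr]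
  gcongr

/-! ### Storing a sequence of signs in a real number -/

/-- The quartic Chebyshev polynomial. -/
def quart (z : ℝ) : ℝ := 2 * (2 * z ^ 2 - 1) ^ 2 - 1

theorem abs_double_le {z : ℝ} (hz : |z| ≤ 1) : |2 * z ^ 2 - 1| ≤ 1 := by
  have := (sq_le_one_iff_abs_le_one z).mpr hz
  have := sq_nonneg z
  rw [abs_le]
  constructor <;> linarith

theorem abs_quart_le {z : ℝ} (hz : |z| ≤ 1) : |quart z| ≤ 1 := abs_double_le (abs_double_le hz)

theorem abs_iterate_quart_le {z : ℝ} (hz : |z| ≤ 1) (t : ℕ) : |quart^[t] z| ≤ 1 := by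
  induction t with
  | zero => simpa using hz
  | succ t ih =>
    rw [Function.iterate_succ_apply']
    exact abs_quart_le ih

theorem abs_double_sub_le {z z' : ℝ} (hz : |z| ≤ 1) (hz' : |z'| ≤ 1) :
    |(2 * z ^ 2 - 1) - (2 * z' ^ 2 - 1)| ≤ 4 * |z - z'| := by
  have h : (2 * z ^ 2 - 1) - (2 * z' ^ 2 - 1) = 2 * (z + z') * (z - z') := by ring
  rw [h, abs_mul, abs_mul, abs_two]
  gcongr
  linarith [abs_add_le z z']

/-- T₄ = T₂ ∘ T₂ and T₂ is 4-Lipschitz on [-1,1]. -/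
theorem abs_iterate_quart_sub_le {z z' : ℝ} (hz : |z| ≤ 1) (hz' : |z'| ≤ 1) (t : ℕ) :
    |quart^[t] z - quart^[t] z'| ≤ 16 ^ t * |z - z'| := by
  induction t with
  | zero => simp
  | succ t ih =>
    rw [Function.iterate_succ_apply', Function.iterate_succ_apply', pow_succ]
    have h1 := abs_iterate_quart_le hz t
    have h2 := abs_iterate_quart_le hz' t
    have h3 := abs_double_sub_le (abs_double_le h1) (abs_double_le h2)
    have h4 := abs_double_sub_le h1 h2
    simp only [quart] at h3 h4 ih ⊢
    linarith

/-- Built backwards: given the code e of the tail, take the preimage of e under T₄ with the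
prescribed sign and largest modulus. T₄ maps [1/√2, 1] onto [-1,1], so the modulus exceeds 1/2. T₂
would not do, as its preimages may be close to 0. -/
theorem exists_code (M : ℕ) (s : ℕ → Bool) :
    ∃ z : ℝ, |z| ≤ 1 ∧ ∀ t < M, 1 / 2 ≤ sgn (s t) * quart^[t] z := by
  induction M generalizing s with
  | zero => exact ⟨0, by simp, by simp⟩
  | succ M ih =>
    obtain ⟨e, he, h⟩ := ih fun t => s (t + 1)
    have he' := abs_le.mp he
    set y := √((1 + e) / 2) with hy
    have hy0 : 0 ≤ y := Real.sqrt_nonneg _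
    have hy2 : y ^ 2 = (1 + e) / 2 := Real.sq_sqrt (by linarith)
    set x := √((1 + y) / 2) with hx
    have hx0 : 0 ≤ x := Real.sqrt_nonneg _
    have hx2 : x ^ 2 = (1 + y) / 2 := Real.sq_sqrt (by linarith)
    have hy1 : y ≤ 1 := by nlinarith
    have hx1 : x ≤ 1 := by nlinarith
    have hxh : 1 / 2 ≤ x := by nlinarith
    have hq : quart (sgn (s 0) * x) = e := by
      have hs : sgn (s 0) ^ 2 = 1 := by cases s 0 <;> simp [sgn]
      rw [quart, mul_pow, hs, one_mul, hx2]
      nlinarith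
    refine ⟨sgn (s 0) * x, ?_, fun t ht => ?_⟩
    · rw [abs_mul, abs_sgn, one_mul, abs_of_nonneg hx0]
      exact hx1
    · rcases t with _ | t
      · rw [Function.iterate_zero, id, ← mul_assoc]
        have hs : sgn (s 0) * sgn (s 0) = 1 := by cases s 0 <;> simp [sgn]
        rw [hs]
        linarith
      · rw [Function.iterate_succ_apply, hq]
        exact h t (by omega)

/-! ### Trigonometric functions by repeated doubling -/

/-- An approximation of `exp (2 π i y / 2 ^ m)` in the unit disk. -/
def rotStart (m : ℕ) (y : ℝ) : ℂ :=
  ((1 - (2 * Real.pi / 2 ^ m) ^ 2 : ℝ) : ℂ) * (1 + ((2 * Real.pi / 2 ^ m * y : ℝ) : ℂ) * Complex.I)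

/-- An approximation of `exp (2 π i 2 ^ k y)`, obtained by squaring. -/
def rot (n : ℕ) (y : ℝ) (k : ℕ) : ℂ := rotStart (2 * n + 12) y ^ 2 ^ (2 * n + 12 + k)

theorem abs_pow_sub_pow_le {z w : ℂ} (hz : ‖z‖ ≤ 1) (hw : ‖w‖ ≤ 1) (N : ℕ) :
    ‖z ^ N - w ^ N‖ ≤ N * ‖z - w‖ := by
  induction N with
  | zero => simp
  | succ N ih =>
    have h : z ^ (N + 1) - w ^ (N + 1) = z ^ N * (z - w) + (z ^ N - w ^ N) * w := by ring
    rw [h]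
    refine (norm_add_le _ _).trans ?_
    rw [norm_mul, norm_mul, norm_pow]
    have h1 : ‖z‖ ^ N ≤ 1 := pow_le_one₀ (norm_nonneg _) hz
    have h2 : ‖z ^ N - w ^ N‖ * ‖w‖ ≤ ‖z ^ N - w ^ N‖ := mul_le_of_le_one_right (norm_nonneg _) hw
    have h3 : ‖z‖ ^ N * ‖z - w‖ ≤ ‖z - w‖ := mul_le_of_le_one_left (norm_nonneg _) h1
    push_cast
    linarith

/-- 1 + it agrees with e^(it) to second order but lies outside the unit disk. The factor 1 - τ²
pulls it inside at a cost of order τ², so that high powers remain stable. -/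
theorem rotStart_bounds {m : ℕ} (hm : 3 ≤ m) {y : ℝ} (hy : y ∈ Icc (0 : ℝ) 1) :
    ‖rotStart m y‖ ≤ 1 ∧
      ‖rotStart m y - Complex.exp (((2 * Real.pi / 2 ^ m * y : ℝ) : ℂ) * Complex.I)‖ ≤
        3 * (2 * Real.pi / 2 ^ m) ^ 2 := by
  set τ := 2 * Real.pi / 2 ^ m with hτ
  have hτ0 : 0 < τ := by positivity
  have hτ1 : τ ≤ 1 := by
    rw [hτ, div_le_one (by positivity)]
    have h1 : (2 : ℝ) ^ 3 ≤ 2 ^ m := pow_le_pow_right₀ (by norm_num) hm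
    linarith [Real.pi_lt_four]
  set t := τ * y with ht
  have ht0 : 0 ≤ t := mul_nonneg hτ0.le hy.1
  have htτ : t ≤ τ := mul_le_of_le_one_right hτ0.le hy.2
  have hsq : τ ^ 2 ≤ 1 := by nlinarith
  have htt : t ^ 2 ≤ τ ^ 2 := by gcongr
  have hn : ‖(1 : ℂ) + (t : ℂ) * Complex.I‖ ^ 2 = 1 + t ^ 2 := by
    rw [← Complex.normSq_eq_norm_sq, Complex.normSq_apply]
    simp
    ring
  have hnn := norm_nonneg ((1 : ℂ) + (t : ℂ) * Complex.I)
  have hz : rotStart m y = ((1 - τ ^ 2 : ℝ) : ℂ) * (1 + (t : ℂ) * Complex.I) := rfl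
  constructor
  · rw [hz, norm_mul, Complex.norm_real, Real.norm_eq_abs, abs_of_nonneg (by linarith)]
    rw [← abs_of_nonneg (mul_nonneg (show 0 ≤ 1 - τ ^ 2 by linarith) hnn),
      ← sq_le_one_iff_abs_le_one, mul_pow, hn]
    calc (1 - τ ^ 2) ^ 2 * (1 + t ^ 2) ≤ (1 - τ ^ 2) ^ 2 * (1 + τ ^ 2) := by gcongr
      _ = (1 - τ ^ 2) * (1 - τ ^ 2 * τ ^ 2) := by ring
      _ ≤ 1 := by nlinarith [mul_nonneg (sq_nonneg τ) (sq_nonneg τ)]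
  · have h1 : ‖Complex.exp ((t : ℂ) * Complex.I) - 1 - (t : ℂ) * Complex.I‖ ≤ τ ^ 2 := by
      refine (Complex.norm_exp_sub_one_sub_id_le ?_).trans ?_
      · simp [abs_of_nonneg ht0]
        linarith
      · simpa using htt
    have h2 : rotStart m y - Complex.exp ((t : ℂ) * Complex.I) =
        -(Complex.exp ((t : ℂ) * Complex.I) - 1 - (t : ℂ) * Complex.I) -
          ((τ ^ 2 : ℝ) : ℂ) * (1 + (t : ℂ) * Complex.I) := by
      rw [hz]
      push_cast
      ring
    rw [h2]
    refine (norm_sub_le _ _).trans ?_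
    rw [norm_neg, norm_mul, Complex.norm_real, Real.norm_eq_abs, abs_of_nonneg (sq_nonneg τ)]
    have h3 : ‖(1 : ℂ) + (t : ℂ) * Complex.I‖ ≤ 2 := by nlinarith
    nlinarith [sq_nonneg τ]

theorem norm_rot_le (n : ℕ) {y : ℝ} (hy : y ∈ Icc (0 : ℝ) 1) (k : ℕ) : ‖rot n y k‖ ≤ 1 := by
  rw [rot, norm_pow]
  exact pow_le_one₀ (norm_nonneg _) (rotStart_bounds (by omega) hy).1

/-- In the disk, N-th powers amplify errors by at most N. The initial error 12π²·4^(-m) times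
2^(m+n) is 12π²·2^(n-m), and m = 2n + 12 makes it small compared with 2^(-n). -/
theorem norm_rot_sub_exp_le {n k : ℕ} (hk : k ≤ n) {y : ℝ} (hy : y ∈ Icc (0 : ℝ) 1) :
    ‖rot n y k - Complex.exp ((2 * Real.pi * 2 ^ k * y : ℝ) * Complex.I)‖ ≤ 1 / 32 / 2 ^ n := by
  set m := 2 * n + 12
  obtain ⟨h1, h2⟩ := rotStart_bounds (m := m) (by omega) hy
  have h3 : Complex.exp ((2 * Real.pi * 2 ^ k * y : ℝ) * Complex.I) =
      Complex.exp (((2 * Real.pi / 2 ^ m * y : ℝ) : ℂ) * Complex.I) ^ 2 ^ (m + k) := by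
    rw [← Complex.exp_nat_mul]
    congr 1
    push_cast
    rw [pow_add]
    field_simp
  have h4 : ‖Complex.exp (((2 * Real.pi / 2 ^ m * y : ℝ) : ℂ) * Complex.I)‖ ≤ 1 :=
    (Complex.norm_exp_ofReal_mul_I _).le
  rw [h3, rot]
  refine (abs_pow_sub_pow_le h1 h4 _).trans ?_
  have h5 : Real.pi ^ 2 ≤ 10 := by nlinarith [Real.pi_lt_d2, Real.pi_pos]
  have h6 : (2 : ℝ) ^ (m + k) ≤ 2 ^ (m + n) := pow_le_pow_right₀ (by norm_num) (by omega)
  calc ((2 ^ (m + k) : ℕ) : ℝ) * _ ≤ 2 ^ (m + n) * (3 * (2 * Real.pi / 2 ^ m) ^ 2) := by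
        rw [Nat.cast_pow, Nat.cast_ofNat]
        exact mul_le_mul h6 h2 (norm_nonneg _) (by positivity)
    _ = 12 * Real.pi ^ 2 * (2 ^ n / 2 ^ m) := by
        rw [pow_add, div_pow]
        field_simp
        ring
    _ = 12 * Real.pi ^ 2 / 4096 / 2 ^ n := by
        have : (2 : ℝ) ^ m = 2 ^ n * 2 ^ n * 4096 := by
          simp only [m]
          rw [pow_add, two_mul, pow_add]
          norm_num
        rw [this]
        field_simp
    _ ≤ 1 / 32 / 2 ^ n := by
        refine div_le_div_of_nonneg_right ?_ (by positivity)
        linarith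

/-! ### Binary digits -/

/-- A binary digit of `y`. -/
def digit (y : ℝ) (k : ℕ) : Bool := decide (Real.sin (2 * Real.pi * 2 ^ k * y) < 0)

/-- The fractional part of `2 ^ k y`, in terms of the digits. -/
def fracPart (y : ℝ) : ℕ → ℝ
  | 0 => y
  | k + 1 => 2 * fracPart y k - bit (digit y k)

/-- Since |sin 2t| ≤ 2|sin t|, a lower bound at the finest frequency passes to all coarser ones: a
point away from the finest grid is away from every coarser grid. -/
theorem abs_sin_ge {n k : ℕ} (hk : k < n) {y : ℝ} (h : 1 / 8 ≤ |Real.sin (2 ^ n * Real.pi * y)|) :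
    1 / 8 / 2 ^ n ≤ |Real.sin (2 * Real.pi * 2 ^ k * y)| := by
  have key : ∀ j : ℕ, ∀ t : ℝ, |Real.sin (2 ^ j * t)| ≤ 2 ^ j * |Real.sin t| := by
    intro j t
    induction j with
    | zero => simp
    | succ j ih =>
      rw [show (2 : ℝ) ^ (j + 1) * t = 2 * (2 ^ j * t) by ring, Real.sin_two_mul, abs_mul, abs_mul,
        abs_two, pow_succ]
      have h1 := Real.abs_cos_le_one (2 ^ j * t)
      have h2 := abs_nonneg (Real.sin (2 ^ j * t))
      nlinarith
  obtain ⟨j, rfl⟩ : ∃ j, n = k + 1 + j := ⟨n - (k + 1), by omega⟩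
  have h1 := key j (2 * Real.pi * 2 ^ k * y)
  rw [show (2 : ℝ) ^ j * (2 * Real.pi * 2 ^ k * y) = 2 ^ (k + 1 + j) * Real.pi * y by
    rw [pow_add, pow_add]; ring] at h1
  rw [div_le_iff₀ (by positivity)]
  have h2 : (2 : ℝ) ^ j ≤ 2 ^ (k + 1 + j) := pow_le_pow_right₀ (by norm_num) (by omega)
  have h3 := abs_nonneg (Real.sin (2 * Real.pi * 2 ^ k * y))
  nlinarith

/-- Modulo 2π the argument of the sine is 2π times the current fractional part, whose half of [0,1]
is read off from the sign. The hypothesis excludes a zero sine, where the half would be ambiguous.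
-/
theorem fracPart_mem {n : ℕ} {y : ℝ} (hy : y ∈ Icc (0 : ℝ) 1)
    (h : 1 / 8 ≤ |Real.sin (2 ^ n * Real.pi * y)|) {k : ℕ} (hk : k ≤ n) :
    fracPart y k ∈ Icc (0 : ℝ) 1 := by
  suffices H : fracPart y k ∈ Icc (0 : ℝ) 1 ∧ ∃ N : ℤ, fracPart y k = 2 ^ k * y - N from H.1
  induction k with
  | zero => exact ⟨hy, 0, by simp [fracPart]⟩
  | succ k ih =>
    obtain ⟨⟨h0, h1⟩, N, hN⟩ := ih (by omega)
    have hsin : Real.sin (2 * Real.pi * 2 ^ k * y) = Real.sin (2 * Real.pi * fracPart y k) := by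
      rw [hN, show 2 * Real.pi * (2 ^ k * y - N) = 2 * Real.pi * 2 ^ k * y - N * (2 * Real.pi) by
        ring, Real.sin_sub_int_mul_two_pi]
    have hne : Real.sin (2 * Real.pi * 2 ^ k * y) ≠ 0 := by
      have := abs_sin_ge (show k < n by omega) h
      have h8 : (0 : ℝ) < 1 / 8 / 2 ^ n := by positivity
      exact abs_pos.mp (h8.trans_le this)
    have hpi := Real.pi_pos
    by_cases hlt : Real.sin (2 * Real.pi * 2 ^ k * y) < 0
    · have hd : digit y k = true := by simp [digit, hlt]
      have : 1 / 2 < fracPart y k := by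
        by_contra hc
        push Not at hc
        rw [hsin] at hlt
        exact absurd (Real.sin_nonneg_of_nonneg_of_le_pi (by positivity) (by nlinarith))
          (not_le.mpr hlt)
      simp only [fracPart, hd, bit, if_true]
      refine ⟨⟨by linarith, by linarith⟩, 2 * N + 1, ?_⟩
      rw [hN]
      push_cast
      ring
    · have hd : digit y k = false := by simp [digit, hlt]
      have : fracPart y k ≤ 1 / 2 := by
        by_contra hc
        push Not at hc
        have h2 : 0 < Real.sin (2 * Real.pi * 2 ^ k * y) := lt_of_le_of_ne (not_lt.mp hlt) hne.symm
        rw [hsin, show 2 * Real.pi * fracPart y k =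
          (2 * Real.pi * fracPart y k - 2 * Real.pi) + 2 * Real.pi by ring, Real.sin_add_two_pi] at h2
        exact absurd (Real.sin_nonpos_of_nonpos_of_neg_pi_le (x := 2 * Real.pi * fracPart y k -
          2 * Real.pi) (by nlinarith) (by nlinarith)) (not_le.mpr h2)
      simp only [fracPart, hd, bit]
      refine ⟨⟨by simp; linarith, by simp; linarith⟩, 2 * N, ?_⟩
      rw [hN]
      push_cast
      simp
      ring

/-- The approximate digits computed by the network. -/
def netDigit (n K : ℕ) (y : ℝ) (k : ℕ) : ℝ := (1 - amp^[K] (rot n y k).im) / 2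

theorem netDigit_mem (n K : ℕ) {y : ℝ} (hy : y ∈ Icc (0 : ℝ) 1) (k : ℕ) :
    netDigit n K y k ∈ Icc (0 : ℝ) 1 := by
  have h := abs_le.mp (abs_iterate_amp_le
    ((Complex.abs_im_le_norm _).trans (norm_rot_le n hy k)) K)
  rw [netDigit, mem_Icc]
  constructor <;> linarith

/-- The rotation error 2^(-n)/32 leaves a margin of at least 2^(-n)/16 from the sine bound 2^(-n)/8,
which the amplifier turns into the correct sign. A negative sine means digit 1, hence the negated
sign. -/
theorem abs_netDigit_sub_le {n K k : ℕ} {y : ℝ} (hy : y ∈ Icc (0 : ℝ) 1) (hk : k < n)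
    (h : 1 / 8 ≤ |Real.sin (2 ^ n * Real.pi * y)|) :
    |netDigit n K y k - bit (digit y k)| ≤ ampErr (1 / 16 / 2 ^ n) K := by
  have h1 := abs_sin_ge hk h
  have h2 := norm_rot_sub_exp_le hk.le hy
  have h3 : (Complex.exp ((2 * Real.pi * 2 ^ k * y : ℝ) * Complex.I)).im =
      Real.sin (2 * Real.pi * 2 ^ k * y) := by
    rw [Complex.exp_ofReal_mul_I_im]
  have h4 : |(rot n y k).im - Real.sin (2 * Real.pi * 2 ^ k * y)| ≤ 1 / 32 / 2 ^ n := by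
    rw [← h3, ← Complex.sub_im]
    exact (Complex.abs_im_le_norm _).trans h2
  have h5 : (0 : ℝ) < 1 / 2 ^ n := by positivity
  have e1 : (1 / 8 / 2 ^ n : ℝ) = 1 / 8 * (1 / 2 ^ n) := by ring
  have e2 : (1 / 32 / 2 ^ n : ℝ) = 1 / 32 * (1 / 2 ^ n) := by ring
  have e3 : (1 / 16 / 2 ^ n : ℝ) = 1 / 16 * (1 / 2 ^ n) := by ring
  have hs : 1 / 16 / 2 ^ n ≤ sgn (!digit y k) * (rot n y k).im := by
    rw [abs_le] at h4
    rw [e2] at h4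
    rw [e1] at h1
    rw [e3]
    generalize (1 : ℝ) / 2 ^ n = e at h1 h4 h5 ⊢
    by_cases hlt : Real.sin (2 * Real.pi * 2 ^ k * y) < 0
    · rw [abs_of_neg hlt] at h1
      simp [digit, hlt, sgn] at h4 ⊢
      linarith
    · rw [abs_of_nonneg (not_lt.mp hlt)] at h1
      simp [digit, hlt, sgn] at h4 ⊢
      linarith
  have h6 := abs_iterate_amp_sub_sgn_le ((Complex.abs_im_le_norm _).trans (norm_rot_le n hy k))
    (by positivity) K hs
  have h7 : netDigit n K y k - bit (digit y k) =
      -(1 / 2) * (amp^[K] (rot n y k).im - sgn (!digit y k)) := by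
    rw [netDigit]
    cases digit y k <;> simp [bit, sgn] <;> ring
  rw [h7, abs_mul]
  have := abs_nonneg (amp^[K] (rot n y k).im - sgn (!digit y k))
  rw [abs_neg, abs_of_pos (by norm_num)]
  linarith

/-! ### The partition of unity -/

/-- The weight of the shifted grid. -/
def netWeight (n K : ℕ) (y : ℝ) : ℝ := (1 + amp^[K] (((rot n y n).re + (rot n y n).im) / 2)) / 2

theorem abs_re_add_im_le (n : ℕ) {y : ℝ} (hy : y ∈ Icc (0 : ℝ) 1) :
    |((rot n y n).re + (rot n y n).im) / 2| ≤ 1 := by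
  have h1 := (Complex.abs_re_le_norm _).trans (norm_rot_le n hy n)
  have h2 := (Complex.abs_im_le_norm _).trans (norm_rot_le n hy n)
  rw [abs_le] at h1 h2 ⊢
  constructor <;> linarith [h1.1, h1.2, h2.1, h2.2]

theorem netWeight_mem (n K : ℕ) {y : ℝ} (hy : y ∈ Icc (0 : ℝ) 1) :
    netWeight n K y ∈ Icc (0 : ℝ) 1 := by
  have h := abs_le.mp (abs_iterate_amp_le (abs_re_add_im_le n hy) K)
  rw [netWeight, mem_Icc]
  constructor <;> linarith

/-- The weight of a grid is tiny near the boundaries of its cells. -/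
theorem weight_le_of_abs_sin_lt {n K : ℕ} {y : ℝ} (hy : y ∈ Icc (0 : ℝ) 1) (b : Bool)
    (h : |Real.sin (2 ^ n * Real.pi * (y + bit b * gridShift n))| < 1 / 8) :
    (if b then netWeight n K y else 1 - netWeight n K y) ≤ ampErr (1 / 4) K := by
  have h2 := norm_rot_sub_exp_le (le_refl n) hy
  set θ := 2 * Real.pi * 2 ^ n * y with hθ
  have hn : (1 / 32 / 2 ^ n : ℝ) ≤ 1 / 32 :=
    div_le_self (by norm_num) (one_le_pow₀ (by norm_num))
  have hre : |(rot n y n).re - Real.cos θ| ≤ 1 / 32 := by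
    rw [← Complex.exp_ofReal_mul_I_re, ← Complex.sub_re]
    exact (Complex.abs_re_le_norm _).trans (h2.trans hn)
  have him : |(rot n y n).im - Real.sin θ| ≤ 1 / 32 := by
    rw [← Complex.exp_ofReal_mul_I_im, ← Complex.sub_im]
    exact (Complex.abs_im_le_norm _).trans (h2.trans hn)
  have hpn : (2 : ℝ) ^ n * Real.pi * gridShift n = Real.pi / 4 := by
    rw [gridShift, pow_add]
    field_simp
    norm_num
  set φ := 2 ^ n * Real.pi * (y + bit b * gridShift n) with hφ
  have hsin2 : |Real.sin (2 * φ)| ≤ 1 / 4 := by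
    rw [Real.sin_two_mul, abs_mul, abs_mul, abs_two]
    have := Real.abs_cos_le_one φ
    have := abs_nonneg (Real.sin φ)
    nlinarith
  have hcos2 : 31 / 32 ≤ Real.cos (2 * φ) := by
    rw [Real.cos_two_mul']
    have h3 := Real.sin_sq_add_cos_sq φ
    have h4 : Real.sin φ ^ 2 ≤ 1 / 64 := by
      rw [← sq_abs]
      nlinarith [abs_nonneg (Real.sin φ)]
    linarith
  rw [abs_le] at hre him hsin2
  -- Near the boundaries of either grid 2φ is close to 0 modulo 2π. The shift by a quarter cell is a
  -- rotation by π/2, so cos θ + sin θ is near 1 for the unshifted grid and near -1 for the shifted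
  -- one.
  have hs : 1 / 4 ≤ sgn (!b) * (((rot n y n).re + (rot n y n).im) / 2) := by
    cases b
    · have : θ = 2 * φ := by
        simp only [hθ, hφ, bit]
        simp
        ring
      rw [this] at hre him
      simp [sgn]
      linarith
    · have : θ = 2 * φ - Real.pi / 2 := by
        have : φ = 2 ^ n * Real.pi * y + Real.pi / 4 := by
          simp only [hφ, bit, if_true, one_mul, mul_add, hpn]
        rw [hθ, this]
        ring
      rw [this, Real.cos_sub_pi_div_two] at hre
      rw [this, Real.sin_sub_pi_div_two] at him
      simp [sgn]
      linarith
  have h6 := abs_iterate_amp_sub_sgn_le (abs_re_add_im_le n hy) (by norm_num) K hs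
  rw [abs_le] at h6
  have h0 : 0 < ampErr (1 / 4) K := Real.exp_pos _
  cases b <;> simp [netWeight, sgn] at h6 ⊢ <;> linarith

/-! ### Selection by approximate digits -/

/-- The weight of a vertex of the unit cube in multilinear interpolation. -/
def pw {d : ℕ} (b : Fin d → ℝ) (v : Fin d → Bool) : ℝ := ∏ i, if v i then b i else 1 - b i

/-- Multilinear interpolation of values at the vertices of the unit cube. -/
def sel {d : ℕ} (b : Fin d → ℝ) (u : (Fin d → Bool) → ℝ) : ℝ := ∑ v, pw b v * u v

theorem sum_pw {d : ℕ} (b : Fin d → ℝ) : ∑ v, pw b v = 1 := by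
  have h := Finset.prod_univ_sum (fun _ : Fin d => (Finset.univ : Finset Bool))
    (fun i v => if v then b i else 1 - b i)
  rw [Fintype.piFinset_univ] at h
  simp only [pw]
  rw [← h]
  simp

theorem pw_nonneg {d : ℕ} {b : Fin d → ℝ} (hb : ∀ i, b i ∈ Icc (0 : ℝ) 1) (v : Fin d → Bool) :
    0 ≤ pw b v := by
  refine Finset.prod_nonneg fun i _ => ?_
  split_ifs
  · exact (hb i).1
  · linarith [(hb i).2]

theorem pw_le_factor {d : ℕ} {b : Fin d → ℝ} (hb : ∀ i, b i ∈ Icc (0 : ℝ) 1) (v : Fin d → Bool)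
    (i : Fin d) : pw b v ≤ if v i then b i else 1 - b i := by
  rw [pw, ← Finset.mul_prod_erase _ _ (Finset.mem_univ i)]
  refine mul_le_of_le_one_right ?_ (Finset.prod_le_one (fun j _ => ?_) fun j _ => ?_)
  · split_ifs
    · exact (hb i).1
    · linarith [(hb i).2]
  · split_ifs
    · exact (hb j).1
    · linarith [(hb j).2]
  · split_ifs
    · exact (hb j).2
    · linarith [(hb j).1]

theorem abs_sel_le {d : ℕ} {b : Fin d → ℝ} (hb : ∀ i, b i ∈ Icc (0 : ℝ) 1)
    {u : (Fin d → Bool) → ℝ} {B : ℝ} (hu : ∀ v, |u v| ≤ B) : |sel b u| ≤ B := by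
  calc |sel b u| ≤ ∑ v, pw b v * B := by
        refine (Finset.abs_sum_le_sum_abs _ _).trans (Finset.sum_le_sum fun v _ => ?_)
        rw [abs_mul, abs_of_nonneg (pw_nonneg hb v)]
        exact mul_le_mul_of_nonneg_left (hu v) (pw_nonneg hb v)
    _ = B := by rw [← Finset.sum_mul, sum_pw, one_mul]

/-- The vertex weights are a probability distribution. By Bernoulli's inequality the vertex v
carries mass at least 1 - dε, and the remaining mass meets values that differ by at most 2B. -/
theorem abs_sel_sub_le {d : ℕ} {b : Fin d → ℝ} (hb : ∀ i, b i ∈ Icc (0 : ℝ) 1) {v : Fin d → Bool}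
    {ε : ℝ} (hε : ε ≤ 1) (hbv : ∀ i, |b i - bit (v i)| ≤ ε)
    {u : (Fin d → Bool) → ℝ} {B : ℝ} (hu : ∀ v, |u v| ≤ B) :
    |sel b u - u v| ≤ 2 * d * ε * B := by
  have hB : 0 ≤ B := (abs_nonneg _).trans (hu v)
  have h1 : sel b u - u v = ∑ v', pw b v' * (u v' - u v) := by
    simp only [mul_sub, Finset.sum_sub_distrib]
    rw [← Finset.sum_mul, sum_pw, one_mul]
    rfl
  have h2 : 1 - d * ε ≤ pw b v := by
    calc 1 - d * ε ≤ (1 - ε) ^ d := by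
          have := one_add_mul_le_pow (a := -ε) (by linarith) d
          rw [← sub_eq_add_neg] at this
          linarith
      _ = ∏ _i : Fin d, (1 - ε) := by simp
      _ ≤ pw b v := by
          refine Finset.prod_le_prod (fun _ _ => by linarith) fun i _ => ?_
          have := abs_le.mp (hbv i)
          cases h : v i <;> simp [h, bit] at this ⊢ <;> linarith
  rw [h1]
  calc _ ≤ ∑ v', |pw b v' * (u v' - u v)| := Finset.abs_sum_le_sum_abs _ _
    _ = ∑ v' ∈ Finset.univ.erase v, |pw b v' * (u v' - u v)| := by
        rw [← Finset.add_sum_erase _ _ (Finset.mem_univ v)]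
        simp
    _ ≤ ∑ v' ∈ Finset.univ.erase v, pw b v' * (2 * B) := by
        refine Finset.sum_le_sum fun v' _ => ?_
        rw [abs_mul, abs_of_nonneg (pw_nonneg hb v')]
        refine mul_le_mul_of_nonneg_left ?_ (pw_nonneg hb v')
        have := abs_sub (u v') (u v)
        linarith [hu v, hu v']
    _ = (1 - pw b v) * (2 * B) := by
        rw [← Finset.sum_mul]
        congr 1
        have := Finset.add_sum_erase Finset.univ (pw b) (Finset.mem_univ v)
        rw [sum_pw] at this
        linarith
    _ ≤ d * ε * (2 * B) := by
        gcongr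
        linarith
    _ = 2 * d * ε * B := by ring

/-- The digits of levels `o, …, o + N - 1`, the last digits first. -/
def addr {d : ℕ} (β : ℕ → Fin d → Bool) (o : ℕ) : ℕ → List (Fin d → Bool)
  | 0 => []
  | N + 1 => β (o + N) :: addr β o N

theorem length_addr {d : ℕ} (β : ℕ → Fin d → Bool) (o N : ℕ) : (addr β o N).length = N := by
  induction N with
  | zero => rfl
  | succ N ih => simp [addr, ih]

theorem addr_append {d : ℕ} (β : ℕ → Fin d → Bool) (q N : ℕ) :
    addr β q N ++ addr β 0 q = addr β 0 (q + N) := by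
  induction N with
  | zero => rfl
  | succ N ih => simp [addr, ih, ← add_assoc]

/-- Selection from a table by `N` levels of approximate digits. -/
def mux {d : ℕ} (b : ℕ → Fin d → ℝ) (o : ℕ) : ℕ → (List (Fin d → Bool) → ℝ) → ℝ
  | 0, w => w []
  | N + 1, w => mux b o N fun l => sel (b (o + N)) fun v => w (v :: l)

theorem abs_mux_le {d : ℕ} {b : ℕ → Fin d → ℝ} (hb : ∀ k i, b k i ∈ Icc (0 : ℝ) 1) (o N : ℕ)
    {w : List (Fin d → Bool) → ℝ} {B : ℝ} (hw : ∀ l, |w l| ≤ B) : |mux b o N w| ≤ B := by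
  induction N generalizing w with
  | zero => exact hw []
  | succ N ih => exact ih fun l => abs_sel_le (hb _) fun v => hw _

/-- Selections are convex combinations and preserve the bound B, so the errors of the N levels
simply add up. -/
theorem abs_mux_sub_le {d : ℕ} {b : ℕ → Fin d → ℝ} (hb : ∀ k i, b k i ∈ Icc (0 : ℝ) 1) {o N : ℕ}
    {β : ℕ → Fin d → Bool} {ε : ℝ} (hε : ε ≤ 1)
    (hbβ : ∀ k < o + N, ∀ i, |b k i - bit (β k i)| ≤ ε)
    {w : List (Fin d → Bool) → ℝ} {B : ℝ} (hw : ∀ l, |w l| ≤ B) :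
    |mux b o N w - w (addr β o N)| ≤ N * (2 * d * ε * B) := by
  induction N generalizing w with
  | zero => simp [mux, addr]
  | succ N ih =>
    have h1 := ih (fun k hk => hbβ k (by omega))
      (w := fun l => sel (b (o + N)) fun v => w (v :: l)) fun l => abs_sel_le (hb _) fun v => hw _
    have h2 := abs_sel_sub_le (hb (o + N)) hε (hbβ (o + N) (by omega))
      (u := fun v => w (v :: addr β o N)) fun v => hw _
    have h3 := abs_add_le (mux b o N (fun l => sel (b (o + N)) fun v => w (v :: l)) -
      sel (b (o + N)) fun v => w (v :: addr β o N))
      ((sel (b (o + N)) fun v => w (v :: addr β o N)) - w (β (o + N) :: addr β o N))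
    rw [sub_add_sub_cancel] at h3
    simp only [mux, addr]
    push_cast
    linarith

end DeepNet

end

noncomputable section

namespace DeepNet

open Set

/-! ### Arithmetic circuits -/

/-- A node of a circuit: the function it computes, which depends on a parameter, and a bound for
its depth. -/
abbrev Node (Θ X : Type*) : Type _ := (Θ → X → ℝ) × ℕ

variable {Θ X : Type*}

/-- The function `f` is computed in `S` at depth at most `D`. -/
def Avail (S : Set (Node Θ X)) (f : Θ → X → ℝ) (D : ℕ) : Prop := ∃ D' ≤ D, (f, D') ∈ S

/-- A gate is a product of two affine combinations, with coefficients depending on the parameter,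
of two functions that have been computed before. -/
def IsGate (S : Set (Node Θ X)) (g : Node Θ X) : Prop :=
  ∃ u v : Θ → X → ℝ, ∃ D, Avail S u D ∧ Avail S v D ∧ D + 1 ≤ g.2 ∧
    ∃ a b c a' b' c' : Θ → ℝ, g.1 = fun θ x =>
      (a θ * u θ x + b θ * v θ x + c θ) * (a' θ * u θ x + b' θ * v θ x + c' θ)

/-- A circuit with the inputs `S`; the last gates are listed first. -/
def Valid (S : Set (Node Θ X)) : List (Node Θ X) → Prop
  | [] => True
  | g :: l => Valid S l ∧ IsGate (S ∪ {x | x ∈ l}) g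

/-- The nodes `T` can be computed from the nodes `S` with at most `N` gates. -/
def Comp (S : Set (Node Θ X)) (N : ℕ) (T : Set (Node Θ X)) : Prop :=
  ∃ l : List (Node Θ X), l.length ≤ N ∧ Valid S l ∧ ∀ t ∈ T, Avail (S ∪ {x | x ∈ l}) t.1 t.2

theorem Avail.of_mem {S : Set (Node Θ X)} {f : Θ → X → ℝ} {D : ℕ} (h : (f, D) ∈ S) :
    Avail S f D := ⟨D, le_rfl, h⟩

theorem Avail.mono {S S' : Set (Node Θ X)} (hS : S ⊆ S') {f : Θ → X → ℝ} {D D' : ℕ}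
    (h : Avail S f D) (hD : D ≤ D') : Avail S' f D' := by
  obtain ⟨E, hE, hm⟩ := h
  exact ⟨E, hE.trans hD, hS hm⟩

theorem Avail.trans {S S' : Set (Node Θ X)} (hS : ∀ s ∈ S, Avail S' s.1 s.2) {f : Θ → X → ℝ} {D : ℕ}
    (h : Avail S f D) : Avail S' f D := by
  obtain ⟨E, hE, hm⟩ := h
  exact (hS _ hm).mono subset_rfl hE

theorem IsGate.mono {S S' : Set (Node Θ X)} (hS : ∀ s ∈ S, Avail S' s.1 s.2) {g : Node Θ X}
    (h : IsGate S g) : IsGate S' g := by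
  obtain ⟨u, v, D, hu, hv, h⟩ := h
  exact ⟨u, v, D, hu.trans hS, hv.trans hS, h⟩

theorem avail_union_of {S S' : Set (Node Θ X)} (hS : ∀ s ∈ S, Avail S' s.1 s.2)
    (l : Set (Node Θ X)) : ∀ s ∈ S ∪ l, Avail (S' ∪ l) s.1 s.2 := by
  rintro s (h | h)
  · exact (hS s h).mono subset_union_left le_rfl
  · exact Avail.of_mem (Or.inr h)

theorem Valid.mono {S S' : Set (Node Θ X)} (hS : ∀ s ∈ S, Avail S' s.1 s.2) {l : List (Node Θ X)}
    (h : Valid S l) : Valid S' l := by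
  induction l with
  | nil => trivial
  | cons g l ih => exact ⟨ih h.1, h.2.mono (avail_union_of hS _)⟩

theorem Valid.append {S : Set (Node Θ X)} {l l' : List (Node Θ X)} (h : Valid S l)
    (h' : Valid (S ∪ {x | x ∈ l}) l') : Valid S (l' ++ l) := by
  induction l' with
  | nil => exact h
  | cons g l' ih =>
    refine ⟨ih h'.1, h'.2.mono fun s hs => Avail.of_mem ?_⟩
    rcases hs with (hs | hs) | hs
    · exact Or.inl hs
    · exact Or.inr (List.mem_append_right l' hs)
    · exact Or.inr (List.mem_append_left l hs)

theorem Comp.of_avail {S T : Set (Node Θ X)} (h : ∀ t ∈ T, Avail S t.1 t.2) : Comp S 0 T :=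
  ⟨[], le_rfl, trivial, fun t ht => (h t ht).mono subset_union_left le_rfl⟩

theorem Comp.mono {S S' T T' : Set (Node Θ X)} {N N' : ℕ} (h : Comp S N T)
    (hS : ∀ s ∈ S, Avail S' s.1 s.2) (hN : N ≤ N') (hT : ∀ t ∈ T', Avail T t.1 t.2) :
    Comp S' N' T' := by
  obtain ⟨l, hl, hv, ha⟩ := h
  exact ⟨l, hl.trans hN, hv.mono hS, fun t ht =>
    ((hT t ht).trans ha).trans (avail_union_of hS _)⟩

theorem Comp.le {S T : Set (Node Θ X)} {N N' : ℕ} (h : Comp S N T) (hN : N ≤ N') : Comp S N' T :=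
  h.mono (fun _ hs => Avail.of_mem hs) hN fun _ ht => Avail.of_mem ht

theorem Comp.subset {S S' T : Set (Node Θ X)} {N : ℕ} (h : Comp S N T) (hS : S ⊆ S') :
    Comp S' N T :=
  h.mono (fun _ hs => Avail.of_mem (hS hs)) le_rfl fun _ ht => Avail.of_mem ht

theorem Comp.weaken {S T T' : Set (Node Θ X)} {N : ℕ} (h : Comp S N T)
    (hT : ∀ t ∈ T', Avail T t.1 t.2) : Comp S N T' :=
  h.mono (fun _ hs => Avail.of_mem hs) le_rfl hT

theorem Comp.trans {S T U : Set (Node Θ X)} {N M : ℕ} (h : Comp S N T) (h' : Comp (S ∪ T) M U) :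
    Comp S (N + M) (T ∪ U) := by
  obtain ⟨l, hl, hv, ha⟩ := h
  obtain ⟨l', hl', hv', ha'⟩ := h'
  have hST : ∀ s ∈ S ∪ T, Avail (S ∪ {x | x ∈ l}) s.1 s.2 := by
    rintro s (hs | hs)
    · exact Avail.of_mem (Or.inl hs)
    · exact ha s hs
  have hsub : (S ∪ {x | x ∈ l}) ∪ {x | x ∈ l'} ⊆ S ∪ {x | x ∈ l' ++ l} := by
    intro s hs
    simp only [mem_union, mem_ofPred_eq, List.mem_append] at hs ⊢
    tauto
  refine ⟨l' ++ l, ?_, hv.append (hv'.mono hST), ?_⟩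
  · rw [List.length_append]
    omega
  · rintro t (ht | ht)
    · exact (ha t ht).mono (subset_union_left.trans hsub) le_rfl
    · exact ((ha' t ht).trans (avail_union_of hST _)).mono hsub le_rfl

/-- Quantifying over every larger set of available nodes hides the intermediate gates, so stages
compose without listing what was computed before. -/
theorem Comp.bind {S T U : Set (Node Θ X)} {N M : ℕ} (h : Comp S N T)
    (h' : ∀ S', S ⊆ S' → T ⊆ S' → Comp S' M U) : Comp S (N + M) U :=
  (h.trans (h' _ subset_union_left subset_union_right)).weaken fun _ ht => Avail.of_mem (Or.inr ht)

theorem Comp.union {S T U : Set (Node Θ X)} {N M : ℕ} (h : Comp S N T) (h' : Comp S M U) :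
    Comp S (N + M) (T ∪ U) :=
  h.trans (h'.subset subset_union_left)

theorem Comp.biUnion {ι : Type*} {S : Set (Node Θ X)} (I : Finset ι) {N : ι → ℕ}
    {T : ι → Set (Node Θ X)} (h : ∀ i ∈ I, Comp S (N i) (T i)) :
    Comp S (∑ i ∈ I, N i) (⋃ i ∈ I, T i) := by
  classical
  induction I using Finset.induction_on with
  | empty => exact Comp.of_avail (by simp)
  | insert i I hi ih =>
    rw [Finset.sum_insert hi, Finset.set_biUnion_insert]
    exact (h i (Finset.mem_insert_self i I)).union
      (ih fun j hj => h j (Finset.mem_insert_of_mem hj))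

/-- Computing a finite family with the same cost for each member. -/
theorem Comp.family {ι : Type*} {S : Set (Node Θ X)} (I : Finset ι) {N : ℕ}
    {T : ι → Set (Node Θ X)} (h : ∀ i ∈ I, Comp S N (T i)) :
    Comp S (I.card * N) (⋃ i ∈ I, T i) := by
  have := Comp.biUnion I h
  rwa [Finset.sum_const, smul_eq_mul] at this

theorem Comp.gate {S : Set (Node Θ X)} {u v : Θ → X → ℝ} {D : ℕ} (hu : Avail S u D)
    (hv : Avail S v D) (a b c a' b' c' : Θ → ℝ) {f : Θ → X → ℝ}
    (hf : ∀ θ x, f θ x =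
      (a θ * u θ x + b θ * v θ x + c θ) * (a' θ * u θ x + b' θ * v θ x + c' θ)) :
    Comp S 1 {(f, D + 1)} := by
  refine ⟨[(f, D + 1)], le_rfl, ⟨trivial, u, v, D, hu.mono subset_union_left le_rfl,
    hv.mono subset_union_left le_rfl, le_rfl, a, b, c, a', b', c', ?_⟩, ?_⟩
  · funext θ x
    exact hf θ x
  · rintro t ht
    rw [mem_singleton_iff] at ht
    subst ht
    exact Avail.of_mem (Or.inr (by simp))

theorem Comp.mul {S : Set (Node Θ X)} {u v : Θ → X → ℝ} {D : ℕ} (hu : Avail S u D)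
    (hv : Avail S v D) : Comp S 1 {((fun θ x => u θ x * v θ x), D + 1)} :=
  Comp.gate hu hv (fun _ => 1) (fun _ => 0) (fun _ => 0) (fun _ => 0) (fun _ => 1) (fun _ => 0)
    fun θ x => by ring

theorem Comp.lin {S : Set (Node Θ X)} {u v : Θ → X → ℝ} {D : ℕ} (hu : Avail S u D)
    (hv : Avail S v D) (a b c : Θ → ℝ) :
    Comp S 1 {((fun θ x => a θ * u θ x + b θ * v θ x + c θ), D + 1)} :=
  Comp.gate hu hv a b c (fun _ => 0) (fun _ => 0) (fun _ => 1) fun θ x => by ring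

theorem Comp.const {S : Set (Node Θ X)} {u : Θ → X → ℝ} {D : ℕ} (hu : Avail S u D) (c : Θ → ℝ) :
    Comp S 1 {((fun θ _ => c θ), D + 1)} :=
  Comp.gate hu hu (fun _ => 0) (fun _ => 0) c (fun _ => 0) (fun _ => 0) (fun _ => 1)
    fun θ x => by ring

theorem Comp.avail_right {S T : Set (Node Θ X)} {f : Θ → X → ℝ} {D : ℕ} (h : (f, D) ∈ T) :
    Avail (S ∪ T) f D := Avail.of_mem (Or.inr h)

/-- A sequential computation. -/
theorem Comp.chain {ι : Type*} {S : Set (Node Θ X)} {F : ℕ → ι → Θ → X → ℝ} {D c e M : ℕ}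
    (h0 : ∀ i, Avail S (F 0 i) D)
    (hstep : ∀ S', S ⊆ S' → ∀ t < M, (∀ i, Avail S' (F t i) (D + e * t)) →
      Comp S' c (range fun i => (F (t + 1) i, D + e * (t + 1)))) :
    Comp S (c * M) {p | ∃ t ≤ M, ∃ i, p = (F t i, D + e * t)} := by
  induction M with
  | zero =>
    refine Comp.of_avail ?_
    rintro _ ⟨t, ht, i, rfl⟩
    obtain rfl : t = 0 := by omega
    exact h0 i
  | succ M ih =>
    have h1 := ih fun S' hS t ht => hstep S' hS t (by omega)
    have h2 := h1.trans (hstep _ subset_union_left M (by omega) fun i =>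
      Comp.avail_right ⟨M, le_rfl, i, rfl⟩)
    refine (h2.le (by rw [Nat.mul_succ])).weaken ?_
    rintro _ ⟨t, ht, i, rfl⟩
    refine Avail.of_mem ?_
    rcases Nat.lt_or_ge t (M + 1) with h | h
    · exact Or.inl ⟨t, by omega, i, rfl⟩
    · obtain rfl : t = M + 1 := by omega
      exact Or.inr ⟨i, rfl⟩

/-! ### Elementary circuits -/

theorem Comp.iterate_amp {S : Set (Node Θ X)} {u : Θ → X → ℝ} {D : ℕ} (hu : Avail S u D) (K : ℕ) :
    Comp S (2 * K) {((fun θ x => amp^[K] (u θ x)), D + 2 * K)} := by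
  have h := Comp.chain (ι := Unit) (S := S) (F := fun t _ θ x => amp^[t] (u θ x)) (D := D) (c := 2)
    (e := 2) (M := K) (fun _ => hu) ?_
  · refine h.weaken ?_
    rintro _ rfl
    exact Avail.of_mem ⟨K, le_rfl, (), rfl⟩
  · intro S' _ t _ ha
    refine ((Comp.mul (ha ()) (ha ())).bind fun S₁ hS hT =>
      Comp.gate ((ha ()).mono hS (Nat.le_succ _)) (Avail.of_mem (hT rfl))
      (fun _ => 1) (fun _ => 0) (fun _ => 0) (fun _ => 0)
      (fun _ => -1 / 2) (fun _ => 3 / 2) (f := fun θ x => amp^[t + 1] (u θ x)) (fun θ x => by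
        rw [Function.iterate_succ_apply', amp]
        ring)).weaken ?_
    rintro _ ⟨i, rfl⟩
    exact Avail.of_mem rfl

theorem Comp.iterate_quart {S : Set (Node Θ X)} {z : Θ → X → ℝ} {D : ℕ} (hz : Avail S z D) (M : ℕ) :
    Comp S (2 * M) {p | ∃ t ≤ M, p = ((fun θ x => quart^[t] (z θ x)), D + 2 * t)} := by
  have h := Comp.chain (ι := Unit) (S := S) (F := fun t _ θ x => quart^[t] (z θ x)) (D := D) (c := 2)
    (e := 2) (M := M) (fun _ => hz) ?_
  · refine h.weaken ?_
    rintro _ ⟨t, ht, rfl⟩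
    exact Avail.of_mem ⟨t, ht, (), rfl⟩
  · intro S' _ t _ ha
    -- A single gate suffices for T₂, because 2z² - 1 = (√2 z + 1)(√2 z - 1).
    have h2 : √2 * √2 = (2 : ℝ) := Real.mul_self_sqrt (by norm_num)
    have h1 := Comp.gate (ha ()) (ha ()) (fun _ => √2) (fun _ => 0) (fun _ => 1) (fun _ => √2)
      (fun _ => 0) (fun _ => -1) (f := fun θ x => 2 * (quart^[t] (z θ x)) ^ 2 - 1) (fun θ x => by
        linear_combination (-(quart^[t] (z θ x)) ^ 2) * h2)
    refine (h1.bind fun S₁ hS hT => Comp.gate (Avail.of_mem (hT rfl))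
      (Avail.of_mem (hT rfl)) (fun _ => √2) (fun _ => 0) (fun _ => 1) (fun _ => √2)
      (fun _ => 0) (fun _ => -1) (f := fun θ x => quart^[t + 1] (z θ x)) (fun θ x => by
        rw [Function.iterate_succ_apply', quart]
        linear_combination (-(2 * (quart^[t] (z θ x)) ^ 2 - 1) ^ 2) * h2)).weaken ?_
    rintro _ ⟨i, rfl⟩
    exact Avail.of_mem rfl

/-- Real and imaginary parts of iterated squares. -/
theorem Comp.iterate_sq {S : Set (Node Θ X)} {z : Θ → X → ℂ} {D : ℕ}
    (hre : Avail S (fun θ x => (z θ x).re) D) (him : Avail S (fun θ x => (z θ x).im) D) (M : ℕ) :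
    Comp S (2 * M) {p | ∃ t ≤ M, p = ((fun θ x => (z θ x ^ 2 ^ t).re), D + M) ∨
      p = ((fun θ x => (z θ x ^ 2 ^ t).im), D + M)} := by
  have h := Comp.chain (ι := Bool) (S := S) (F := fun t b θ x =>
    if b then (z θ x ^ 2 ^ t).re else (z θ x ^ 2 ^ t).im) (D := D) (c := 2)
    (e := 1) (M := M) (by rintro (_ | _) <;> simpa) ?_
  · refine h.weaken ?_
    rintro _ ⟨t, ht, rfl | rfl⟩
    · exact ⟨D + 1 * t, by simp; omega, t, ht, true, by simp⟩
    · exact ⟨D + 1 * t, by simp; omega, t, ht, false, by simp⟩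
  · intro S' _ t _ ha
    have hr := ha true
    have hi := ha false
    simp only [if_true, Bool.false_eq_true, if_false] at hr hi
    have hsq : ∀ θ x, z θ x ^ 2 ^ (t + 1) = (z θ x ^ 2 ^ t) * (z θ x ^ 2 ^ t) := by
      intro θ x
      rw [pow_succ 2, pow_mul, sq]
    have h1 := Comp.gate hr hi (fun _ => 1) (fun _ => 1) (fun _ => 0) (fun _ => 1)
      (fun _ => -1) (fun _ => 0) (f := fun θ x => (z θ x ^ 2 ^ (t + 1)).re) (fun θ x => by
        rw [hsq, Complex.mul_re]
        ring)
    have h2 := Comp.gate hr hi (fun _ => 2) (fun _ => 0) (fun _ => 0) (fun _ => 0)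
      (fun _ => 1) (fun _ => 0) (f := fun θ x => (z θ x ^ 2 ^ (t + 1)).im) (fun θ x => by
        rw [hsq, Complex.mul_im]
        ring)
    refine (h1.union h2).weaken ?_
    rintro _ ⟨b, rfl⟩
    refine Avail.of_mem ?_
    cases b
    · right
      simp [mul_add, add_assoc]
    · left
      simp [mul_add, add_assoc]

/-- Linear combinations. -/
theorem Comp.sum {ι : Type*} {S : Set (Node Θ X)} (I : Finset ι) {f : ι → Θ → X → ℝ} {D : ℕ}
    {o : Θ → X → ℝ} (ho : Avail S o D) (hf : ∀ i ∈ I, Avail S (f i) D) (α : ι → Θ → ℝ) :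
    Comp S (I.card + 1) {((fun θ x => ∑ i ∈ I, α i θ * f i θ x), D + (I.card + 1))} := by
  classical
  induction I using Finset.induction_on with
  -- Even a constant gate needs a source to read; o only plays this role.
  | empty => simpa using Comp.const ho fun _ => 0
  | insert i I hi ih =>
    rw [Finset.card_insert_of_notMem hi]
    have h1 := ih fun j hj => hf j (Finset.mem_insert_of_mem hj)
    refine (h1.bind fun S₁ hS hT => Comp.lin
      ((hf i (Finset.mem_insert_self i I)).mono hS (Nat.le_add_right _ _))
      (Avail.of_mem (hT rfl)) (α i) (fun _ => 1) (fun _ => 0)).weaken ?_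
    rintro _ rfl
    refine Avail.of_mem ?_
    simp only [Finset.sum_insert hi, one_mul, add_zero, add_assoc]
    rfl

/-- Products of affine functions. -/
theorem Comp.prod {ι : Type*} {S : Set (Node Θ X)} (I : Finset ι) {f : ι → Θ → X → ℝ} {D : ℕ}
    {o : Θ → X → ℝ} (ho : Avail S o D) (hf : ∀ i ∈ I, Avail S (f i) D) (α β : ι → ℝ) :
    Comp S (I.card + 1) {((fun θ x => ∏ i ∈ I, (α i * f i θ x + β i)), D + (I.card + 1))} := by
  classical
  induction I using Finset.induction_on with
  | empty => simpa using Comp.const ho fun _ => 1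
  | insert i I hi ih =>
    rw [Finset.card_insert_of_notMem hi]
    have h1 := ih fun j hj => hf j (Finset.mem_insert_of_mem hj)
    exact h1.bind fun S₁ hS hT => Comp.gate
      ((hf i (Finset.mem_insert_self i I)).mono hS (Nat.le_add_right _ _))
      (Avail.of_mem (hT rfl)) (fun _ => α i) (fun _ => 0) (fun _ => β i) (fun _ => 0)
      (fun _ => 1) (fun _ => 0)
      (f := fun θ x => ∏ i ∈ insert i I, (α i * f i θ x + β i)) (fun θ x => by
        rw [Finset.prod_insert hi]
        ring)

theorem Comp.pw {S : Set (Node Θ X)} {d D : ℕ} {b : Fin d → Θ → X → ℝ} {o : Θ → X → ℝ}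
    (ho : Avail S o D) (hb : ∀ i, Avail S (b i) D) :
    Comp S (2 ^ d * (d + 1))
      (range fun v : Fin d → Bool => ((fun θ x => pw (fun i => b i θ x) v), D + (d + 1))) := by
  have h := Comp.family (S := S) (Finset.univ : Finset (Fin d → Bool)) (N := d + 1)
    (T := fun v => {((fun θ x => DeepNet.pw (fun i => b i θ x) v), D + (d + 1))}) fun v _ => by
      have h1 := Comp.prod (S := S) (Finset.univ : Finset (Fin d)) (f := b) ho (fun i _ => hb i)
        (fun i => if v i then 1 else -1) (fun i => if v i then 0 else 1)
      rw [Finset.card_univ, Fintype.card_fin] at h1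
      have heq : (fun θ x => DeepNet.pw (fun i => b i θ x) v) = fun θ x =>
          ∏ i : Fin d, ((if v i then 1 else -1) * b i θ x + if v i then 0 else 1) := by
        funext θ x
        refine Finset.prod_congr rfl fun i _ => ?_
        split_ifs <;> ring
      rw [heq]
      exact h1
  have hc : (Finset.univ : Finset (Fin d → Bool)).card = 2 ^ d := by simp
  rw [hc] at h
  refine h.weaken ?_
  rintro _ ⟨v, rfl⟩
  exact Avail.of_mem (by simp)

/-- Selection with known vertex weights. -/
theorem Comp.sel {S : Set (Node Θ X)} {d D : ℕ} {b : Fin d → Θ → X → ℝ}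
    {u : (Fin d → Bool) → Θ → X → ℝ} {o : Θ → X → ℝ} (ho : Avail S o D)
    (hb : ∀ v, Avail S (fun θ x => DeepNet.pw (fun i => b i θ x) v) D) (hu : ∀ v, Avail S (u v) D) :
    Comp S (2 * 2 ^ d + 1)
      {((fun θ x => sel (fun i => b i θ x) fun v => u v θ x), D + (2 ^ d + 2))} := by
  have hc : (Finset.univ : Finset (Fin d → Bool)).card = 2 ^ d := by simp
  have h := Comp.family (S := S) (Finset.univ : Finset (Fin d → Bool)) (N := 1)
    (T := fun v => {((fun θ x => DeepNet.pw (fun i => b i θ x) v * u v θ x), D + 1)})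
    fun v _ => Comp.mul (hb v) (hu v)
  have h2 := h.bind fun S₁ hS hT => Comp.sum (D := D + 1) (Finset.univ : Finset (Fin d → Bool))
    (f := fun v θ x => DeepNet.pw (fun i => b i θ x) v * u v θ x)
    (ho.mono hS (Nat.le_succ _))
    (fun v _ => Avail.of_mem (hT (mem_biUnion (Finset.mem_univ v) (mem_singleton _))))
    (fun _ _ => 1)
  rw [hc] at h2
  refine (h2.le (by omega)).weaken ?_
  rintro _ rfl
  refine Avail.of_mem ?_
  simp only [one_mul]
  rw [show D + (2 ^ d + 2) = D + 1 + (2 ^ d + 1) by ring]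
  rfl

/-- Selection from a table. -/
theorem Comp.mux {S : Set (Node Θ X)} {d D o' : ℕ} (hd : 0 < d) {b : ℕ → Fin d → Θ → X → ℝ}
    {o : Θ → X → ℝ} (ho : Avail S o D) (N : ℕ)
    (hb : ∀ k < o' + N, ∀ v, Avail S (fun θ x => DeepNet.pw (fun i => b k i θ x) v) D)
    {w : List (Fin d → Bool) → Θ → X → ℝ} (hw : ∀ l, l.length = N → Avail S (w l) D) :
    Comp S ((2 * 2 ^ d + 1) * 2 ^ (d * N))
      {((fun θ x => mux (fun k i => b k i θ x) o' N fun l => w l θ x), D + (2 ^ d + 2) * N)} := by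
  induction N generalizing S w D with
  | zero =>
    refine (Comp.of_avail ?_).le (Nat.zero_le _)
    rintro _ rfl
    exact hw [] rfl
  | succ N ih =>
    classical
    have hc : (Finset.univ : Finset (Fin N → (Fin d → Bool))).card = 2 ^ (d * N) := by
      simp [pow_mul]
    have h1 := Comp.family (S := S) (Finset.univ : Finset (Fin N → (Fin d → Bool)))
      (N := 2 * 2 ^ d + 1)
      (T := fun l => {((fun θ x => DeepNet.sel (fun i => b (o' + N) i θ x)
        fun v => w (v :: List.ofFn l) θ x), D + (2 ^ d + 2))})
      fun l _ => Comp.sel ho (hb (o' + N) (by omega)) fun v => hw _ (by simp)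
    rw [hc] at h1
    have h2 := h1.bind fun S₁ hS hT => ih (S := S₁) (D := D + (2 ^ d + 2))
      (w := fun l θ x => DeepNet.sel (fun i => b (o' + N) i θ x) fun v => w (v :: l) θ x)
      (ho.mono hS (Nat.le_add_right _ _))
      (fun k hk v => (hb k (by omega) v).mono hS (Nat.le_add_right _ _))
      (fun l hl => by
        subst hl
        refine Avail.of_mem (hT (mem_biUnion (Finset.mem_univ l.get) ?_))
        rw [List.ofFn_get]
        exact mem_singleton _)
    refine (h2.le ?_).weaken ?_
    -- The cost halves at least from one level to the next, so the geometric sum is dominated by the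
    -- finest level; this uses d > 0.
    · have h4 : 2 ≤ 2 ^ d := by
        calc 2 = 2 ^ 1 := rfl
          _ ≤ 2 ^ d := Nat.pow_le_pow_right (by norm_num) hd
      have h5 : 2 ^ (d * (N + 1)) = 2 ^ (d * N) * 2 ^ d := by rw [Nat.mul_succ, pow_add]
      rw [h5]
      calc _ = (2 ^ (d * N) * (2 * 2 ^ d + 1)) * 2 := by ring
        _ ≤ (2 ^ (d * N) * (2 * 2 ^ d + 1)) * 2 ^ d := Nat.mul_le_mul_left _ h4
        _ = _ := by ring
    · rintro _ rfl
      refine Avail.of_mem ?_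
      rw [show D + (2 ^ d + 2) * (N + 1) = D + (2 ^ d + 2) + (2 ^ d + 2) * N by ring]
      rfl

end DeepNet

end

noncomputable section

namespace DeepNet

open Set Filter Topology

/-! ### Architectures whose units are numbered by natural numbers -/

/-- The numbering of the sources of connections. -/
def sourceEmb (d n : ℕ) : Fin d ⊕ Fin n ↪ Fin d ⊕ ℕ :=
  Function.Embedding.sumMap (Function.Embedding.refl _) Fin.valEmbedding

theorem map_filter_sourceEmb {d n : ℕ} {P : Finset (Fin d ⊕ ℕ)} (hP : ∀ j, Sum.inr j ∈ P → j < n) :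
    (Finset.univ.filter fun s => sourceEmb d n s ∈ P).map (sourceEmb d n) = P := by
  ext s
  simp only [Finset.mem_map, Finset.mem_filter, Finset.mem_univ, true_and]
  constructor
  · rintro ⟨t, ht, rfl⟩
    exact ht
  · intro hs
    rcases s with k | j
    · exact ⟨Sum.inl k, hs, rfl⟩
    · exact ⟨Sum.inr ⟨j, hP j hs⟩, hs, rfl⟩

/-- Sources of the hidden units and of the output unit, by numbers. -/
def HasSources {d : ℕ} (η : Architecture d) (P : ℕ → Finset (Fin d ⊕ ℕ)) (Q : Finset (Fin d ⊕ ℕ)) :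
    Prop :=
  (∀ i, (η.preds i).map (sourceEmb d η.numHidden) = P i) ∧
    η.outPreds.map (sourceEmb d η.numHidden) = Q

theorem exists_hasSources {d : ℕ} (n : ℕ) (P : ℕ → Finset (Fin d ⊕ ℕ)) (Q : Finset (Fin d ⊕ ℕ))
    (hP : ∀ i j, Sum.inr j ∈ P i → j < i) (hQ : ∀ j, Sum.inr j ∈ Q → j < n) :
    ∃ η : Architecture d, η.numHidden = n ∧ HasSources η P Q :=
  ⟨{  numHidden := n
      preds := fun i => Finset.univ.filter fun s => sourceEmb d n s ∈ P i
      outPreds := Finset.univ.filter fun s => sourceEmb d n s ∈ Q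
      acyclic := fun i j h => hP i j (Finset.mem_filter.mp h).2 }, rfl,
    fun i => map_filter_sourceEmb fun j hj => (hP i j hj).trans i.2, map_filter_sourceEmb hQ⟩

section sources

variable {d : ℕ} {η : Architecture d} {P : ℕ → Finset (Fin d ⊕ ℕ)} {Q : Finset (Fin d ⊕ ℕ)}

/-- Weights of an architecture with numbered sources. -/
def numberedParam (η : Architecture d) (ω : ℕ → Fin d ⊕ ℕ → ℝ) (β : ℕ → ℝ) (ω' : Fin d ⊕ ℕ → ℝ)
    (β' : ℝ) : η.Param → ℝ :=
  Sum.elim (fun p => p.2.elim (β p.1) fun s => ω p.1 (sourceEmb d η.numHidden s.1))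
    (fun o => o.elim β' fun s => ω' (sourceEmb d η.numHidden s.1))

theorem HasSources.numWeights (h : HasSources η P Q) :
    η.numWeights = (∑ i ∈ Finset.range η.numHidden, ((P i).card + 1)) + (Q.card + 1) := by
  have h1 : ∀ i, (η.preds i).card = (P i).card := fun i => by rw [← h.1 i, Finset.card_map]
  have h2 : η.outPreds.card = Q.card := by rw [← h.2, Finset.card_map]
  rw [Architecture.numWeights, Fintype.card_sum, Fintype.card_sigma, Fintype.card_option,
    Fintype.card_coe, h2]
  simp only [Fintype.card_option, Fintype.card_coe, h1]
  rw [Fin.sum_univ_eq_sum_range (fun i => (P i).card + 1)]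

/-- Any labelling that increases strictly along the edges between hidden units and is at least 1
dominates the layers. Thus the depth bounds carried by circuit nodes can serve as labels. -/
theorem HasSources.depth_le (h : HasSources η P Q) {δ : ℕ → ℕ} {D : ℕ}
    (hδ : ∀ i < η.numHidden, 1 ≤ δ i ∧ δ i ≤ D + 1 ∧ ∀ j, Sum.inr j ∈ P i → δ j + 1 ≤ δ i)
    (hδQ : ∀ j, Sum.inr j ∈ Q → δ j ≤ D) : η.depth ≤ D + 1 := by
  have hl : ∀ m : ℕ, ∀ hm : m < η.numHidden, η.layer ⟨m, hm⟩ ≤ δ m := by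
    intro m
    induction m using Nat.strong_induction_on with
    | _ m ih =>
      intro hm
      obtain ⟨h1, -, h3⟩ := hδ m hm
      rw [Architecture.layer_eq]
      have : (η.preds ⟨m, hm⟩).sup (Sum.elim (fun _ => 0) η.layer) ≤ δ m - 1 := by
        refine Finset.sup_le fun s hs => ?_
        rcases s with k | j
        · exact Nat.zero_le _
        · have hj : j.1 < m := η.acyclic _ _ hs
          have h4 : η.layer j ≤ δ j := ih j hj j.2
          have h5 := h3 j (by
            have := h.1 ⟨m, hm⟩
            simp only at this
            rw [← this]
            exact Finset.mem_map_of_mem (sourceEmb d η.numHidden) hs)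
          simp only [Sum.elim_inr]
          omega
      omega
  refine max_le ?_ (Finset.sup_le fun i _ => (hl i i.2).trans (hδ i i.2).2.1)
  rw [Architecture.outLayer, add_comm]
  refine Nat.add_le_add_right (Finset.sup_le fun s hs => ?_) 1
  rcases s with k | j
  · exact Nat.zero_le _
  · exact (hl j j.2).trans (hδQ j (by
      rw [← h.2]
      exact Finset.mem_map_of_mem (sourceEmb d η.numHidden) hs))

/-- The value of a hidden unit, by number. -/
def hiddenValue (η : Architecture d) (σ : ℝ → ℝ) (w : η.Param → ℝ) (x : EuclideanSpace ℝ (Fin d))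
    (m : ℕ) : ℝ :=
  if h : m < η.numHidden then η.hidden σ w x ⟨m, h⟩ else 0

/-- The value of a source, by number. -/
def sourceValue (η : Architecture d) (σ : ℝ → ℝ) (w : η.Param → ℝ) (x : EuclideanSpace ℝ (Fin d))
    (s : Fin d ⊕ ℕ) : ℝ :=
  Sum.elim (fun k => x k) (hiddenValue η σ w x) s

theorem elim_eq_sourceValue (σ : ℝ → ℝ) (w : η.Param → ℝ) (x : EuclideanSpace ℝ (Fin d))
    (s : Fin d ⊕ Fin η.numHidden) :
    Sum.elim (fun k => x k) (η.hidden σ w x) s =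
      sourceValue η σ w x (sourceEmb d η.numHidden s) := by
  rcases s with k | j
  · rfl
  · have : sourceEmb d η.numHidden (Sum.inr j) = Sum.inr (j : ℕ) := rfl
    rw [this, sourceValue, Sum.elim_inr, Sum.elim_inr, hiddenValue, dif_pos j.2]

theorem HasSources.hiddenValue_eq (h : HasSources η P Q) (σ : ℝ → ℝ) (ω : ℕ → Fin d ⊕ ℕ → ℝ)
    (β : ℕ → ℝ) (ω' : Fin d ⊕ ℕ → ℝ) (β' : ℝ) (x : EuclideanSpace ℝ (Fin d)) {m : ℕ}
    (hm : m < η.numHidden) :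
    hiddenValue η σ (numberedParam η ω β ω' β') x m =
      σ ((∑ s ∈ P m, ω m s * sourceValue η σ (numberedParam η ω β ω' β') x s) + β m) := by
  have h1 := h.1 ⟨m, hm⟩
  simp only at h1
  rw [hiddenValue, dif_pos hm, Architecture.hidden_eq, ← h1, Finset.sum_map]
  simp only [elim_eq_sourceValue]
  congr 2
  exact Finset.sum_coe_sort (η.preds ⟨m, hm⟩) fun s => ω m (sourceEmb d η.numHidden s) *
    sourceValue η σ (numberedParam η ω β ω' β') x (sourceEmb d η.numHidden s)

theorem HasSources.eval_eq (h : HasSources η P Q) (σ : ℝ → ℝ) (ω : ℕ → Fin d ⊕ ℕ → ℝ)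
    (β : ℕ → ℝ) (ω' : Fin d ⊕ ℕ → ℝ) (β' : ℝ) (x : EuclideanSpace ℝ (Fin d)) :
    η.eval σ (numberedParam η ω β ω' β') x =
      (∑ s ∈ Q, ω' s * sourceValue η σ (numberedParam η ω β ω' β') x s) + β' := by
  rw [Architecture.eval, ← h.2, Finset.sum_map]
  simp only [elim_eq_sourceValue]
  congr 1
  exact Finset.sum_coe_sort η.outPreds fun s => ω' (sourceEmb d η.numHidden s) *
    sourceValue η σ (numberedParam η ω β ω' β') x (sourceEmb d η.numHidden s)

end sources

/-! ### Squares from second differences -/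

/-- The difference ψ(u) of the second difference and s·u² has ψ(0) = 0 and derivative σ'(x₀+t) -
σ'(x₀-t) - 2st = o(t), by differentiability of σ' at the single point x₀. The mean value inequality
then gives o(u²). -/
theorem HasSecondDerivAt.second_difference {σ : ℝ → ℝ} {s x₀ : ℝ} (h : HasSecondDerivAt σ s x₀)
    {ε : ℝ} (hε : 0 < ε) : ∃ δ > 0, ∀ u, |u| ≤ δ →
      |σ (x₀ + u) + σ (x₀ - u) - 2 * σ x₀ - s * u ^ 2| ≤ ε * u ^ 2 := by
  obtain ⟨h1, h2⟩ := h
  rw [hasDerivAt_iff_isLittleO_nhds_zero] at h2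
  have h3 := h2.def (half_pos hε)
  obtain ⟨δ₁, hδ₁, h1⟩ := Metric.eventually_nhds_iff.mp h1
  obtain ⟨δ₂, hδ₂, h3⟩ := Metric.eventually_nhds_iff.mp h3
  simp only [dist_zero_right, Real.norm_eq_abs, smul_eq_mul] at h3
  set δ := min δ₁ δ₂ / 2 with hδ
  have hmin : 0 < min δ₁ δ₂ := lt_min hδ₁ hδ₂
  have hδ1 : δ < δ₁ := by linarith [min_le_left δ₁ δ₂]
  have hδ2 : δ < δ₂ := by linarith [min_le_right δ₁ δ₂]
  refine ⟨δ, half_pos hmin, fun u hu => ?_⟩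
  set ψ : ℝ → ℝ := fun u => σ (x₀ + u) + σ (x₀ - u) - 2 * σ x₀ - s * u ^ 2 with hψ
  have hder : ∀ t ∈ Icc (-|u|) |u|, HasDerivWithinAt ψ
      (deriv σ (x₀ + t) - deriv σ (x₀ - t) - s * (2 * t)) (Icc (-|u|) |u|) t := by
    intro t ht
    have htu : |t| ≤ |u| := abs_le.mpr ht
    have d1 : DifferentiableAt ℝ σ (x₀ + t) := h1 (by
      rw [Real.dist_eq, add_sub_cancel_left]
      linarith)
    have d2 : DifferentiableAt ℝ σ (x₀ - t) := h1 (by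
      rw [Real.dist_eq, sub_sub_cancel_left, abs_neg]
      linarith)
    have e1 : HasDerivAt (fun t => σ (x₀ + t)) (deriv σ (x₀ + t)) t := by
      have := d1.hasDerivAt.comp t ((hasDerivAt_id t).const_add x₀)
      rwa [mul_one] at this
    have e2 : HasDerivAt (fun t => σ (x₀ - t)) (-deriv σ (x₀ - t)) t := by
      have := d2.hasDerivAt.comp t ((hasDerivAt_id t).const_sub x₀)
      rwa [mul_neg_one] at this
    have e3 : HasDerivAt (fun t : ℝ => s * t ^ 2) (s * (2 * t)) t := by
      simpa using (hasDerivAt_pow 2 t).const_mul s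
    have e4 := ((e1.add e2).sub_const (2 * σ x₀)).sub e3
    rw [← sub_eq_add_neg] at e4
    exact e4.hasDerivWithinAt
  have hbound : ∀ t ∈ Icc (-|u|) |u|,
      ‖deriv σ (x₀ + t) - deriv σ (x₀ - t) - s * (2 * t)‖ ≤ ε * |u| := by
    intro t ht
    have htu : |t| ≤ |u| := abs_le.mpr ht
    have a1 := h3 (show |t| < δ₂ by linarith)
    have a2 := h3 (show |-t| < δ₂ by rw [abs_neg]; linarith)
    rw [abs_neg] at a2
    have : deriv σ (x₀ + t) - deriv σ (x₀ - t) - s * (2 * t) =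
        (deriv σ (x₀ + t) - deriv σ x₀ - t * s) - (deriv σ (x₀ + -t) - deriv σ x₀ - -t * s) := by
      rw [← sub_eq_add_neg]
      ring
    rw [this, Real.norm_eq_abs]
    refine (abs_sub _ _).trans ?_
    nlinarith
  have h0 : (0 : ℝ) ∈ Icc (-|u|) |u| := by simp
  have hu' : u ∈ Icc (-|u|) |u| := ⟨neg_abs_le u, le_abs_self u⟩
  have h5 := (convex_Icc (-|u|) |u|).norm_image_sub_le_of_norm_hasDerivWithin_le hder hbound h0 hu'
  have hψ0 : ψ 0 = 0 := by
    simp [hψ]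
    ring
  rw [hψ0, sub_zero, sub_zero, Real.norm_eq_abs, Real.norm_eq_abs, mul_assoc, abs_mul_abs_self,
    ← sq] at h5
  exact h5

/-- Uniform convergence on `A` as the step size tends to zero. -/
def UnifTo {X : Type*} (A : Set X) (F : ℝ → X → ℝ) (f : X → ℝ) : Prop :=
  ∀ ε > 0, ∀ᶠ h in 𝓝[≠] (0 : ℝ), ∀ x ∈ A, |F h x - f x| ≤ ε

section UnifTo

variable {X : Type*} {A : Set X} {F F' : ℝ → X → ℝ} {f f' : X → ℝ}

theorem UnifTo.lin (hF : UnifTo A F f) (hF' : UnifTo A F' f') (a b c : ℝ) :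
    UnifTo A (fun h x => a * F h x + b * F' h x + c) (fun x => a * f x + b * f' x + c) := by
  intro ε hε
  set η := ε / (|a| + |b| + 1) with hη
  have hη0 : 0 < η := by positivity
  filter_upwards [hF η hη0, hF' η hη0] with h h1 h2 x hx
  have h3 : (a * F h x + b * F' h x + c) - (a * f x + b * f' x + c) =
      a * (F h x - f x) + b * (F' h x - f' x) := by ring
  rw [h3]
  have h4 : η * (|a| + |b| + 1) = ε := by
    rw [hη]
    field_simp
  calc _ ≤ |a| * η + |b| * η := by
        refine (abs_add_le _ _).trans (add_le_add ?_ ?_)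
        · rw [abs_mul]
          gcongr
          exact h1 x hx
        · rw [abs_mul]
          gcongr
          exact h2 x hx
    _ ≤ ε := by nlinarith

/-- The second difference quotient of `σ`, normalized to approximate the square. -/
def secDiff (σ : ℝ → ℝ) (s x₀ h t : ℝ) : ℝ :=
  (σ (x₀ + h * t) + σ (x₀ - h * t) - 2 * σ x₀) / (s * h ^ 2)

/-- Eventually F stays below B + 1, so h·F is uniformly small and the second-difference estimate
applies; the other half of ε pays for replacing F² by f². Since F may depend on h, the statement can
be iterated through a circuit. -/
theorem UnifTo.secDiff {σ : ℝ → ℝ} {s x₀ : ℝ} (hs : s ≠ 0) (hσ : HasSecondDerivAt σ s x₀)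
    (hF : UnifTo A F f) {B : ℝ} (hB : ∀ x ∈ A, |f x| ≤ B) :
    UnifTo A (fun h x => secDiff σ s x₀ h (F h x)) (fun x => f x ^ 2) := by
  intro ε hε
  rcases A.eq_empty_or_nonempty with rfl | ⟨x₁, hx₁⟩
  · simp
  have hB0 : 0 ≤ B := (abs_nonneg _).trans (hB x₁ hx₁)
  have hs' : 0 < |s| := abs_pos.mpr hs
  obtain ⟨δ, hδ, hψ⟩ := hσ.second_difference
    (show 0 < ε / 2 * |s| / (B + 1) ^ 2 by positivity)
  have hη : 0 < min 1 (ε / 2 / (2 * B + 1)) := by positivity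
  have hh : ∀ᶠ h in 𝓝[≠] (0 : ℝ), |h| < δ / (B + 1) := by
    refine mem_nhdsWithin_of_mem_nhds ?_
    have : Metric.ball (0 : ℝ) (δ / (B + 1)) ∈ 𝓝 (0 : ℝ) := Metric.ball_mem_nhds _ (by positivity)
    filter_upwards [this] with h hh
    simpa using hh
  filter_upwards [hF _ hη, hh, self_mem_nhdsWithin] with h h1 h2 h3 x hx
  have h3 : h ≠ 0 := h3
  have h4 := h1 x hx
  have h5 : |F h x - f x| ≤ 1 := h4.trans (min_le_left _ _)
  have h6 : |F h x - f x| ≤ ε / 2 / (2 * B + 1) := h4.trans (min_le_right _ _)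
  have h7 := hB x hx
  have h8 : |F h x| ≤ B + 1 := by
    have := abs_add_le (F h x - f x) (f x)
    rw [sub_add_cancel] at this
    linarith
  set t := F h x
  have h9 : |h * t| ≤ δ := by
    rw [abs_mul]
    rw [lt_div_iff₀ (by positivity)] at h2
    have := abs_nonneg h
    nlinarith
  have h10 := hψ _ h9
  have hh2 : 0 < h ^ 2 := by positivity
  have h11 : |DeepNet.secDiff σ s x₀ h t - t ^ 2| ≤ ε / 2 := by
    have : DeepNet.secDiff σ s x₀ h t - t ^ 2 =
        (σ (x₀ + h * t) + σ (x₀ - h * t) - 2 * σ x₀ - s * (h * t) ^ 2) / (s * h ^ 2) := by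
      rw [DeepNet.secDiff]
      field_simp
    rw [this, abs_div, abs_mul, abs_of_pos hh2, div_le_iff₀ (by positivity)]
    refine h10.trans ?_
    have ht : t ^ 2 ≤ (B + 1) ^ 2 := by
      rw [← sq_abs]
      gcongr
    rw [mul_pow, div_mul_eq_mul_div, div_le_iff₀ (by positivity)]
    have : 0 ≤ ε / 2 * |s| * h ^ 2 := by positivity
    nlinarith
  have h12 : |t ^ 2 - f x ^ 2| ≤ ε / 2 := by
    rw [sq_sub_sq, abs_mul]
    have h13 : |t + f x| ≤ 2 * B + 1 := (abs_add_le _ _).trans (by linarith)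
    rw [le_div_iff₀ (by positivity)] at h6
    have := abs_nonneg (t - f x)
    nlinarith
  have := abs_add_le (DeepNet.secDiff σ s x₀ h t - t ^ 2) (t ^ 2 - f x ^ 2)
  rw [sub_add_sub_cancel] at this
  linarith

/-- Polarization. In the difference of the two quotients the terms with σ(x₀) cancel, so four
evaluations of σ suffice. -/
theorem UnifTo.mul_of_secDiff {σ : ℝ → ℝ} {s x₀ : ℝ} (hs : s ≠ 0) (hσ : HasSecondDerivAt σ s x₀)
    (hF : UnifTo A F f) (hF' : UnifTo A F' f') {B B' : ℝ} (hB : ∀ x ∈ A, |f x| ≤ B)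
    (hB' : ∀ x ∈ A, |f' x| ≤ B') :
    UnifTo A (fun h x => (DeepNet.secDiff σ s x₀ h (F h x + F' h x) -
      DeepNet.secDiff σ s x₀ h (F h x - F' h x)) / 4) (fun x => f x * f' x) := by
  have h1 := UnifTo.secDiff hs hσ (hF.lin hF' 1 1 0) (B := B + B') fun x hx => by
    have := abs_add_le (f x) (f' x)
    simp only [one_mul, add_zero]
    linarith [hB x hx, hB' x hx]
  have h2 := UnifTo.secDiff hs hσ (hF.lin hF' 1 (-1) 0) (B := B + B') fun x hx => by
    have := abs_sub (f x) (f' x)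
    simp only [one_mul, add_zero, neg_mul, ← sub_eq_add_neg]
    linarith [hB x hx, hB' x hx]
  have h3 := h1.lin h2 (1 / 4) (-1 / 4) 0
  intro ε hε
  filter_upwards [h3 ε hε] with h h4 x hx
  convert h4 x hx using 2
  simp only [one_mul, add_zero, neg_mul, ← sub_eq_add_neg]
  ring

end UnifTo

end DeepNet

end

noncomputable section

namespace DeepNet

open Set Filter Topology

/-! ### Realization of circuits by networks -/

section Indexed

variable {Θ X : Type*}

/-- Gates that are too deep are not used by the others. -/
theorem Valid.filter {S : Set (Node Θ X)} {l : List (Node Θ X)} (h : Valid S l) (D : ℕ) :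
    Valid S (l.filter fun g => g.2 ≤ D) := by
  induction l with
  | nil => trivial
  | cons g l ih =>
    rw [List.filter_cons]
    split_ifs with hg
    · refine ⟨ih h.1, ?_⟩
      obtain ⟨u, v, E, hu, hv, hE, h2⟩ := h.2
      have hg' : g.2 ≤ D := by simpa using hg
      have key : ∀ {u : Θ → X → ℝ}, Avail (S ∪ {x | x ∈ l}) u E →
          Avail (S ∪ {x | x ∈ l.filter fun g => g.2 ≤ D}) u E := by
        rintro u ⟨E', hE', hm | hm⟩
        · exact ⟨E', hE', Or.inl hm⟩
        · refine ⟨E', hE', Or.inr ?_⟩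
          rw [mem_ofPred_eq, List.mem_filter]
          exact ⟨hm, by simp; omega⟩
      exact ⟨u, v, E, key hu, key hv, hE, h2⟩
    · exact ih h.1

/-- Numbering of the gates of a circuit. -/
theorem Valid.exists_index {S : Set (Node Θ X)} {l : List (Node Θ X)} (h : Valid S l) :
    ∃ G : ℕ → Node Θ X, (∀ p ∈ l, ∃ i < l.length, G i = p) ∧ (∀ i < l.length, G i ∈ l) ∧
      ∀ i < l.length, IsGate (S ∪ {p | ∃ j < i, G j = p}) (G i) := by
  induction l with
  | nil => exact ⟨fun _ => (fun _ _ => 0, 0), by simp, by simp, by simp⟩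
  | cons g l ih =>
    obtain ⟨G, h1, h2, h3⟩ := ih h.1
    refine ⟨Function.update G l.length g, ?_, ?_, ?_⟩
    · intro p hp
      rcases List.mem_cons.mp hp with rfl | hp
      · exact ⟨l.length, by simp, by simp⟩
      · obtain ⟨i, hi, rfl⟩ := h1 p hp
        exact ⟨i, by simp; omega, Function.update_of_ne hi.ne _ _⟩
    · intro i hi
      rcases eq_or_ne i l.length with rfl | hne
      · simp
      · rw [Function.update_of_ne hne]
        simp only [List.length_cons] at hi
        exact List.mem_cons_of_mem _ (h2 i (by omega))
    · intro i hi
      simp only [List.length_cons] at hi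
      rcases eq_or_ne i l.length with rfl | hne
      · rw [Function.update_self]
        refine h.2.mono fun s hs => Avail.of_mem ?_
        rcases hs with hs | hs
        · exact Or.inl hs
        · obtain ⟨j, hj, rfl⟩ := h1 s hs
          exact Or.inr ⟨j, hj, Function.update_of_ne hj.ne _ _⟩
      · rw [Function.update_of_ne hne]
        refine (h3 i (by omega)).mono fun s hs => Avail.of_mem ?_
        rcases hs with hs | ⟨j, hj, rfl⟩
        · exact Or.inl hs
        · exact Or.inr ⟨j, hj, Function.update_of_ne (by omega) _ _⟩

end Indexed

variable {Θ : Type*} {d : ℕ}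

/-- The inputs of a network as nodes of a circuit. -/
def inputs (Θ : Type*) (d : ℕ) : Set (Node Θ (EuclideanSpace ℝ (Fin d))) :=
  range fun k => ((fun _ x => x k), 0)

/-- The node with a given number. -/
def srcNode (G : ℕ → Node Θ (EuclideanSpace ℝ (Fin d))) : Fin d ⊕ ℕ →
    Node Θ (EuclideanSpace ℝ (Fin d)) :=
  Sum.elim (fun k => ((fun _ x => x k), 0)) G

/-- The units that represent a node: four for each gate. -/
def expand : Fin d ⊕ ℕ → Finset (Fin d ⊕ ℕ)
  | Sum.inl k => {Sum.inl k}
  | Sum.inr j => (Finset.range 4).map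
      ⟨fun c => Sum.inr (4 * j + c), fun a b h => by
        have := Sum.inr_injective h
        omega⟩

theorem mem_expand {a : Fin d ⊕ ℕ} {m : ℕ} (h : Sum.inr m ∈ expand a) : a = Sum.inr (m / 4) := by
  rcases a with k | j
  · simp [expand] at h
  · simp only [expand, Finset.mem_map, Finset.mem_range] at h
    obtain ⟨c, hc, h⟩ := h
    have := Sum.inr_injective h
    congr 1
    omega

theorem card_expand_le (a : Fin d ⊕ ℕ) : (expand a).card ≤ 4 := by
  rcases a with k | j <;> simp [expand]

/-- The coefficients that recover the values of the nodes from those of the units. -/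
def unitCoeff (κ : ℝ) : Fin d ⊕ ℕ → ℝ
  | Sum.inl _ => 1
  | Sum.inr m => if m % 4 < 2 then κ else -κ

theorem sum_expand_inr (κ : ℝ) (F : Fin d ⊕ ℕ → ℝ) (j : ℕ) :
    ∑ s ∈ expand (Sum.inr j), unitCoeff κ s * F s =
      κ * (F (Sum.inr (4 * j)) + F (Sum.inr (4 * j + 1)) - F (Sum.inr (4 * j + 2)) -
        F (Sum.inr (4 * j + 3))) := by
  have h0 : (4 * j) % 4 < 2 := by omega
  have h1 : (4 * j + 1) % 4 < 2 := by omega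
  have h2 : ¬(4 * j + 2) % 4 < 2 := by omega
  have h3 : ¬(4 * j + 3) % 4 < 2 := by omega
  have hu : ∀ m, unitCoeff κ (Sum.inr m : Fin d ⊕ ℕ) = if m % 4 < 2 then κ else -κ := fun _ => rfl
  rw [expand, Finset.sum_map]
  change ∑ c ∈ Finset.range 4, unitCoeff κ (Sum.inr (4 * j + c)) * F (Sum.inr (4 * j + c)) = _
  simp only [Finset.sum_range_succ, Finset.sum_range_zero, hu, add_zero, h0, h1, h2, h3, if_true,
    if_false]
  ring

/-- Each gate becomes four units evaluating σ at x₀ ± h(U+V) and x₀ ± h(U-V), where U and V are its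
affine factors. The coefficients ±1/(4sh²) recovering the product UV are absorbed into the weights
of later units. A gate costs 4·(8+1) = 36 weights and the output at most 4 + 1. Uniform convergence
as h → 0 passes along the circuit since all gates are bounded on the cube. The step h may depend on
θ, the architecture does not. -/
theorem exists_network_of_comp {g : Θ → EuclideanSpace ℝ (Fin d) → ℝ} {D N W : ℕ}
    (hC : Comp (inputs Θ d) N {(g, D)}) (hW : 36 * N + 5 ≤ W) {σ : ℝ → ℝ} {s x₀ : ℝ} (hs : s ≠ 0)
    (hσ : HasSecondDerivAt σ s x₀) :
    ∃ η : Architecture d, η.numWeights = W ∧ η.depth ≤ D + 1 ∧ ∀ θ : Θ, ∀ ε > 0,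
      ∃ w : η.Param → ℝ, ∀ x ∈ cube d, |g θ x - η.eval σ w x| ≤ ε := by
  classical
  obtain ⟨l, hlN, hv, ha⟩ := hC
  obtain ⟨D', hD', hmem⟩ := ha _ rfl
  simp only at hD' hmem
  -- Depth also counts units without influence on the output, so gates deeper than D are discarded.
  set l' := l.filter fun g => g.2 ≤ D with hl'
  have hl'N : l'.length ≤ N := (List.length_filter_le _ _).trans hlN
  obtain ⟨G, hG1, hG2, hG3⟩ := (hv.filter D).exists_index
  set n := l'.length
  have hdepth : ∀ i < n, (G i).2 ≤ D := fun i hi => by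
    have := (List.mem_filter.mp (hG2 i hi)).2
    simpa using this
  -- sources of the gates
  have hsrc : ∀ {i : ℕ} {u : Θ → EuclideanSpace ℝ (Fin d) → ℝ} {E : ℕ},
      Avail (inputs Θ d ∪ {p | ∃ j < i, G j = p}) u E →
        ∃ a : Fin d ⊕ ℕ, (srcNode G a).1 = u ∧ ∀ j, a = Sum.inr j → j < i ∧ (G j).2 ≤ E := by
    rintro i u E ⟨E', hE', ⟨k, hk⟩ | ⟨j, hj, hp⟩⟩
    · exact ⟨Sum.inl k, congrArg Prod.fst hk, fun j hj => by simp at hj⟩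
    · refine ⟨Sum.inr j, congrArg Prod.fst hp, fun j' hj' => ?_⟩
      obtain rfl := Sum.inr_injective hj'
      exact ⟨hj, (congrArg Prod.snd hp).le.trans hE'⟩
  have hgate : ∀ i : ℕ, ∃ a b : Fin d ⊕ ℕ, ∃ A B C A' B' C' : Θ → ℝ,
      (∀ j, a = Sum.inr j → j < i) ∧ (∀ j, b = Sum.inr j → j < i) ∧ (i < n →
      (∀ j, a = Sum.inr j → (G j).2 + 1 ≤ (G i).2) ∧
      (∀ j, b = Sum.inr j → (G j).2 + 1 ≤ (G i).2) ∧ 1 ≤ (G i).2 ∧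
      (G i).1 = fun θ x =>
        (A θ * (srcNode G a).1 θ x + B θ * (srcNode G b).1 θ x + C θ) *
          (A' θ * (srcNode G a).1 θ x + B' θ * (srcNode G b).1 θ x + C' θ)) := by
    intro i
    by_cases hi : i < n
    · obtain ⟨u, v, E, hu, hv, hE, A, B, C, A', B', C', h⟩ := hG3 i hi
      obtain ⟨a, rfl, ha⟩ := hsrc hu
      obtain ⟨b, rfl, hb⟩ := hsrc hv
      exact ⟨a, b, A, B, C, A', B', C', fun j hj => (ha j hj).1, fun j hj => (hb j hj).1,
        fun _ => ⟨fun j hj => by have := (ha j hj).2; omega,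
          fun j hj => by have := (hb j hj).2; omega, by omega, h⟩⟩
    -- Indices beyond the circuit need dummy sources: an input if g is one, otherwise gate 0, which
    -- exists as g is then itself a gate.
    · rcases hmem with ⟨k, hk⟩ | hm
      · exact ⟨Sum.inl k, Sum.inl k, 0, 0, 0, 0, 0, 0, by simp, by simp, fun h => absurd h hi⟩
      · rcases Nat.eq_zero_or_pos i with rfl | hi0
        · have hm' : (g, D') ∈ l' := List.mem_filter.mpr ⟨hm, by simpa using hD'⟩
          have := List.length_pos_of_mem hm'
          exact absurd this hi
        · exact ⟨Sum.inr 0, Sum.inr 0, 0, 0, 0, 0, 0, 0, fun j hj => by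
            obtain rfl := Sum.inr_injective hj
            exact hi0, fun j hj => by
            obtain rfl := Sum.inr_injective hj
            exact hi0, fun h => absurd h hi⟩
  choose a b A B C A' B' C' hal hbl hgate using hgate
  obtain ⟨t, ht, htn⟩ : ∃ t : Fin d ⊕ ℕ, (srcNode G t).1 = g ∧ ∀ j, t = Sum.inr j → j < n := by
    rcases hmem with ⟨k, hk⟩ | hm
    · exact ⟨Sum.inl k, congrArg Prod.fst hk, by simp⟩
    · obtain ⟨i, hi, hGi⟩ := hG1 (g, D') (List.mem_filter.mpr ⟨hm, by simpa using hD'⟩)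
      refine ⟨Sum.inr i, congrArg Prod.fst hGi, fun j hj => ?_⟩
      obtain rfl := Sum.inr_injective hj
      exact hi
  -- the architecture
  set P : ℕ → Finset (Fin d ⊕ ℕ) := fun m =>
    if m < 4 * n then expand (a (m / 4)) ∪ expand (b (m / 4)) else ∅ with hPdef
  have hPmem : ∀ m j, Sum.inr j ∈ P m →
      m < 4 * n ∧ (a (m / 4) = Sum.inr (j / 4) ∨ b (m / 4) = Sum.inr (j / 4)) := by
    intro m j h
    simp only [hPdef] at h
    split_ifs at h with hm
    · rcases Finset.mem_union.mp h with h | h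
      · exact ⟨hm, Or.inl (mem_expand h)⟩
      · exact ⟨hm, Or.inr (mem_expand h)⟩
    · simp at h
  have hPlt : ∀ m j, Sum.inr j ∈ P m → j < m := by
    intro m j h
    rcases (hPmem m j h).2 with h | h
    · have := hal _ _ h
      omega
    · have := hbl _ _ h
      omega
  have hPcard : ∀ m, (P m).card ≤ 8 := by
    intro m
    simp only [hPdef]
    split_ifs
    · refine (Finset.card_union_le _ _).trans ?_
      have := card_expand_le (a (m / 4))
      have := card_expand_le (b (m / 4))
      omega
    · simp
  set core := (∑ i ∈ Finset.range (4 * n), ((P i).card + 1)) + ((expand t).card + 1) with hcore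
  have hcoreW : core ≤ W := by
    have h1 : ∑ i ∈ Finset.range (4 * n), ((P i).card + 1) ≤ ∑ _i ∈ Finset.range (4 * n), 9 :=
      Finset.sum_le_sum fun i _ => Nat.add_le_add_right (hPcard i) 1
    have h2 := card_expand_le t
    simp only [Finset.sum_const, Finset.card_range, smul_eq_mul] at h1
    omega
  have hQ : ∀ j, Sum.inr j ∈ expand t → j < 4 * n := by
    intro j h
    have := htn _ (mem_expand h)
    omega
  -- The W - core additional units have no incoming connections and carry one weight each, their
  -- bias; this makes the total exactly W.
  obtain ⟨η, hη, hsrcs⟩ := exists_hasSources (4 * n + (W - core)) P (expand t) hPlt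
    (fun j h => by have := hQ j h; omega)
  have hnum : η.numWeights = W := by
    rw [hsrcs.numWeights, hη, Finset.sum_range_add]
    have : ∑ x ∈ Finset.range (W - core), ((P (4 * n + x)).card + 1) = W - core := by
      rw [Finset.sum_congr rfl (g := fun _ => 1) fun x _ => by simp [hPdef]]
      simp
    rw [this]
    omega
  refine ⟨η, hnum, ?_, fun θ => ?_⟩
  · refine hsrcs.depth_le (δ := fun m => if m < 4 * n then (G (m / 4)).2 else 1) ?_ ?_
    · intro m _
      by_cases hm : m < 4 * n
      · obtain ⟨h1, h2, h3, -⟩ := hgate (m / 4) (by omega)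
        simp only [hm, if_true]
        refine ⟨h3, (hdepth _ (by omega)).trans (Nat.le_succ _), fun j hj => ?_⟩
        rw [if_pos ((hPlt m j hj).trans hm)]
        rcases (hPmem m j hj).2 with h | h
        · exact h1 _ h
        · exact h2 _ h
      · simp only [hm, if_false]
        exact ⟨le_rfl, by omega, fun j hj => absurd (hPmem m j hj).1 hm⟩
    · intro j hj
      have := hQ j hj
      simp only [this, if_true]
      exact hdepth _ (by omega)
  -- the weights
  set sg : ℕ → ℝ := fun c => if c % 2 = 0 then 1 else -1 with hsg
  set sg' : ℕ → ℝ := fun c => if c < 2 then 1 else -1 with hsg'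
  -- Both factors of a gate may read the same node; the indicators then add both contributions on
  -- the shared connections.
  set ω : ℝ → ℕ → Fin d ⊕ ℕ → ℝ := fun h m q =>
    h * sg (m % 4) * ((A (m / 4) θ + sg' (m % 4) * A' (m / 4) θ) *
        (if q ∈ expand (a (m / 4)) then 1 else 0) +
      (B (m / 4) θ + sg' (m % 4) * B' (m / 4) θ) * (if q ∈ expand (b (m / 4)) then 1 else 0)) *
      unitCoeff (1 / (4 * s * h ^ 2)) q with hω
  set β : ℝ → ℕ → ℝ := fun h m =>
    x₀ + h * sg (m % 4) * (C (m / 4) θ + sg' (m % 4) * C' (m / 4) θ) with hβ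
  set w : ℝ → η.Param → ℝ := fun h =>
    numberedParam η (ω h) (β h) (unitCoeff (1 / (4 * s * h ^ 2))) 0 with hw
  set val : ℝ → EuclideanSpace ℝ (Fin d) → Fin d ⊕ ℕ → ℝ := fun h x q =>
    ∑ p ∈ expand q, unitCoeff (1 / (4 * s * h ^ 2)) p * sourceValue η σ (w h) x p with hval
  have hinl : ∀ h x k, val h x (Sum.inl k) = x k := by
    intro h x k
    simp [hval, expand, unitCoeff, sourceValue]
  have hinr : ∀ h x, ∀ i < n, val h x (Sum.inr i) =
      (secDiff σ s x₀ h ((A i θ * val h x (a i) + B i θ * val h x (b i) + C i θ) +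
          (A' i θ * val h x (a i) + B' i θ * val h x (b i) + C' i θ)) -
        secDiff σ s x₀ h ((A i θ * val h x (a i) + B i θ * val h x (b i) + C i θ) -
          (A' i θ * val h x (a i) + B' i θ * val h x (b i) + C' i θ))) / 4 := by
    intro h x i hi
    have hunit : ∀ c < 4, sourceValue η σ (w h) x (Sum.inr (4 * i + c)) =
        σ (x₀ + h * (sg c * ((A i θ * val h x (a i) + B i θ * val h x (b i) + C i θ) + sg' c *
          (A' i θ * val h x (a i) + B' i θ * val h x (b i) + C' i θ)))) := by
      intro c hc
      have hm1 : (4 * i + c) / 4 = i := by omega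
      have hm2 : (4 * i + c) % 4 = c := by omega
      have hm3 : 4 * i + c < 4 * n := by omega
      have := hsrcs.hiddenValue_eq σ (ω h) (β h) (unitCoeff (1 / (4 * s * h ^ 2))) 0 x
        (m := 4 * i + c) (by omega)
      rw [sourceValue, Sum.elim_inr]
      simp only [hw]
      rw [this]
      congr 1
      have hPi : P (4 * i + c) = expand (a i) ∪ expand (b i) := by
        simp only [hPdef, hm1, hm3, if_true]
      have hsub1 : ∑ q ∈ expand (a i) ∪ expand (b i), (if q ∈ expand (a i) then 1 else 0) *
          (unitCoeff (1 / (4 * s * h ^ 2)) q * sourceValue η σ (w h) x q) = val h x (a i) := by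
        simp only [ite_mul, one_mul, zero_mul]
        rw [← Finset.sum_filter, Finset.filter_mem_eq_inter, Finset.union_inter_cancel_left]
      have hsub2 : ∑ q ∈ expand (a i) ∪ expand (b i), (if q ∈ expand (b i) then 1 else 0) *
          (unitCoeff (1 / (4 * s * h ^ 2)) q * sourceValue η σ (w h) x q) = val h x (b i) := by
        simp only [ite_mul, one_mul, zero_mul]
        rw [← Finset.sum_filter, Finset.filter_mem_eq_inter, Finset.union_inter_cancel_right]
      rw [hPi, ← hsub1, ← hsub2]
      simp only [hω, hβ, hm1, hm2]
      have hsum : ∀ α γ : ℝ, ∑ q ∈ expand (a i) ∪ expand (b i),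
          h * sg c * (α * (if q ∈ expand (a i) then 1 else 0) +
            γ * (if q ∈ expand (b i) then 1 else 0)) * unitCoeff (1 / (4 * s * h ^ 2)) q *
              sourceValue η σ (w h) x q =
          h * sg c * (α * ∑ q ∈ expand (a i) ∪ expand (b i), (if q ∈ expand (a i) then 1 else 0) *
            (unitCoeff (1 / (4 * s * h ^ 2)) q * sourceValue η σ (w h) x q) +
          γ * ∑ q ∈ expand (a i) ∪ expand (b i), (if q ∈ expand (b i) then 1 else 0) *
            (unitCoeff (1 / (4 * s * h ^ 2)) q * sourceValue η σ (w h) x q)) := by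
        intro α γ
        rw [Finset.mul_sum, Finset.mul_sum, ← Finset.sum_add_distrib, Finset.mul_sum]
        refine Finset.sum_congr rfl fun q _ => ?_
        ring
      have h3 := hsum (A i θ + sg' c * A' i θ) (B i θ + sg' c * B' i θ)
      simp only [hw, hω, hβ] at h3 ⊢
      rw [h3]
      ring
    have e0 := hunit 0 (by norm_num)
    have e1 := hunit 1 (by norm_num)
    have e2 := hunit 2 (by norm_num)
    have e3 := hunit 3 (by norm_num)
    have hvi : val h x (Sum.inr i) = ∑ p ∈ expand (Sum.inr i),
      unitCoeff (1 / (4 * s * h ^ 2)) p * sourceValue η σ (w h) x p := rfl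
    rw [hvi, sum_expand_inr]
    rw [add_zero] at e0
    rw [e0, e1, e2, e3, secDiff, secDiff]
    generalize A i θ * val h x (a i) + B i θ * val h x (b i) + C i θ = U
    generalize A' i θ * val h x (a i) + B' i θ * val h x (b i) + C' i θ = V
    have g0 : x₀ + h * (sg 0 * (U + sg' 0 * V)) = x₀ + h * (U + V) := by simp [hsg, hsg']
    have g1 : x₀ + h * (sg 1 * (U + sg' 1 * V)) = x₀ - h * (U + V) := by simp [hsg, hsg']; ring
    have g2 : x₀ + h * (sg 2 * (U + sg' 2 * V)) = x₀ + h * (U - V) := by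
      simp [hsg, hsg', sub_eq_add_neg]
    have g3 : x₀ + h * (sg 3 * (U + sg' 3 * V)) = x₀ - h * (U - V) := by simp [hsg, hsg']; ring
    rw [g0, g1, g2, g3, ← sub_div, div_div]
    rw [show 4 * s * h ^ 2 = s * h ^ 2 * 4 by ring]
    ring
  have hbase : ∀ k : Fin d, UnifTo (cube d) (fun h x => val h x (Sum.inl k)) (fun x => x k) ∧
      ∃ M : ℝ, ∀ x ∈ cube d, |x k| ≤ M := by
    intro k
    refine ⟨fun ε hε => Eventually.of_forall fun h x _ => ?_, 1, fun x hx => ?_⟩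
    · change |val h x (Sum.inl k) - x k| ≤ ε
      rw [hinl, sub_self, abs_zero]
      exact hε.le
    · exact abs_le.mpr ⟨by linarith [(hx k).1], (hx k).2⟩
  have hconv : ∀ i < n, UnifTo (cube d) (fun h x => val h x (Sum.inr i)) ((G i).1 θ) ∧
      ∃ M : ℝ, ∀ x ∈ cube d, |(G i).1 θ x| ≤ M := by
    intro i
    induction i using Nat.strong_induction_on with
    | _ i ih =>
      intro hi
      obtain ⟨-, -, -, hGi⟩ := hgate i hi
      have hq : ∀ q : Fin d ⊕ ℕ, (∀ j, q = Sum.inr j → j < i) →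
          UnifTo (cube d) (fun h x => val h x q) ((srcNode G q).1 θ) ∧
            ∃ M : ℝ, ∀ x ∈ cube d, |(srcNode G q).1 θ x| ≤ M := by
        rintro (k | j) hq
        · exact hbase k
        · exact ih j (hq j rfl) ((hq j rfl).trans hi)
      obtain ⟨ha1, Ma, ha2⟩ := hq _ (hal i)
      obtain ⟨hb1, Mb, hb2⟩ := hq _ (hbl i)
      have hlin : ∀ α γ ζ : ℝ, ∃ M : ℝ, ∀ x ∈ cube d,
          |α * (srcNode G (a i)).1 θ x + γ * (srcNode G (b i)).1 θ x + ζ| ≤ M := by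
        intro α γ ζ
        refine ⟨|α| * Ma + |γ| * Mb + |ζ|, fun x hx => ?_⟩
        refine (abs_add_le _ _).trans (add_le_add ((abs_add_le _ _).trans (add_le_add ?_ ?_)) le_rfl)
        · rw [abs_mul]
          gcongr
          exact ha2 x hx
        · rw [abs_mul]
          gcongr
          exact hb2 x hx
      obtain ⟨M1, hM1⟩ := hlin (A i θ) (B i θ) (C i θ)
      obtain ⟨M2, hM2⟩ := hlin (A' i θ) (B' i θ) (C' i θ)
      have h1 := UnifTo.mul_of_secDiff hs hσ (ha1.lin hb1 (A i θ) (B i θ) (C i θ))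
        (ha1.lin hb1 (A' i θ) (B' i θ) (C' i θ)) hM1 hM2
      rw [hGi]
      refine ⟨?_, M1 * M2, fun x hx => ?_⟩
      · intro ε hε
        filter_upwards [h1 ε hε] with h h2 x hx
        rw [hinr h x i hi]
        exact h2 x hx
      · rw [abs_mul]
        exact mul_le_mul (hM1 x hx) (hM2 x hx) (abs_nonneg _) ((abs_nonneg _).trans (hM1 x hx))
  have hfin : UnifTo (cube d) (fun h x => val h x t) (g θ) := by
    rw [← ht]
    rcases t with k | j
    · exact (hbase k).1
    · exact (hconv j (htn j rfl)).1
  intro ε hε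
  obtain ⟨h, hh⟩ := (hfin ε hε).exists
  refine ⟨w h, fun x hx => ?_⟩
  rw [hsrcs.eval_eq, add_zero, abs_sub_comm]
  exact hh x hx

/-- A network that computes the zero function. -/
theorem exists_zero_network (d : ℕ) (σ : ℝ → ℝ) {W : ℕ} (hW : 1 ≤ W) :
    ∃ η : Architecture d, η.numWeights = W ∧ η.depth ≤ 1 ∧
      ∃ w : η.Param → ℝ, ∀ x, η.eval σ w x = 0 := by
  obtain ⟨η, hη, hs⟩ := exists_hasSources (d := d) (W - 1) (fun _ => ∅) ∅ (by simp) (by simp)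
  refine ⟨η, ?_, ?_, fun _ => 0, fun x => by simp [Architecture.eval]⟩
  · rw [hs.numWeights, hη]
    simp
    omega
  · exact hs.depth_le (δ := fun _ => 1) (D := 0) (by simp) (by simp)

end DeepNet

end

noncomputable section

namespace DeepNet

open Set Polynomial

/-! ### The local approximant computed by the network -/

/-- The local coordinates obtained from approximate digits. -/
def netLoc {d : ℕ} (b : ℕ → Fin d → ℝ) (y : Fin d → ℝ) : ℕ → Fin d → ℝ
  | 0 => y
  | j + 1 => fun i => 2 * netLoc b y j i - b j i

/-- The sign with the number `t`, decoded from the code selected by approximate digits. -/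
def netSign {d : ℕ} (q κ : ℕ) (b : ℕ → Fin d → ℝ) (code : List (Fin d → Bool) → ℝ) (t : ℕ) : ℝ :=
  amp^[κ] (quart^[t] (mux b 0 q code))

/-- The local approximant computed from approximate digits, a table of values and a table of
codes of signs. -/
def netPart {d : ℕ} (k m : ℕ) (r A : ℝ) (q κ : ℕ) (b : ℕ → Fin d → ℝ) (y : Fin d → ℝ)
    (val : List (Fin d → Bool) → (Fin d → Fin (k + 1)) → ℝ) (code : List (Fin d → Bool) → ℝ)
    (idx : List (Fin d → Bool) × (Fin d → Fin (k + 1)) × Fin m → ℕ) : ℕ → ℝ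
  | 0 => ∑ a, mux b 0 q (fun c => val c a) * tlag a (netLoc b y q)
  | j + 1 => netPart k m r A q κ b y val code idx j + ∑ a, refScale r A (q + j) *
      quantValue (fun e => mux b q (j + 1) fun l => netSign q κ b code (idx (l, a, e))) *
        tlag a (netLoc b y (q + (j + 1)))

/-- Injectivity of `idx` on I turns the sign table into a sequence, to which `exists_code` applies.
-/
theorem exists_table_code {P : Type*} (I : Set P) (idx : P → ℕ) (hidx : InjOn idx I) {M : ℕ}
    (hM : ∀ p ∈ I, idx p < M) (g : P → Bool) :
    ∃ z : ℝ, |z| ≤ 1 ∧ ∀ p ∈ I, 1 / 2 ≤ sgn (g p) * quart^[idx p] z := by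
  classical
  rcases isEmpty_or_nonempty P with hP | hP
  · exact ⟨0, by simp, fun p => (hP.false p).elim⟩
  obtain ⟨z, hz, h⟩ := exists_code M fun t => g (Function.invFunOn idx I t)
  refine ⟨z, hz, fun p hp => ?_⟩
  have := h _ (hM p hp)
  rwa [hidx.leftInvOn_invFunOn hp] at this

/-- An enumeration of the corrections. -/
theorem exists_enumeration (d k m : ℕ) (hd : 0 < d) : ∃ C : ℕ, ∀ J : ℕ,
    ∃ idx : List (Fin d → Bool) × (Fin d → Fin (k + 1)) × Fin m → ℕ,
      InjOn idx {p | p.1.length ≤ J} ∧ ∀ p, p.1.length ≤ J → idx p < C * 2 ^ (d * J) := by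
  classical
  refine ⟨2 * Fintype.card ((Fin d → Fin (k + 1)) × Fin m), fun J => ?_⟩
  set A := (Fin d → Fin (k + 1)) × Fin m
  -- The extra 1 closes the induction: 2^d·|S| + 2 ≤ 2^d·(|S| + 1) because 2^d ≥ 2.
  have key : ∀ J : ℕ, ∃ S : Finset (List (Fin d → Bool)), (∀ l, l.length ≤ J → l ∈ S) ∧
      S.card + 1 ≤ 2 * 2 ^ (d * J) := by
    intro J
    induction J with
    | zero => exact ⟨{[]}, by simp, by simp⟩
    | succ J ih =>
      obtain ⟨S, hS, hc⟩ := ih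
      refine ⟨insert [] ((S ×ˢ (Finset.univ : Finset (Fin d → Bool))).image fun p => p.2 :: p.1),
        ?_, ?_⟩
      · rintro (_ | ⟨v, l⟩) hl
        · simp
        · refine Finset.mem_insert_of_mem (Finset.mem_image.mpr ⟨(l, v), ?_, rfl⟩)
          simpa using hS l (by simpa using hl)
      · refine (Nat.add_le_add_right (Finset.card_insert_le _ _) 1).trans ?_
        have h1 := Finset.card_image_le (s := S ×ˢ (Finset.univ : Finset (Fin d → Bool)))
          (f := fun p => p.2 :: p.1)
        rw [Finset.card_product, Finset.card_univ, Fintype.card_fun, Fintype.card_bool,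
          Fintype.card_fin] at h1
        have h2 : 2 ≤ 2 ^ d := by
          calc 2 = 2 ^ 1 := rfl
            _ ≤ 2 ^ d := Nat.pow_le_pow_right (by norm_num) hd
        have h3 : 2 * 2 ^ (d * (J + 1)) = 2 * 2 ^ (d * J) * 2 ^ d := by
          rw [Nat.mul_succ, pow_add]
          ring
        rw [h3]
        have h4 := Nat.mul_le_mul_right (2 ^ d) hc
        rw [add_mul] at h4
        omega
  obtain ⟨S, hS, hc⟩ := key J
  set T : Finset (List (Fin d → Bool) × A) := S ×ˢ Finset.univ
  have hT : ∀ p : List (Fin d → Bool) × A, p.1.length ≤ J → p ∈ T := fun p hp => by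
    simpa [T] using hS _ hp
  refine ⟨fun p => if h : p ∈ T then T.equivFin ⟨p, h⟩ else 0, ?_, ?_⟩
  · intro p hp p' hp' h
    simp only [hT p hp, hT p' hp', dif_pos] at h
    have := T.equivFin.injective (Fin.ext h)
    simpa using this
  · intro p hp
    simp only [hT p hp, dif_pos]
    refine (T.equivFin ⟨p, _⟩).2.trans_le ?_
    rw [Finset.card_product, Finset.card_univ, show Fintype.card ((Fin d → Fin (k + 1)) × Fin m) =
      Fintype.card A from rfl]
    calc S.card * Fintype.card A ≤ 2 * 2 ^ (d * J) * Fintype.card A :=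
          Nat.mul_le_mul_right _ (by omega)
      _ = _ := by ring

section Bounds

variable {d : ℕ} {b : ℕ → Fin d → ℝ} {y : Fin d → ℝ} {β : ℕ → Fin d → Bool} {ε : ℝ}

/-- No accuracy of the digits is assumed. Near cell boundaries this crude growth is all that is
known, and the tiny weight of the grid has to compensate for it. -/
theorem abs_netLoc_le (hb : ∀ j i, b j i ∈ Icc (0 : ℝ) 1) (hy : ∀ i, y i ∈ Icc (0 : ℝ) 1) (j : ℕ)
    (i : Fin d) : |netLoc b y j i| ≤ 2 ^ (j + 1) - 1 := by
  induction j with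
  | zero =>
    have := hy i
    rw [netLoc, abs_le]
    norm_num
    constructor <;> linarith [this.1, this.2]
  | succ j ih =>
    have h1 := hb j i
    have h2 := abs_le.mp ih
    rw [netLoc, abs_le, pow_succ]
    constructor <;> linarith [h1.1, h1.2, h2.1, h2.2]

/-- Each level doubles the error and adds ε. -/
theorem abs_netLoc_sub_le {n : ℕ} (hbβ : ∀ j < n, ∀ i, |b j i - bit (β j i)| ≤ ε)
    {j : ℕ} (hj : j ≤ n) (i : Fin d) : |netLoc b y j i - loc (addr β 0 j) y i| ≤ (2 ^ j - 1) * ε := by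
  induction j with
  | zero => simp [netLoc, addr, loc]
  | succ j ih =>
    have h1 := ih (by omega)
    have h2 := hbβ j (by omega) i
    rw [netLoc, addr, loc, zero_add]
    rw [show 2 * netLoc b y j i - b j i - (2 * loc (addr β 0 j) y i - bit (β j i)) =
      2 * (netLoc b y j i - loc (addr β 0 j) y i) - (b j i - bit (β j i)) by ring]
    refine (abs_sub _ _).trans ?_
    rw [abs_mul, abs_two, pow_succ]
    linarith

theorem abs_prod_sub_prod_le {ι : Type*} (I : Finset ι) {u v : ι → ℝ} {Λ δ : ℝ} (hΛ : 1 ≤ Λ)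
    (hu : ∀ i, |u i| ≤ Λ) (hv : ∀ i, |v i| ≤ Λ) (huv : ∀ i, |u i - v i| ≤ Λ * δ) (hδ : 0 ≤ δ) :
    |∏ i ∈ I, u i - ∏ i ∈ I, v i| ≤ I.card * Λ ^ I.card * δ := by
  classical
  induction I using Finset.induction_on with
  | empty => simp
  | insert i I hi ih =>
    rw [Finset.prod_insert hi, Finset.prod_insert hi, Finset.card_insert_of_notMem hi]
    have h1 : |∏ i ∈ I, u i| ≤ Λ ^ I.card := by
      rw [Finset.abs_prod]
      exact (Finset.prod_le_prod (fun _ _ => abs_nonneg _) fun i _ => hu i).trans (by simp)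
    have hd : u i * ∏ i ∈ I, u i - v i * ∏ i ∈ I, v i =
        (u i - v i) * ∏ i ∈ I, u i + v i * (∏ i ∈ I, u i - ∏ i ∈ I, v i) := by ring
    rw [hd]
    refine (abs_add_le _ _).trans ?_
    rw [abs_mul, abs_mul]
    calc _ ≤ Λ * δ * Λ ^ I.card + Λ * (I.card * Λ ^ I.card * δ) := by
          gcongr
          · exact huv i
          · exact hv i
      _ = _ := by
        push_cast
        ring

variable {k : ℕ} {Λ : ℝ} (hΛ : 1 ≤ Λ)
  (hlag : ∀ a : Fin (k + 1), (∀ t, |(lag k a).eval t| ≤ Λ * (1 + |t|) ^ k) ∧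
    (∀ t ∈ Icc (-1 : ℝ) 2, |(lag k a).eval t| ≤ Λ) ∧
    ∀ t ∈ Icc (-1 : ℝ) 2, ∀ u ∈ Icc (-1 : ℝ) 2,
      |(lag k a).eval t - (lag k a).eval u| ≤ Λ * |t - u|)

include hlag

theorem abs_tlag_le {ξ : Fin d → ℝ} (hξ : ∀ i, ξ i ∈ Icc (-1 : ℝ) 2) (a : Fin d → Fin (k + 1)) :
    |tlag a ξ| ≤ Λ ^ d := by
  rw [tlag, Finset.abs_prod]
  exact (Finset.prod_le_prod (fun _ _ => abs_nonneg _) fun i _ =>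
    (hlag (a i)).2.1 _ (hξ i)).trans (by simp)

include hΛ in
theorem abs_tlag_sub_le {ξ ξ' : Fin d → ℝ} (hξ : ∀ i, ξ i ∈ Icc (-1 : ℝ) 2)
    (hξ' : ∀ i, ξ' i ∈ Icc (-1 : ℝ) 2) {δ : ℝ} (hδ : 0 ≤ δ) (h : ∀ i, |ξ i - ξ' i| ≤ δ)
    (a : Fin d → Fin (k + 1)) : |tlag a ξ - tlag a ξ'| ≤ d * Λ ^ d * δ := by
  have := abs_prod_sub_prod_le (Finset.univ : Finset (Fin d)) (u := fun i => (lag k (a i)).eval (ξ i))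
    (v := fun i => (lag k (a i)).eval (ξ' i)) hΛ (fun i => (hlag (a i)).2.1 _ (hξ i))
    (fun i => (hlag (a i)).2.1 _ (hξ' i))
    (fun i => ((hlag (a i)).2.2 _ (hξ i) _ (hξ' i)).trans (by gcongr; exact h i)) hδ
  simpa [tlag] using this

include hΛ in
theorem abs_tlag_netLoc_le (hb : ∀ j i, b j i ∈ Icc (0 : ℝ) 1) (hy : ∀ i, y i ∈ Icc (0 : ℝ) 1)
    {j n : ℕ} (hj : j ≤ n) (a : Fin d → Fin (k + 1)) :
    |tlag a (netLoc b y j)| ≤ (Λ * (2 ^ (n + 1)) ^ k) ^ d := by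
  rw [tlag, Finset.abs_prod]
  refine (Finset.prod_le_prod (fun _ _ => abs_nonneg _) fun i _ =>
    ((hlag (a i)).1 _).trans ?_).trans (by simp : ∏ _i : Fin d, (Λ * (2 ^ (n + 1)) ^ k) ≤ _)
  have h1 := abs_netLoc_le hb hy j i
  have h2 : (2 : ℝ) ^ (j + 1) ≤ 2 ^ (n + 1) := pow_le_pow_right₀ (by norm_num) (by omega)
  gcongr
  linarith

include hΛ in
/-- One term of the approximant. -/
theorem abs_term_sub_le {n j : ℕ} (hd : 0 < d) (hj : j ≤ n) (hε : 0 ≤ ε) (hε1 : 2 ^ n * ε ≤ 1)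
    (hbβ : ∀ j < n, ∀ i, |b j i - bit (β j i)| ≤ ε)
    (hloc : ∀ i, loc (addr β 0 j) y i ∈ Icc (0 : ℝ) 1) {Q Q' : ℝ} (hQ : |Q| ≤ 1)
    (hQQ : |Q' - Q| ≤ (2 * d * n + 1) * ε) (a : Fin d → Fin (k + 1)) :
    |Q' * tlag a (netLoc b y j) - Q * tlag a (loc (addr β 0 j) y)| ≤
      4 * d * 2 ^ n * Λ ^ d * ε := by
  have h2j : (2 : ℝ) ^ j ≤ 2 ^ n := pow_le_pow_right₀ (by norm_num) hj
  have hδ : ∀ i, |netLoc b y j i - loc (addr β 0 j) y i| ≤ 2 ^ n * ε := fun i =>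
    (abs_netLoc_sub_le hbβ hj i).trans (by gcongr; linarith)
  have hξ' : ∀ i, loc (addr β 0 j) y i ∈ Icc (-1 : ℝ) 2 := fun i =>
    ⟨by linarith [(hloc i).1], by linarith [(hloc i).2]⟩
  have hξ : ∀ i, netLoc b y j i ∈ Icc (-1 : ℝ) 2 := fun i => by
    have h1 := abs_le.mp (hδ i)
    exact ⟨by linarith [(hloc i).1, h1.1], by linarith [(hloc i).2, h1.2]⟩
  have h1 := abs_tlag_le hlag hξ a
  have h2 := abs_tlag_sub_le hΛ hlag hξ hξ' (by positivity) hδ a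
  have hd1 : (1 : ℝ) ≤ d := by exact_mod_cast hd
  have hn : (n : ℝ) + 1 ≤ 2 ^ n := by exact_mod_cast (Nat.lt_two_pow_self : n < 2 ^ n)
  have h3 : Q' * tlag a (netLoc b y j) - Q * tlag a (loc (addr β 0 j) y) =
      (Q' - Q) * tlag a (netLoc b y j) +
        Q * (tlag a (netLoc b y j) - tlag a (loc (addr β 0 j) y)) := by ring
  rw [h3]
  refine (abs_add_le _ _).trans ?_
  rw [abs_mul, abs_mul]
  calc _ ≤ ((2 * d * n + 1) * ε) * Λ ^ d + 1 * (d * Λ ^ d * (2 ^ n * ε)) := by gcongr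
    _ = (2 * d * n + 1 + d * 2 ^ n) * (Λ ^ d * ε) := by ring
    _ ≤ (4 * d * 2 ^ n) * (Λ ^ d * ε) := by
      gcongr
      nlinarith
    _ = _ := by ring

end Bounds

section Approximant

variable {d k m q κ J : ℕ} {r A ε Λ : ℝ} {b : ℕ → Fin d → ℝ} {y : Fin d → ℝ}
  {val : List (Fin d → Bool) → (Fin d → Fin (k + 1)) → ℝ} {code : List (Fin d → Bool) → ℝ}
  {idx : List (Fin d → Bool) × (Fin d → Fin (k + 1)) × Fin m → ℕ}

theorem refScale_le (hr : 0 < r) (hA : 0 < A) (j : ℕ) : 0 ≤ refScale r A j ∧ refScale r A j ≤ A := by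
  have h : (2 : ℝ) ^ (-(r * j)) ≤ 1 :=
    Real.rpow_le_one_of_one_le_of_nonpos (by norm_num) (by
      have : 0 ≤ r * j := by positivity
      linarith)
  rw [refScale]
  exact ⟨by positivity, by nlinarith⟩

theorem abs_quantValue_le {s : Fin m → ℝ} (hs : ∀ e, |s e| ≤ 1) : |quantValue s| ≤ 1 := by
  have h := abs_quantValue_sub_le (s := s) (t := fun _ => 0) zero_le_one fun e => by simpa using hs e
  have h0 : quantValue (fun _ : Fin m => (0 : ℝ)) = 0 := by simp [quantValue]
  rwa [h0, sub_zero] at h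

theorem abs_netSign_le (hb : ∀ j i, b j i ∈ Icc (0 : ℝ) 1) (hcode : ∀ l, |code l| ≤ 1) (t : ℕ) :
    |netSign q κ b code t| ≤ 1 :=
  abs_iterate_amp_le (abs_iterate_quart_le (abs_mux_le hb _ _ hcode) _) _

theorem abs_netPart_le (hr : 0 < r) (hA : 0 < A) (hΛ : 1 ≤ Λ)
    (hlag : ∀ a : Fin (k + 1), (∀ t, |(lag k a).eval t| ≤ Λ * (1 + |t|) ^ k) ∧
      (∀ t ∈ Icc (-1 : ℝ) 2, |(lag k a).eval t| ≤ Λ) ∧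
      ∀ t ∈ Icc (-1 : ℝ) 2, ∀ u ∈ Icc (-1 : ℝ) 2,
        |(lag k a).eval t - (lag k a).eval u| ≤ Λ * |t - u|)
    (hb : ∀ j i, b j i ∈ Icc (0 : ℝ) 1) (hy : ∀ i, y i ∈ Icc (0 : ℝ) 1)
    (hval : ∀ c a, |val c a| ≤ 1) (hcode : ∀ l, |code l| ≤ 1) {j : ℕ} (hj : j ≤ J) :
    |netPart k m r A q κ b y val code idx j| ≤
      (j + 1) * ((k + 1) ^ d * ((1 + A) * (Λ * (2 ^ (q + J + 1)) ^ k) ^ d)) := by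
  have hsum : ∀ (c : (Fin d → Fin (k + 1)) → ℝ) (j' : ℕ), j' ≤ q + J → (∀ a, |c a| ≤ 1 + A) →
      |∑ a, c a * tlag a (netLoc b y j')| ≤
        (k + 1) ^ d * ((1 + A) * (Λ * (2 ^ (q + J + 1)) ^ k) ^ d) := by
    intro c j' hj' hc
    refine (Finset.abs_sum_le_sum_abs _ _).trans ((Finset.sum_le_sum (g := fun _ =>
      (1 + A) * (Λ * (2 ^ (q + J + 1)) ^ k) ^ d) fun a _ => ?_).trans (by simp))
    rw [abs_mul]
    gcongr
    · exact hc a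
    · exact abs_tlag_netLoc_le hΛ hlag hb hy hj' a
  induction j with
  | zero =>
    rw [netPart]
    refine (hsum _ q (by omega) fun a => ?_).trans (by simp)
    exact (abs_mux_le hb _ _ fun l => hval l a).trans (by linarith)
  | succ j ih =>
    rw [netPart]
    have h1 := ih (by omega)
    have h2 := hsum (fun a => refScale r A (q + j) * quantValue (fun e => mux b q (j + 1) fun l =>
      netSign q κ b code (idx (l, a, e)))) (q + (j + 1)) (by omega) fun a => by
        obtain ⟨h3, h4⟩ := refScale_le hr hA (q + j)
        rw [abs_mul, abs_of_nonneg h3]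
        have h5 : |quantValue (fun e => mux b q (j + 1) fun l =>
            netSign q κ b code (idx (l, a, e)))| ≤ 1 :=
          abs_quantValue_le fun e => abs_mux_le hb _ _ fun l => abs_netSign_le hb hcode _
        nlinarith [abs_nonneg (quantValue (fun e => mux b q (j + 1) fun l =>
            netSign q κ b code (idx (l, a, e))))]
    refine (abs_add_le _ _).trans ?_
    push_cast
    linarith

variable {β : ℕ → Fin d → Bool} {M : ℕ}

/-- The selected code is off by at most 2dqε, and decoding amplifies this by 16^t. By `hM` this uses
up at most 1/4 of the margin 1/2, and the amplifier restores the sign from the rest. -/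
theorem abs_netSign_sub_le (hb : ∀ j i, b j i ∈ Icc (0 : ℝ) 1) (hε : ε ≤ 1)
    (hbβ : ∀ j < q, ∀ i, |b j i - bit (β j i)| ≤ ε) (hcode : ∀ l, |code l| ≤ 1)
    (hM : 16 ^ M * (q * (2 * d * ε)) ≤ 1 / 4) {t : ℕ} (ht : t ≤ M) {v : Bool}
    (hv : 1 / 2 ≤ sgn v * quart^[t] (code (addr β 0 q))) :
    |netSign q κ b code t - sgn v| ≤ ampErr (1 / 4) κ := by
  have h1 := abs_mux_sub_le hb (o := 0) (N := q) hε (by simpa using hbβ) hcode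
  rw [mul_one] at h1
  have hz := abs_mux_le hb 0 q hcode
  have h2 := abs_iterate_quart_sub_le hz (hcode (addr β 0 q)) t
  have h3 : (16 : ℝ) ^ t ≤ 16 ^ M := pow_le_pow_right₀ (by norm_num) ht
  have h4 : |quart^[t] (mux b 0 q code) - quart^[t] (code (addr β 0 q))| ≤ 1 / 4 :=
    h2.trans ((mul_le_mul h3 h1 (abs_nonneg _) (by positivity)).trans hM)
  refine abs_iterate_amp_sub_sgn_le (abs_iterate_quart_le hz t) (by norm_num) κ ?_
  have h5 : |sgn v * (quart^[t] (mux b 0 q code) - quart^[t] (code (addr β 0 q)))| ≤ 1 / 4 := by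
    rwa [abs_mul, abs_sgn, one_mul]
  linarith [(abs_le.mp h5).1]

/-- Comparison term by term: selected values, decoded signs and local coordinates each deviate from
the exact ones by a multiple of ε, since all digits are accurate and the exact local coordinates lie
in the unit cube. -/
theorem abs_netPart_sub_refine_le (hd : 0 < d) (hr : 0 < r) (hA : 0 < A) (hΛ : 1 ≤ Λ)
    (hlag : ∀ a : Fin (k + 1), (∀ t, |(lag k a).eval t| ≤ Λ * (1 + |t|) ^ k) ∧
      (∀ t ∈ Icc (-1 : ℝ) 2, |(lag k a).eval t| ≤ Λ) ∧
      ∀ t ∈ Icc (-1 : ℝ) 2, ∀ u ∈ Icc (-1 : ℝ) 2,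
        |(lag k a).eval t - (lag k a).eval u| ≤ Λ * |t - u|)
    (hb : ∀ j i, b j i ∈ Icc (0 : ℝ) 1) (hε0 : 0 ≤ ε) (hε1 : 2 ^ (q + J) * ε ≤ 1)
    (hbβ : ∀ j < q + J, ∀ i, |b j i - bit (β j i)| ≤ ε)
    (hloc : ∀ j ≤ q + J, ∀ i, loc (addr β 0 j) y i ∈ Icc (0 : ℝ) 1)
    (hcode : ∀ l, |code l| ≤ 1) (hval : ∀ c a, |val c a| ≤ 1)
    (hM : 16 ^ M * (q * (2 * d * ε)) ≤ 1 / 4) (hκ : ampErr (1 / 4) κ ≤ ε)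
    {g : (Fin d → ℝ) → ℝ} (hg : ∀ a, val (addr β 0 q) a = g (cellNode (addr β 0 q) a))
    (hidx : ∀ p, p.1.length ≤ J → idx p ≤ M)
    (hsgn : ∀ l a e, l.length ≤ J → 1 / 2 ≤ sgn (refSign k m r A g (addr β 0 q) l a e) *
      quart^[idx (l, a, e)] (code (addr β 0 q))) {j : ℕ} (hj : j ≤ J) :
    |netPart k m r A q κ b y val code idx j -
        refine k m r A g (addr β 0 q) (addr β q j) y| ≤
      (j + 1) * ((k + 1) ^ d * ((1 + A) * (4 * d * 2 ^ (q + J) * Λ ^ d * ε))) := by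
  have hε : ε ≤ 1 := by
    have : (1 : ℝ) ≤ 2 ^ (q + J) := one_le_pow₀ (by norm_num)
    nlinarith
  have hsum : ∀ (ρ : ℝ) (Q' Q : (Fin d → Fin (k + 1)) → ℝ) (i : ℕ), 0 ≤ ρ → ρ ≤ 1 + A → i ≤ q + J →
      (∀ a, |Q a| ≤ 1) → (∀ a, |Q' a - Q a| ≤ (2 * d * (q + J : ℕ) + 1) * ε) →
      |∑ a, ρ * Q' a * tlag a (netLoc b y i) - ∑ a, ρ * Q a * tlag a (loc (addr β 0 i) y)| ≤
        (k + 1) ^ d * ((1 + A) * (4 * d * 2 ^ (q + J) * Λ ^ d * ε)) := by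
    intro ρ Q' Q i hρ hρ' hi hQ hQQ
    rw [← Finset.sum_sub_distrib]
    refine (Finset.abs_sum_le_sum_abs _ _).trans ((Finset.sum_le_sum (g := fun _ =>
      (1 + A) * (4 * d * 2 ^ (q + J) * Λ ^ d * ε)) fun a _ => ?_).trans (by simp))
    rw [mul_assoc, mul_assoc, ← mul_sub, abs_mul, abs_of_nonneg hρ]
    gcongr
    exact abs_term_sub_le hΛ hlag hd hi hε0 hε1 hbβ (hloc i hi) (hQ a) (hQQ a) a
  induction j with
  | zero =>
    simp only [netPart, addr, refine]
    have h := hsum 1 (fun a => mux b 0 q fun c => val c a) (fun a => val (addr β 0 q) a) q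
      zero_le_one (by linarith) (by omega) (fun a => hval _ a) fun a => by
        refine (abs_mux_sub_le hb hε (fun j hj => hbβ j (by omega)) fun l => hval l a).trans ?_
        push_cast
        have h1 : (0 : ℝ) ≤ 2 * d * ε * J := by positivity
        nlinarith
    simp only [one_mul] at h
    simp only [← hg]
    refine h.trans (by simp)
  | succ j ih =>
    have h1 := ih (by omega)
    rw [netPart, addr, refine_cons, List.length_append, length_addr, length_addr, add_comm j q]
    have hcons : β (q + j) :: addr β q j = addr β q (j + 1) := rfl
    rw [hcons, addr_append]
    obtain ⟨h3, h4⟩ := refScale_le hr hA (q + j)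
    have h2 := hsum (refScale r A (q + j)) (fun a => quantValue (fun e => mux b q (j + 1) fun l =>
        netSign q κ b code (idx (l, a, e))))
      (fun a => quantValue (fun e => sgn (refSign k m r A g (addr β 0 q) (addr β q (j + 1)) a e)))
      (q + (j + 1)) h3 (by linarith) (by omega)
      (fun a => abs_quantValue_le fun e => (abs_sgn _).le) fun a => by
        refine abs_quantValue_sub_le (by positivity) fun e => ?_
        -- The selection error needs only the bound 1 on all decoded signs; accuracy of the sign is
        -- then used just for the true subcell.
        have h5 := abs_mux_sub_le hb hε (o := q) (N := j + 1) (β := β)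
          (fun i hi => hbβ i (by omega))
          (w := fun l => netSign q κ b code (idx (l, a, e))) (B := 1)
          fun l => abs_netSign_le hb hcode _
        have hlen : (addr β q (j + 1)).length ≤ J := by rwa [length_addr]
        have h6 := abs_netSign_sub_le (κ := κ) hb hε (fun i hi => hbβ i (by omega)) hcode hM
          (hidx (addr β q (j + 1), a, e) hlen) (hsgn _ a e hlen)
        refine (abs_sub_le _ _ _).trans ((add_le_add h5 (h6.trans hκ)).trans ?_)
        have h7 : ((j + 1 : ℕ) : ℝ) ≤ (q + J : ℕ) := by exact_mod_cast (by omega : j + 1 ≤ q + J)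
        have h8 : (0 : ℝ) ≤ 2 * d * ε := by positivity
        nlinarith
    rw [show ∀ u v u' v' : ℝ, u + v - (u' + v') = (u - u') + (v - v') by intros; ring]
    refine (abs_add_le _ _).trans ?_
    push_cast
    linarith

end Approximant

end DeepNet

end

noncomputable section

namespace DeepNet

open Set

/-! ### The approximant computed by the network -/

/-- The approximant: local approximants on shifted grids, glued by weights that vanish near the
boundaries of the cells. -/
def netApprox {d : ℕ} (k m : ℕ) (r A : ℝ) (q J κ : ℕ)
    (val : (Fin d → Bool) → List (Fin d → Bool) → (Fin d → Fin (k + 1)) → ℝ)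
    (code : (Fin d → Bool) → List (Fin d → Bool) → ℝ)
    (idx : List (Fin d → Bool) × (Fin d → Fin (k + 1)) × Fin m → ℕ)
    (x : EuclideanSpace ℝ (Fin d)) : ℝ :=
  ∑ s : Fin d → Bool,
    pw (fun i => netWeight (q + J) κ (gridCoord (q + J) (fun _ => false) x i)) s *
      netPart k m r A q κ (fun j i => netDigit (q + J) κ (gridCoord (q + J) s x i) j)
        (gridCoord (q + J) s x) (val s) (code s) idx J

theorem two_pow_le_exp (n : ℕ) : (2 : ℝ) ^ n ≤ Real.exp n := by
  have h := Real.add_one_le_exp 1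
  have h1 := Real.exp_nat_mul 1 n
  rw [mul_one] at h1
  rw [h1]
  gcongr
  linarith

theorem exp_neg_mul_le_two_rpow {r : ℝ} (hr : 0 ≤ r) (n : ℕ) :
    Real.exp (-(r * n)) ≤ 2 ^ (-(r * n)) := by
  rw [Real.rpow_def_of_pos two_pos]
  have h : Real.log 2 ≤ 1 := by linarith [Real.log_two_lt_d9]
  have h1 : 0 ≤ r * n := by positivity
  rw [Real.exp_le_exp]
  nlinarith

/-- The first 2n + 8 iterations cancel the squared margin (2^(-n)/16)². The next dn provide the
exponent 2^(dn) ≥ 2^(dJ), n + 1, and the last H provide the factor L. -/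
theorem exists_ampErr_le (d : ℕ) (hd : 0 < d) (L : ℝ) : ∃ H : ℕ, ∀ n J : ℕ, J ≤ n →
    ampErr (1 / 16 / 2 ^ n) (2 * n + 8 + d * n + H) ≤ Real.exp (-(L * (2 ^ (d * J) + n + 1))) := by
  obtain ⟨H, hH⟩ := pow_unbounded_of_one_lt (2 * max L 0) (one_lt_two : (1 : ℝ) < 2)
  refine ⟨H, fun n J hJ => ?_⟩
  rw [ampErr, Real.exp_le_exp, neg_le_neg_iff]
  have h1 : ((1 : ℝ) / 16 / 2 ^ n) ^ 2 * 2 ^ (2 * n + 8 + d * n + H) = 2 ^ H * 2 ^ (d * n) := by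
    rw [pow_add, pow_add, pow_add, pow_mul' (2 : ℝ) 2 n]
    field_simp
    norm_num
  rw [h1]
  have h2 : (2 : ℝ) ^ (d * J) ≤ 2 ^ (d * n) :=
    pow_le_pow_right₀ one_le_two (Nat.mul_le_mul_left d hJ)
  have h3 : (n : ℝ) + 1 ≤ 2 ^ (d * n) := by
    have h4 : n + 1 ≤ 2 ^ n := Nat.lt_two_pow_self
    have h5 : 2 ^ n ≤ 2 ^ (d * n) := Nat.pow_le_pow_right two_pos (Nat.le_mul_of_pos_left n hd)
    exact_mod_cast h4.trans h5
  calc L * (2 ^ (d * J) + n + 1) ≤ max L 0 * (2 ^ (d * n) + 2 ^ (d * n)) := by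
        refine mul_le_mul (le_max_left _ _) (by linarith) (by positivity) (le_max_right _ _)
    _ = 2 * max L 0 * 2 ^ (d * n) := by ring
    _ ≤ _ := by gcongr

theorem loc_addr_digit {d : ℕ} (y : Fin d → ℝ) (j : ℕ) (i : Fin d) :
    loc (addr (fun j i => digit (y i) j) 0 j) y i = fracPart (y i) j := by
  induction j with
  | zero => rfl
  | succ j ih =>
    simp only [addr, loc, fracPart, zero_add]
    rw [ih]

/-- The weights of the grids sum to 1, so the error is an average over the grids s. Where all
coordinates are away from the boundaries of grid s, its local approximant is accurate. Otherwise the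
weight of s is at most ε, which outweighs the growth of the approximant. -/
theorem exists_netApprox {d : ℕ} (hd : 0 < d) {r : ℝ} (hr : 0 < r) :
    ∃ A B : ℝ, ∃ m C H : ℕ, 0 < B ∧ ∀ q J : ℕ,
      ∃ idx : List (Fin d → Bool) × (Fin d → Fin (intPart r + 1)) × Fin m → ℕ,
        (∀ p, p.1.length ≤ J → idx p < C * 2 ^ (d * J)) ∧ ∀ f ∈ holderBall d r, ∃ val code,
          ∀ x ∈ cube d, |f x - netApprox (intPart r) m r A q J
            (2 * (q + J) + 8 + d * (q + J) + H) val code idx x| ≤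
              B * 2 ^ (-(r * (q + J : ℕ))) := by
  classical
  obtain ⟨A, hA, m, href⟩ := exists_refine_bound hd hr
  set k := intPart r with hk
  obtain ⟨Λ, hΛ, hlag⟩ := exists_lag_bound k
  obtain ⟨C, hC⟩ := exists_enumeration d k m hd
  -- One summand for each factor that ε must beat: the target rate 2^(rn), powers 2^(2n), the growth
  -- 2^((n+1)kd) of basis polynomials, the decoder's 16^(C·2^(dJ)), and the remaining factor
  -- 8d(n+1).
  set L : ℝ := r + 2 + k * d + 4 * C + 8 * d with hL
  obtain ⟨H, hH⟩ := exists_ampErr_le d hd L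
  set B₁ : ℝ := (k + 1) ^ d * ((1 + A) * (4 * d * Λ ^ d)) with hB₁
  set B₂ : ℝ := 1 + (k + 1) ^ d * ((1 + A) * Λ ^ d) with hB₂
  have hB₁0 : 0 ≤ B₁ := by positivity
  have hB₂0 : 0 ≤ B₂ := by positivity
  refine ⟨A, A + B₁ + 2 ^ d * B₂, m, C, H, by positivity, fun q J => ?_⟩
  obtain ⟨idx, hinj, hidx⟩ := hC J
  refine ⟨idx, hidx, fun f hf => ?_⟩
  set n := q + J with hn
  set κ := 2 * n + 8 + d * n + H with hκ
  set ε := ampErr (1 / 16 / 2 ^ n) κ with hεdef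
  set T : ℝ := 2 ^ (d * J) + n + 1 with hT
  have hε : ε ≤ Real.exp (-(L * T)) := hH n J (by omega)
  have hε0 : 0 ≤ ε := (Real.exp_pos _).le
  have h2J : (0 : ℝ) < 2 ^ (d * J) := by positivity
  have hLT : r * n + 2 * n + (n + 1) * (k * d) + 4 * C * 2 ^ (d * J) + 8 * d * (n + 1) ≤ L * T := by
    have e1 : (0 : ℝ) ≤ r * (2 ^ (d * J) + 1) := by positivity
    have e2 : (0 : ℝ) ≤ 2 * (2 ^ (d * J) + 1) := by positivity
    have e3 : (0 : ℝ) ≤ (k * d) * 2 ^ (d * J) := by positivity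
    have e4 : (0 : ℝ) ≤ 4 * C * (n + 1) := by positivity
    have e5 : (0 : ℝ) ≤ 8 * d * 2 ^ (d * J) := by positivity
    rw [hL, hT]
    nlinarith
  have hr0 : (0 : ℝ) ≤ r * n := by positivity
  have hkd0 : (0 : ℝ) ≤ (n + 1) * (k * d) := by positivity
  have hC0 : (0 : ℝ) ≤ 4 * C * 2 ^ (d * J) := by positivity
  have hd0 : (0 : ℝ) ≤ 8 * d * (n + 1) := by positivity
  have hn0 : (0 : ℝ) ≤ n := by positivity
  have hexp : ∀ u v : ℝ, ∀ z : ℝ, 0 ≤ z → z ≤ Real.exp u → u + v ≤ L * T →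
      z * ε ≤ Real.exp (-v) := by
    intro u v z hz hzu huv
    calc z * ε ≤ Real.exp u * Real.exp (-(L * T)) := by gcongr
      _ = Real.exp (u - L * T) := by rw [← Real.exp_add, sub_eq_add_neg]
      _ ≤ Real.exp (-v) := Real.exp_le_exp.mpr (by linarith)
  have hrate := exp_neg_mul_le_two_rpow hr.le n
  have hε1 : 2 ^ n * ε ≤ 1 := by
    have := hexp n 0 (2 ^ n) (by positivity) (two_pow_le_exp n) (by linarith)
    simpa using this
  have hM : (16 : ℝ) ^ (C * 2 ^ (d * J)) * (q * (2 * d * ε)) ≤ 1 / 4 := by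
    have h1 := hexp (4 * C * 2 ^ (d * J) + 8 * d * (n + 1)) 0
      (16 ^ (C * 2 ^ (d * J)) * (8 * d * (n + 1))) (by positivity) (by
        rw [Real.exp_add]
        have h2 := two_pow_le_exp (4 * (C * 2 ^ (d * J)))
        rw [pow_mul] at h2
        push_cast at h2
        rw [← mul_assoc] at h2
        norm_num at h2
        have h3 := Real.add_one_le_exp (8 * d * (n + 1) : ℝ)
        gcongr
        linarith) (by linarith)
    rw [neg_zero, Real.exp_zero] at h1
    have h2 : (q : ℝ) ≤ n + 1 := by
      rw [hn]
      push_cast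
      linarith [show (0 : ℝ) ≤ J by positivity]
    have h3 : (16 : ℝ) ^ (C * 2 ^ (d * J)) * (q * (2 * d * ε)) ≤
        16 ^ (C * 2 ^ (d * J)) * ((n + 1) * (2 * d * ε)) := by gcongr
    refine h3.trans ?_
    linarith
  have hJn : (J : ℝ) + 1 ≤ 2 ^ n := by
    exact_mod_cast (show J + 1 ≤ 2 ^ n from
      (show J + 1 ≤ n + 1 by omega).trans Nat.lt_two_pow_self)
  have hgood : ((J : ℝ) + 1) * ((k + 1) ^ d * ((1 + A) * (4 * d * 2 ^ n * Λ ^ d * ε))) ≤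
      B₁ * 2 ^ (-(r * n)) := by
    have h1 := hexp (2 * n) (r * n) (2 ^ n * 2 ^ n) (by positivity) (by
      rw [two_mul, Real.exp_add]
      gcongr <;> exact two_pow_le_exp n) (by linarith)
    calc _ = (B₁ * 2 ^ n * ε) * ((J : ℝ) + 1) := by
          rw [hB₁]
          ring
      _ ≤ (B₁ * 2 ^ n * ε) * 2 ^ n := by gcongr
      _ = B₁ * (2 ^ n * 2 ^ n * ε) := by ring
      _ ≤ _ := by
        gcongr
        exact h1.trans hrate
  have hbad : ε * (1 + ((J : ℝ) + 1) * ((k + 1) ^ d * ((1 + A) * (Λ * (2 ^ (n + 1)) ^ k) ^ d))) ≤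
      B₂ * 2 ^ (-(r * n)) := by
    have h1 := hexp (n + (n + 1) * (k * d)) (r * n) (2 ^ n * (2 ^ (n + 1)) ^ (k * d))
      (by positivity) (by
      rw [Real.exp_add]
      gcongr
      · exact two_pow_le_exp n
      · have := two_pow_le_exp ((n + 1) * (k * d))
        rw [pow_mul] at this
        exact_mod_cast this) (by linarith)
    have h2 : (1 : ℝ) ≤ 2 ^ n * (2 ^ (n + 1)) ^ (k * d) :=
      one_le_mul_of_one_le_of_one_le (one_le_pow₀ one_le_two)
        (one_le_pow₀ (one_le_pow₀ one_le_two))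
    calc _ = ε + ε * ((k + 1) ^ d * ((1 + A) * Λ ^ d)) *
            (((J : ℝ) + 1) * (2 ^ (n + 1)) ^ (k * d)) := by
          rw [mul_pow, ← pow_mul]
          ring
      _ ≤ (2 ^ n * (2 ^ (n + 1)) ^ (k * d)) * ε + ε * ((k + 1) ^ d * ((1 + A) * Λ ^ d)) *
            (2 ^ n * (2 ^ (n + 1)) ^ (k * d)) := by
          gcongr
          exact le_mul_of_one_le_left hε0 h2
      _ = B₂ * (2 ^ n * (2 ^ (n + 1)) ^ (k * d) * ε) := by
          rw [hB₂]
          ring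
      _ ≤ _ := by
        gcongr
        exact h1.trans hrate
  have hκε : ampErr (1 / 4) κ ≤ ε := by
    refine ampErr_anti (by positivity) ?_ κ
    refine (div_le_self (by norm_num) (one_le_pow₀ one_le_two)).trans (by norm_num)
  -- the tables
  choose code hcode1 hcode2 using fun (s : Fin d → Bool) (l : List (Fin d → Bool)) =>
    exists_table_code {p : List (Fin d → Bool) × (Fin d → Fin (k + 1)) × Fin m | p.1.length ≤ J}
      idx hinj (M := C * 2 ^ (d * J)) (fun p hp => hidx p hp)
      (fun p => refSign k m r A (fun y => f (gridPoint n s y)) l p.1 p.2.1 p.2.2)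
  -- Only lists of length q are ever meaningful; the default 0 keeps the table bounded where the
  -- nodes might leave the cube.
  set val : (Fin d → Bool) → List (Fin d → Bool) → (Fin d → Fin (k + 1)) → ℝ := fun s c a =>
    if c.length = q then f (gridPoint n s (cellNode c a)) else 0 with hval
  have hval1 : ∀ s c a, |val s c a| ≤ 1 := by
    intro s c a
    simp only [hval]
    split_ifs with h
    · exact abs_le_one_of_mem_holderBall hf (gridPoint_cellNode_mem s (by omega) a)
    · simp
  refine ⟨val, code, fun x hx => ?_⟩
  set w : (Fin d → Bool) → ℝ :=
    pw (fun i => netWeight n κ (gridCoord n (fun _ => false) x i)) with hw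
  set F : (Fin d → Bool) → ℝ := fun s => netPart k m r A q κ
    (fun j i => netDigit n κ (gridCoord n s x i) j) (gridCoord n s x) (val s) (code s) idx J with hF
  have hnet : netApprox k m r A q J κ val code idx x = ∑ s, w s * F s := rfl
  have hwI : ∀ i, netWeight n κ (gridCoord n (fun _ => false) x i) ∈ Icc (0 : ℝ) 1 := fun i =>
    netWeight_mem n κ (gridCoord_mem n _ hx i)
  have hw0 : ∀ s, 0 ≤ w s := fun s => pw_nonneg hwI s
  have hw1 : ∑ s, w s = 1 := sum_pw _
  have hdig : ∀ s j i, netDigit n κ (gridCoord n s x i) j ∈ Icc (0 : ℝ) 1 := fun s j i =>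
    netDigit_mem n κ (gridCoord_mem n s hx i) j
  have hfx := abs_le_one_of_mem_holderBall hf hx
  have hterm : ∀ s, w s * |f x - F s| ≤ w s * ((A + B₁) * 2 ^ (-(r * n))) + B₂ * 2 ^ (-(r * n)) := by
    intro s
    by_cases hs : ∀ i, 1 / 8 ≤ |Real.sin (2 ^ n * Real.pi * gridCoord n s x i)|
    · have hfp : ∀ j ≤ n, ∀ i,
          loc (addr (fun j i => digit (gridCoord n s x i) j) 0 j) (gridCoord n s x) i ∈
            Icc (0 : ℝ) 1 := by
        intro j hj i
        rw [loc_addr_digit (gridCoord n s x)]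
        exact fracPart_mem (gridCoord_mem n s hx i) (hs i) hj
      set β : ℕ → Fin d → Bool := fun j i => digit (gridCoord n s x i) j with hβ
      have h1 := abs_netPart_sub_refine_le (k := k) (m := m) (q := q) (κ := κ) (J := J) (j := J)
        (b := fun j i => netDigit n κ (gridCoord n s x i) j) (y := gridCoord n s x)
        (val := val s) (code := code s) (idx := idx) (β := β) (ε := ε) hd hr hA hΛ hlag
        (hdig s) hε0 hε1 (fun j hj i => abs_netDigit_sub_le (gridCoord_mem n s hx i) hj (hs i))
        hfp (hcode1 s) (hval1 s) hM hκε (g := fun y => f (gridPoint n s y))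
        (fun a => by simp only [hval, length_addr, if_true]) (fun p hp => (hidx p hp).le)
        (fun l a e hl => hcode2 s _ (l, a, e) hl) le_rfl
      have h2 := href n s f hf (addr β 0 q) (addr β q J)
        (by rw [addr_append, length_addr]) x hx (by
          rw [addr_append]
          exact hfp n le_rfl)
      rw [addr_append, length_addr] at h2
      have h3 : |f x - F s| ≤ (A + B₁) * 2 ^ (-(r * n)) := by
        refine (abs_sub_le _ _ _).trans ((add_le_add h2
          ((abs_sub_comm _ _).trans_le (h1.trans hgood))).trans_eq ?_)
        rw [refScale]
        ring
      have := mul_le_mul_of_nonneg_left h3 (hw0 s)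
      have h5 : 0 ≤ B₂ * 2 ^ (-(r * (n : ℝ))) := by positivity
      linarith
    · push Not at hs
      obtain ⟨i, hi⟩ := hs
      have hgc : gridCoord n (fun _ => false) x i + bit (s i) * gridShift n = gridCoord n s x i := by
        simp [gridCoord, bit]
      have h1 := weight_le_of_abs_sin_lt (gridCoord_mem n (fun _ => false) hx i) (s i)
        (n := n) (K := κ) (by rwa [hgc])
      have h2 : w s ≤ ε := (pw_le_factor hwI s i).trans (h1.trans hκε)
      have h3 := abs_netPart_le (m := m) (q := q) (κ := κ) (idx := idx) hr hA hΛ hlag (hdig s)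
        (gridCoord_mem n s hx) (hval1 s) (hcode1 s) (le_refl J)
      have h4 : |f x - F s| ≤
          1 + ((J : ℝ) + 1) * ((k + 1) ^ d * ((1 + A) * (Λ * (2 ^ (n + 1)) ^ k) ^ d)) :=
        (abs_sub _ _).trans (add_le_add hfx h3)
      have h5 := (mul_le_mul h2 h4 (abs_nonneg _) hε0).trans hbad
      have h6 : 0 ≤ w s * ((A + B₁) * 2 ^ (-(r * (n : ℝ)))) := by
        have := hw0 s
        positivity
      linarith
  have hsplit : f x - ∑ s, w s * F s = ∑ s, w s * (f x - F s) := by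
    simp only [mul_sub, Finset.sum_sub_distrib, ← Finset.sum_mul, hw1, one_mul]
  rw [hnet, hsplit]
  refine (Finset.abs_sum_le_sum_abs _ _).trans ?_
  calc ∑ s, |w s * (f x - F s)| ≤
        ∑ s, (w s * ((A + B₁) * 2 ^ (-(r * n))) + B₂ * 2 ^ (-(r * n))) := by
        refine Finset.sum_le_sum fun s _ => ?_
        rw [abs_mul, abs_of_nonneg (hw0 s)]
        exact hterm s
    _ = (A + B₁ + 2 ^ d * B₂) * 2 ^ (-(r * n)) := by
        rw [Finset.sum_add_distrib, ← Finset.sum_mul, hw1, Finset.sum_const, Finset.card_univ,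
          Fintype.card_fun, Fintype.card_bool, Fintype.card_fin, nsmul_eq_mul]
        push_cast
        ring

end DeepNet

end

noncomputable section

namespace DeepNet

open Set Polynomial

/-! ### Circuits for the approximant -/

variable {Θ X : Type*} {d : ℕ}

/-- The factor for the node's own index is replaced by the constant 1, so that the product runs over
all pairs and has one shape for every a. -/
theorem tlag_eq_prod {k : ℕ} (a : Fin d → Fin (k + 1)) : ∃ α β : Fin d × Fin (k + 1) → ℝ,
    ∀ ξ : Fin d → ℝ, tlag a ξ = ∏ p : Fin d × Fin (k + 1), (α p * ξ p.1 + β p) := by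
  classical
  refine ⟨fun p => if p.2 = a p.1 then 0 else (node k (a p.1) - node k p.2)⁻¹,
    fun p => if p.2 = a p.1 then 1 else (node k (a p.1) - node k p.2)⁻¹ * -node k p.2, fun ξ => ?_⟩
  rw [tlag, Fintype.prod_prod_type]
  refine Finset.prod_congr rfl fun i _ => ?_
  rw [lag, Lagrange.basis, eval_prod, ← Finset.mul_prod_erase Finset.univ _ (Finset.mem_univ (a i))]
  simp only [if_true, zero_mul, zero_add, one_mul]
  refine Finset.prod_congr rfl fun c hc => ?_
  rw [if_neg (Finset.ne_of_mem_erase hc), if_neg (Finset.ne_of_mem_erase hc), Lagrange.basisDivisor]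
  simp
  ring

theorem Comp.tlag {S : Set (Node Θ X)} {D k : ℕ} {ξ : Fin d → Θ → X → ℝ} {o : Θ → X → ℝ}
    (ho : Avail S o D) (hξ : ∀ i, Avail S (ξ i) D) (a : Fin d → Fin (k + 1)) :
    Comp S (d * (k + 1) + 1)
      {((fun θ x => DeepNet.tlag a fun i => ξ i θ x), D + (d * (k + 1) + 1))} := by
  obtain ⟨α, β, h⟩ := tlag_eq_prod a
  have h1 := Comp.prod (Finset.univ : Finset (Fin d × Fin (k + 1))) (f := fun p => ξ p.1) ho
    (fun p _ => hξ p.1) α β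
  rw [Finset.card_univ, Fintype.card_prod, Fintype.card_fin, Fintype.card_fin] at h1
  simp only [h]
  exact h1

theorem rotStart_re (m : ℕ) (y : ℝ) : (rotStart m y).re = 1 - (2 * Real.pi / 2 ^ m) ^ 2 := by
  rw [rotStart, Complex.re_ofReal_mul, Complex.add_re, Complex.one_re, Complex.re_ofReal_mul,
    Complex.I_re]
  ring

theorem rotStart_im (m : ℕ) (y : ℝ) : (rotStart m y).im =
    (1 - (2 * Real.pi / 2 ^ m) ^ 2) * (2 * Real.pi / 2 ^ m) * y := by
  rw [rotStart, Complex.im_ofReal_mul, Complex.add_im, Complex.one_im, Complex.im_ofReal_mul,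
    Complex.I_im]
  ring

theorem Comp.rot {S : Set (Node Θ X)} {D : ℕ} {y : Θ → X → ℝ} (hy : Avail S y D) (n : ℕ) :
    Comp S (6 * n + 26) {p | ∃ k ≤ n, p = ((fun θ x => (rot n (y θ x) k).re), D + (3 * n + 13)) ∨
      p = ((fun θ x => (rot n (y θ x) k).im), D + (3 * n + 13))} := by
  -- The starting value has constant real part and imaginary part linear in y; the top power 2n + 12
  -- + n gives 3n + 12 squarings.
  have h1 := Comp.const hy fun _ => 1 - (2 * Real.pi / 2 ^ (2 * n + 12)) ^ 2
  have h2 := Comp.lin hy hy (fun _ => (1 - (2 * Real.pi / 2 ^ (2 * n + 12)) ^ 2) *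
    (2 * Real.pi / 2 ^ (2 * n + 12))) (fun _ => 0) (fun _ => 0)
  have h := (h1.union h2).bind fun S₁ hS hT => Comp.iterate_sq (D := D + 1)
    (z := fun θ x => rotStart (2 * n + 12) (y θ x))
    (by
      simp only [rotStart_re]
      exact Avail.of_mem (hT (Or.inl rfl)))
    (by
      simp only [rotStart_im]
      refine Avail.of_mem (hT (Or.inr ?_))
      simp) (3 * n + 12)
  refine (h.le (by omega)).weaken ?_
  rintro _ ⟨k, hk, rfl | rfl⟩
  · exact ⟨D + 1 + (3 * n + 12), by simp only; omega, 2 * n + 12 + k, by omega, Or.inl rfl⟩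
  · exact ⟨D + 1 + (3 * n + 12), by simp only; omega, 2 * n + 12 + k, by omega, Or.inr rfl⟩

theorem Comp.netDigit {S : Set (Node Θ X)} {D : ℕ} {y : Θ → X → ℝ} (hy : Avail S y D) (n κ : ℕ) :
    Comp S (6 * n + 26 + n * (2 * κ + 1))
      {p | ∃ k < n, p = ((fun θ x => netDigit n κ (y θ x) k), D + (3 * n + 14 + 2 * κ))} := by
  have h := (Comp.rot hy n).bind fun S₁ hS hT => Comp.family (Finset.range n) (N := 2 * κ + 1)
    (T := fun k => {((fun θ x => DeepNet.netDigit n κ (y θ x) k), D + (3 * n + 14 + 2 * κ))})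
    fun k hk => by
      have h1 := Comp.iterate_amp (Avail.of_mem (hT ⟨k, (Finset.mem_range.mp hk).le, Or.inr rfl⟩)) κ
      refine (h1.bind fun S₂ hS' hT' => Comp.lin (Avail.of_mem (hT' rfl)) (Avail.of_mem (hT' rfl))
        (fun _ => -1 / 2) (fun _ => 0) (fun _ => 1 / 2)).weaken ?_
      rintro _ rfl
      refine ⟨D + (3 * n + 13) + 2 * κ + 1, by simp only; omega, ?_⟩
      rw [mem_singleton_iff, Prod.mk.injEq]
      refine ⟨?_, rfl⟩
      funext θ x
      simp only [DeepNet.netDigit]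
      ring
  rw [Finset.card_range] at h
  refine h.weaken ?_
  rintro _ ⟨k, hk, rfl⟩
  exact Avail.of_mem (mem_biUnion (Finset.mem_range.mpr hk) rfl)

theorem Comp.netLoc {S : Set (Node Θ X)} {D n : ℕ} {y : Fin d → Θ → X → ℝ}
    {b : ℕ → Fin d → Θ → X → ℝ} (hy : ∀ i, Avail S (y i) D)
    (hb : ∀ k < n, ∀ i, Avail S (b k i) D) :
    Comp S (d * n) {p | ∃ k ≤ n, ∃ i,
      p = ((fun θ x => DeepNet.netLoc (fun k i => b k i θ x) (fun i => y i θ x) k i), D + n)} := by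
  have h := Comp.chain (S := S) (D := D) (c := d) (e := 1) (M := n)
    (F := fun t i θ x => DeepNet.netLoc (fun k i => b k i θ x) (fun i => y i θ x) t i)
    (fun i => hy i) fun S' hS t ht ha => by
      have h1 := Comp.family (S := S') (Finset.univ : Finset (Fin d)) (N := 1)
        (T := fun i => {((fun θ x => DeepNet.netLoc (fun k i => b k i θ x) (fun i => y i θ x)
          (t + 1) i), D + 1 * (t + 1))}) fun i _ => by
          refine (Comp.lin (ha i) ((hb t ht i).mono hS (Nat.le_add_right _ _))
            (fun _ => 2) (fun _ => -1) (fun _ => 0)).weaken ?_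
          rintro _ rfl
          refine ⟨D + 1 * t + 1, by simp only; omega, ?_⟩
          rw [mem_singleton_iff, Prod.mk.injEq]
          refine ⟨?_, rfl⟩
          funext θ x
          simp only [DeepNet.netLoc]
          ring
      rw [Finset.card_univ, Fintype.card_fin, mul_one] at h1
      refine h1.weaken ?_
      rintro _ ⟨i, rfl⟩
      exact Avail.of_mem (mem_biUnion (Finset.mem_univ i) rfl)
  refine h.weaken ?_
  rintro _ ⟨k, hk, i, rfl⟩
  exact ⟨D + 1 * k, by simp only; omega, k, hk, i, rfl⟩

/-- Selection from a table of weights. -/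
theorem Comp.table {S : Set (Node Θ X)} {D q : ℕ} (hd : 0 < d) {b : ℕ → Fin d → Θ → X → ℝ}
    {o : Θ → X → ℝ} (ho : Avail S o D)
    (hb : ∀ k < q, ∀ v, Avail S (fun θ x => DeepNet.pw (fun i => b k i θ x) v) D)
    (w : Θ → List (Fin d → Bool) → ℝ) :
    Comp S ((2 * 2 ^ d + 2) * 2 ^ (d * q))
      {((fun θ x => DeepNet.mux (fun k i => b k i θ x) 0 q (w θ)), D + 1 + (2 ^ d + 2) * q)} := by
  classical
  have hc : (Finset.univ : Finset (Fin q → (Fin d → Bool))).card = 2 ^ (d * q) := by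
    simp [pow_mul]
  have h1 := Comp.family (S := S) (Finset.univ : Finset (Fin q → (Fin d → Bool))) (N := 1)
    (T := fun l => {((fun θ _ => w θ (List.ofFn l)), D + 1)})
    fun l _ => Comp.const ho fun θ => w θ (List.ofFn l)
  rw [hc] at h1
  refine (h1.bind fun S₁ hS hT => Comp.mux (D := D + 1) (o' := 0) hd (ho.mono hS (Nat.le_succ _)) q
    (fun k hk v => (hb k (by omega) v).mono hS (Nat.le_succ _))
    (w := fun l θ _ => w θ l) fun l hl => ?_).le (by
      rw [mul_one]
      exact le_of_eq (by ring))
  subst hl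
  refine Avail.of_mem (hT (mem_biUnion (Finset.mem_univ l.get) ?_))
  rw [List.ofFn_get]
  exact mem_singleton _

/-- The T₄-iterates form one chain, contributing 2M to the depth. The M amplifiers branch off in
parallel, so they multiply the size but only add 2κ to the depth. -/
theorem Comp.netSign {S : Set (Node Θ X)} {D q : ℕ} (hd : 0 < d) {b : ℕ → Fin d → Θ → X → ℝ}
    {o : Θ → X → ℝ} (ho : Avail S o D)
    (hb : ∀ k < q, ∀ v, Avail S (fun θ x => DeepNet.pw (fun i => b k i θ x) v) D)
    (code : Θ → List (Fin d → Bool) → ℝ) (M κ : ℕ) :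
    Comp S ((2 * 2 ^ d + 2) * 2 ^ (d * q) + 2 * M + M * (2 * κ))
      {p | ∃ t < M, p = ((fun θ x => DeepNet.netSign q κ (fun k i => b k i θ x) (code θ) t),
        D + 1 + (2 ^ d + 2) * q + 2 * M + 2 * κ)} := by
  have h := ((Comp.table hd ho hb code).bind fun S₁ hS hT =>
    Comp.iterate_quart (Avail.of_mem (hT rfl)) M).bind fun S₂ hS hT =>
    Comp.family (Finset.range M) (N := 2 * κ)
      (T := fun t => {((fun θ x => DeepNet.netSign q κ (fun k i => b k i θ x) (code θ) t),
        D + 1 + (2 ^ d + 2) * q + 2 * M + 2 * κ)})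
      fun t ht => by
        have ht' := Finset.mem_range.mp ht
        refine Comp.iterate_amp ?_ κ
        exact ⟨D + 1 + (2 ^ d + 2) * q + 2 * t, by omega, hT ⟨t, ht'.le, rfl⟩⟩
  rw [Finset.card_range] at h
  refine h.weaken ?_
  rintro _ ⟨t, ht, rfl⟩
  exact Avail.of_mem (mem_biUnion (Finset.mem_range.mpr ht) rfl)

/-- One level of corrections. -/
theorem Comp.correction {S : Set (Node Θ X)} {D q j J k m : ℕ} (hd : 0 < d)
    {b : ℕ → Fin d → Θ → X → ℝ} {o : Θ → X → ℝ} (ho : Avail S o D)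
    (hb : ∀ k < q + J, ∀ v, Avail S (fun θ x => DeepNet.pw (fun i => b k i θ x) v) D) (hj : j ≤ J)
    {w : List (Fin d → Bool) × (Fin d → Fin (k + 1)) × Fin m → Θ → X → ℝ}
    (hw : ∀ p, p.1.length = j → Avail S (w p) D) {τ : (Fin d → Fin (k + 1)) → Θ → X → ℝ}
    (hτ : ∀ a, Avail S (τ a) D) (ρ : ℝ) :
    Comp S ((k + 1) ^ d * (m * ((2 * 2 ^ d + 1) * 2 ^ (d * J)) + (m + 1) + 1) + ((k + 1) ^ d + 1))
      {((fun θ x => ∑ a, ρ * quantValue (fun e => DeepNet.mux (fun k i => b k i θ x) q j fun l =>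
        w (l, a, e) θ x) * τ a θ x), D + (2 ^ d + 2) * J + (m + 1) + 1 + ((k + 1) ^ d + 1))} := by
  classical
  have hc : (Finset.univ : Finset (Fin d → Fin (k + 1))).card = (k + 1) ^ d := by simp
  have hm : (Finset.univ : Finset (Fin m)).card = m := by simp
  set Dm := D + (2 ^ d + 2) * J with hDm
  set Q : (Fin d → Fin (k + 1)) → Fin m → Θ → X → ℝ := fun a e θ x =>
    DeepNet.mux (fun k i => b k i θ x) q j fun l => w (l, a, e) θ x with hQ
  have hterm : ∀ a, Comp S (m * ((2 * 2 ^ d + 1) * 2 ^ (d * J)) + (m + 1) + 1)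
      {((fun θ x => quantValue (fun e => Q a e θ x) * τ a θ x), Dm + (m + 1) + 1)} := by
    intro a
    have h1 := Comp.family (S := S) (Finset.univ : Finset (Fin m))
      (N := (2 * 2 ^ d + 1) * 2 ^ (d * J)) (T := fun e => {(Q a e, Dm)}) fun e _ => by
        refine ((Comp.mux (D := D) (o' := q) hd ho j (fun k hk v => hb k (by omega) v)
          (w := fun l => w (l, a, e)) fun l hl => hw _ hl).le ?_).weaken ?_
        · exact Nat.mul_le_mul_left _ (Nat.pow_le_pow_right two_pos (Nat.mul_le_mul_left d hj))
        · rintro _ rfl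
          exact ⟨D + (2 ^ d + 2) * j, Nat.add_le_add_left (Nat.mul_le_mul_left _ hj) _, rfl⟩
    rw [hm] at h1
    have h2 := h1.bind fun S₁ hS hT => Comp.sum (Finset.univ : Finset (Fin m)) (f := fun e => Q a e)
      (D := Dm) (ho.mono hS (Nat.le_add_right _ _))
      (fun e _ => Avail.of_mem (hT (mem_biUnion (Finset.mem_univ e) rfl)))
      (fun e _ => (1 / 2) ^ ((e : ℕ) + 1))
    rw [hm] at h2
    have h3 := (h2.trans (U := {((fun θ x => quantValue (fun e => Q a e θ x) * τ a θ x),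
      Dm + (m + 1) + 1)}) (M := 1) (Comp.mul (D := Dm + (m + 1)) (Avail.of_mem (Or.inr rfl))
        ((hτ a).mono subset_union_left (by omega))))
    exact h3.weaken fun t ht => Avail.of_mem (Or.inr ht)
  have h4 := Comp.family (S := S) (Finset.univ : Finset (Fin d → Fin (k + 1))) fun a _ => hterm a
  rw [hc] at h4
  have h5 := h4.bind fun S₁ hS hT => Comp.sum (Finset.univ : Finset (Fin d → Fin (k + 1)))
    (f := fun a θ x => quantValue (fun e => Q a e θ x) * τ a θ x) (D := Dm + (m + 1) + 1)
    (ho.mono hS (by omega))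
    (fun a _ => Avail.of_mem (hT (mem_biUnion (Finset.mem_univ a) rfl))) (fun _ _ => ρ)
  rw [hc] at h5
  refine h5.weaken ?_
  rintro _ rfl
  refine Avail.of_mem ?_
  simp only [← mul_assoc]
  rfl

end DeepNet

end

/-! ### Circuits for the local approximants and the gluing weights -/

noncomputable section

namespace DeepNet

open Set

variable {Θ X : Type*} {d : ℕ}

theorem Comp.netPart {S : Set (Node Θ X)} {D q J k m M κ : ℕ} (hd : 0 < d) {r A : ℝ}
    {b : ℕ → Fin d → Θ → X → ℝ} {y : Fin d → Θ → X → ℝ} {o : Θ → X → ℝ} (ho : Avail S o D)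
    (hb : ∀ k < q + J, ∀ v, Avail S (fun θ x => DeepNet.pw (fun i => b k i θ x) v) D)
    (hξ : ∀ k ≤ q + J, ∀ i, Avail S (fun θ x => DeepNet.netLoc (fun k i => b k i θ x)
      (fun i => y i θ x) k i) D)
    (val : Θ → List (Fin d → Bool) → (Fin d → Fin (k + 1)) → ℝ)
    (code : Θ → List (Fin d → Bool) → ℝ)
    {idx : List (Fin d → Bool) × (Fin d → Fin (k + 1)) × Fin m → ℕ}
    (hidx : ∀ p, p.1.length ≤ J → idx p < M) :
    Comp S (((q + J + 1) * ((k + 1) ^ d * (d * (k + 1) + 1)) +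
        ((2 * 2 ^ d + 2) * 2 ^ (d * q) + 2 * M + M * (2 * κ)) +
        (k + 1) ^ d * ((2 * 2 ^ d + 2) * 2 ^ (d * q))) + (((k + 1) ^ d * 1 + ((k + 1) ^ d + 1)) +
        J * ((k + 1) ^ d * (m * ((2 * 2 ^ d + 1) * 2 ^ (d * J)) + (m + 1) + 1) +
          ((k + 1) ^ d + 1)) + 1 * J))
      {((fun θ x => DeepNet.netPart k m r A q κ (fun k i => b k i θ x) (fun i => y i θ x) (val θ)
        (code θ) idx J),
        D + (d * (k + 1) + 1) + (2 ^ d + 2) * q + 2 * M + 2 * κ + 1 + (2 ^ d + 2) * J + (m + 1) + 1 +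
          ((k + 1) ^ d + 1) + 1 * J)} := by
  classical
  have hc : (Finset.univ : Finset (Fin d → Fin (k + 1))).card = (k + 1) ^ d := by simp
  set D₁ := D + (d * (k + 1) + 1) + (2 ^ d + 2) * q + 2 * M + 2 * κ + 1 with hD₁
  set τ : ℕ → (Fin d → Fin (k + 1)) → Θ → X → ℝ := fun j a θ x =>
    DeepNet.tlag a (DeepNet.netLoc (fun k i => b k i θ x) (fun i => y i θ x) j) with hτ
  set V : (Fin d → Fin (k + 1)) → Θ → X → ℝ := fun a θ x =>
    DeepNet.mux (fun k i => b k i θ x) 0 q fun c => val θ c a with hV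
  set sg : ℕ → Θ → X → ℝ := fun t θ x =>
    DeepNet.netSign q κ (fun k i => b k i θ x) (code θ) t with hsg
  have h1 : Comp S ((q + J + 1) * ((k + 1) ^ d * (d * (k + 1) + 1)))
      (⋃ j ∈ Finset.range (q + J + 1), ⋃ a ∈ (Finset.univ : Finset (Fin d → Fin (k + 1))),
        {(τ j a, D + (d * (k + 1) + 1))}) := by
    have := Comp.family (S := S) (Finset.range (q + J + 1)) fun j hj =>
      Comp.family (S := S) (Finset.univ : Finset (Fin d → Fin (k + 1)))
        (T := fun a => {(τ j a, D + (d * (k + 1) + 1))}) fun a _ =>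
          Comp.tlag ho (hξ j (by have := Finset.mem_range.mp hj; omega)) a
    rwa [Finset.card_range, hc] at this
  have h2 := Comp.netSign (q := q) hd ho (fun k hk v => hb k (by omega) v) code M κ
  have h3 := Comp.family (S := S) (Finset.univ : Finset (Fin d → Fin (k + 1)))
    (T := fun a => {(V a, D + 1 + (2 ^ d + 2) * q)}) fun a _ =>
      Comp.table (q := q) hd ho (fun k hk v => hb k (by omega) v) fun θ c => val θ c a
  rw [hc] at h3
  refine ((h1.union h2).union h3).bind fun S₁ hS hT => ?_
  have hτ₁ : ∀ j ≤ q + J, ∀ a, Avail S₁ (τ j a) D₁ := fun j hj a =>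
    ⟨D + (d * (k + 1) + 1), by omega, hT (Or.inl (Or.inl (mem_biUnion
      (Finset.mem_range.mpr (by omega)) (mem_biUnion (Finset.mem_univ a) rfl))))⟩
  have hsg₁ : ∀ t < M, Avail S₁ (sg t) D₁ := fun t ht =>
    ⟨D + 1 + (2 ^ d + 2) * q + 2 * M + 2 * κ, by omega, hT (Or.inl (Or.inr ⟨t, ht, rfl⟩))⟩
  have hV₁ : ∀ a, Avail S₁ (V a) D₁ := fun a =>
    ⟨D + 1 + (2 ^ d + 2) * q, by omega, hT (Or.inr (mem_biUnion (Finset.mem_univ a) rfl))⟩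
  have ho₁ : Avail S₁ o D₁ := ho.mono hS (by omega)
  have hb₁ : ∀ k < q + J, ∀ v, Avail S₁ (fun θ x => DeepNet.pw (fun i => b k i θ x) v) D₁ :=
    fun k hk v => (hb k hk v).mono hS (by omega)
  set D₂ := D₁ + (2 ^ d + 2) * J + (m + 1) + 1 + ((k + 1) ^ d + 1) with hD₂
  have h4 : Comp S₁ ((k + 1) ^ d * 1 + ((k + 1) ^ d + 1))
      {((fun θ x => ∑ a, V a θ x * τ q a θ x), D₂)} := by
    have h := (Comp.family (S := S₁) (Finset.univ : Finset (Fin d → Fin (k + 1)))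
      (T := fun a => {((fun θ x => V a θ x * τ q a θ x), D₁ + 1)}) fun a _ =>
        Comp.mul (hV₁ a) (hτ₁ q (by omega) a)).bind fun S₂ hS hT =>
      Comp.sum (Finset.univ : Finset (Fin d → Fin (k + 1)))
        (f := fun a θ x => V a θ x * τ q a θ x) (D := D₁ + 1) (ho₁.mono hS (by omega))
        (fun a _ => Avail.of_mem (hT (mem_biUnion (Finset.mem_univ a) rfl))) (fun _ _ => 1)
    rw [hc] at h
    refine h.weaken ?_
    rintro _ rfl
    refine ⟨D₁ + 1 + ((k + 1) ^ d + 1), by simp only; omega, ?_⟩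
    simp only [one_mul]
    rfl
  set cor : ℕ → Θ → X → ℝ := fun j θ x => ∑ a, refScale r A (q + j) *
    quantValue (fun e => DeepNet.mux (fun k i => b k i θ x) q (j + 1) fun l =>
      sg (idx (l, a, e)) θ x) * τ (q + (j + 1)) a θ x with hcor
  have h5 := Comp.family (S := S₁) (Finset.range J) (T := fun j => {(cor j, D₂)}) fun j hj => by
    have hj' := Finset.mem_range.mp hj
    exact Comp.correction hd ho₁ hb₁ (by omega : j + 1 ≤ J) (w := fun p => sg (idx p))
      (fun p hp => hsg₁ _ (hidx p (by omega))) (hτ₁ (q + (j + 1)) (by omega))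
      (refScale r A (q + j))
  rw [Finset.card_range] at h5
  refine (h4.union h5).bind fun S₂ hS hT => ?_
  have h6 := Comp.chain (ι := Unit) (S := S₂) (F := fun t _ θ x => DeepNet.netPart k m r A q κ
      (fun k i => b k i θ x) (fun i => y i θ x) (val θ) (code θ) idx t) (D := D₂) (c := 1) (e := 1)
      (M := J) (fun _ => Avail.of_mem (hT (Or.inl rfl))) fun S₃ hS' t ht ha => by
    have hc : Avail S₃ (cor t) (D₂ + 1 * t) := ⟨D₂, Nat.le_add_right _ _,
      hS' (hT (Or.inr (mem_biUnion (Finset.mem_range.mpr ht) rfl)))⟩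
    refine (Comp.lin (ha ()) hc (fun _ => 1) (fun _ => 1) (fun _ => 0)).weaken ?_
    rintro _ ⟨_, rfl⟩
    refine ⟨D₂ + 1 * t + 1, by simp only; omega, ?_⟩
    rw [mem_singleton_iff, Prod.mk.injEq]
    refine ⟨?_, rfl⟩
    funext θ x
    simp only [one_mul, add_zero]
    rfl
  refine h6.weaken ?_
  rintro _ rfl
  exact Avail.of_mem ⟨J, le_rfl, (), rfl⟩

/-- The local approximant, from the coordinates. -/
theorem Comp.netPart_of_coord {S : Set (Node Θ X)} {D q J k m M κ : ℕ} (hd : 0 < d) {r A : ℝ}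
    {y : Fin d → Θ → X → ℝ} (hy : ∀ i, Avail S (y i) D)
    (val : Θ → List (Fin d → Bool) → (Fin d → Fin (k + 1)) → ℝ)
    (code : Θ → List (Fin d → Bool) → ℝ)
    {idx : List (Fin d → Bool) × (Fin d → Fin (k + 1)) × Fin m → ℕ}
    (hidx : ∀ p, p.1.length ≤ J → idx p < M) :
    Comp S (d * (6 * (q + J) + 26 + (q + J) * (2 * κ + 1)) +
        (((q + J) * (2 ^ d * (d + 1)) + d * (q + J)) +
      (((q + J + 1) * ((k + 1) ^ d * (d * (k + 1) + 1)) +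
        ((2 * 2 ^ d + 2) * 2 ^ (d * q) + 2 * M + M * (2 * κ)) +
        (k + 1) ^ d * ((2 * 2 ^ d + 2) * 2 ^ (d * q))) + (((k + 1) ^ d * 1 + ((k + 1) ^ d + 1)) +
        J * ((k + 1) ^ d * (m * ((2 * 2 ^ d + 1) * 2 ^ (d * J)) + (m + 1) + 1) +
          ((k + 1) ^ d + 1)) + 1 * J))))
      {((fun θ x => DeepNet.netPart k m r A q κ (fun j i => DeepNet.netDigit (q + J) κ (y i θ x) j)
        (fun i => y i θ x) (val θ) (code θ) idx J),
        D + (3 * (q + J) + 14 + 2 * κ) + (d + 1) + (q + J) +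
        (d * (k + 1) + 1) + (2 ^ d + 2) * q + 2 * M + 2 * κ + 1 + (2 ^ d + 2) * J + (m + 1) + 1 +
          ((k + 1) ^ d + 1) + 1 * J)} := by
  classical
  set n := q + J with hn
  set D₁ := D + (3 * n + 14 + 2 * κ) with hD₁
  have h1 := Comp.family (S := S) (Finset.univ : Finset (Fin d)) fun i _ =>
    Comp.netDigit (hy i) n κ
  rw [Finset.card_univ, Fintype.card_fin] at h1
  refine h1.bind fun S₁ hS hT => ?_
  have hb : ∀ j < n, ∀ i, Avail S₁ (fun θ x => DeepNet.netDigit n κ (y i θ x) j) D₁ :=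
    fun j hj i => Avail.of_mem (hT (mem_biUnion (Finset.mem_univ i) ⟨j, hj, rfl⟩))
  have hy₁ : ∀ i, Avail S₁ (y i) D₁ := fun i => (hy i).mono hS (by omega)
  have h2 := Comp.family (S := S₁) (Finset.range n) fun j hj =>
    Comp.pw (d := d) (b := fun i θ x => DeepNet.netDigit n κ (y i θ x) j) (hy₁ ⟨0, hd⟩)
      fun i => hb j (Finset.mem_range.mp hj) i
  rw [Finset.card_range] at h2
  have h3 := Comp.netLoc (b := fun j i θ x => DeepNet.netDigit n κ (y i θ x) j) hy₁ hb
  refine (h2.union h3).bind fun S₂ hS₂ hT₂ => ?_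
  refine Comp.netPart (D := D₁ + (d + 1) + n) (b := fun j i θ x =>
    DeepNet.netDigit n κ (y i θ x) j) hd ((hy₁ ⟨0, hd⟩).mono hS₂ (by omega)) ?_ ?_ val code hidx
  · intro j hj v
    exact ⟨D₁ + (d + 1), by omega, hT₂ (Or.inl (mem_biUnion (Finset.mem_range.mpr hj) ⟨v, rfl⟩))⟩
  · intro j hj i
    exact ⟨D₁ + n, by omega, hT₂ (Or.inr ⟨j, hj, i, rfl⟩)⟩

theorem Comp.netWeight {S : Set (Node Θ X)} {D : ℕ} (hd : 0 < d) {y : Fin d → Θ → X → ℝ}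
    (hy : ∀ i, Avail S (y i) D) (n κ : ℕ) :
    Comp S (d * (6 * n + 26 + (1 + (2 * κ + 1))) + 2 ^ d * (d + 1))
      (range fun v : Fin d → Bool => ((fun θ x => DeepNet.pw (fun i =>
        DeepNet.netWeight n κ (y i θ x)) v), D + (3 * n + 15 + 2 * κ) + (d + 1))) := by
  have h1 := Comp.family (S := S) (Finset.univ : Finset (Fin d))
    (N := 6 * n + 26 + (1 + (2 * κ + 1)))
    (T := fun i => {((fun θ x => DeepNet.netWeight n κ (y i θ x)), D + (3 * n + 15 + 2 * κ))})
    fun i _ => (Comp.rot (hy i) n).bind fun S₁ hS hT =>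
      (Comp.lin (Avail.of_mem (hT ⟨n, le_rfl, Or.inl rfl⟩))
        (Avail.of_mem (hT ⟨n, le_rfl, Or.inr rfl⟩)) (fun _ => 1 / 2) (fun _ => 1 / 2)
        (fun _ => 0)).bind fun S₂ hS₂ hT₂ =>
      (Comp.iterate_amp (Avail.of_mem (hT₂ rfl)) κ).bind fun S₃ hS₃ hT₃ => by
        refine (Comp.lin (Avail.of_mem (hT₃ rfl)) (Avail.of_mem (hT₃ rfl))
          (fun _ => 1 / 2) (fun _ => 0) (fun _ => 1 / 2)).weaken ?_
        rintro _ rfl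
        refine ⟨D + (3 * n + 13) + 1 + 2 * κ + 1, by simp only; omega, ?_⟩
        rw [mem_singleton_iff, Prod.mk.injEq]
        refine ⟨?_, rfl⟩
        funext θ x
        simp only [DeepNet.netWeight]
        have e : 1 / 2 * (DeepNet.rot n (y i θ x) n).re + 1 / 2 * (DeepNet.rot n (y i θ x) n).im + 0 =
          ((DeepNet.rot n (y i θ x) n).re + (DeepNet.rot n (y i θ x) n).im) / 2 := by ring
        rw [e]
        ring
  rw [Finset.card_univ, Fintype.card_fin] at h1
  exact h1.bind fun S₁ hS hT => Comp.pw ((hy ⟨0, hd⟩).mono hS (by omega)) fun i =>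
    Avail.of_mem (hT (mem_biUnion (Finset.mem_univ i) rfl))

/-! ### The size of the circuit -/

/-- Domination up to a constant factor. -/
def Dominated (U f : ℕ → ℕ → ℕ) : Prop := ∃ E, ∀ q J, f q J ≤ E * U q J

theorem Dominated.add {U f g : ℕ → ℕ → ℕ} (hf : Dominated U f) (hg : Dominated U g) :
    Dominated U fun q J => f q J + g q J := by
  obtain ⟨E, hE⟩ := hf
  obtain ⟨E', hE'⟩ := hg
  exact ⟨E + E', fun q J => by
    rw [add_mul]
    exact Nat.add_le_add (hE q J) (hE' q J)⟩

theorem Dominated.const_mul {U f : ℕ → ℕ → ℕ} (hf : Dominated U f) (c : ℕ) :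
    Dominated U fun q J => c * f q J := by
  obtain ⟨E, hE⟩ := hf
  exact ⟨c * E, fun q J => by
    rw [mul_assoc]
    exact Nat.mul_le_mul_left c (hE q J)⟩

theorem Dominated.mono {U f g : ℕ → ℕ → ℕ} (hf : Dominated U f) (h : ∀ q J, g q J ≤ f q J) :
    Dominated U g := by
  obtain ⟨E, hE⟩ := hf
  exact ⟨E, fun q J => (h q J).trans (hE q J)⟩

theorem Dominated.const {U : ℕ → ℕ → ℕ} (hU : ∀ q J, 1 ≤ U q J) (c : ℕ) :
    Dominated U fun _ _ => c :=
  ⟨c, fun q J => Nat.le_mul_of_pos_right c (hU q J)⟩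

end DeepNet

end

/-! ### Gate count and depth of the whole circuit -/

noncomputable section

namespace DeepNet

open Set

variable {Θ : Type*} {d : ℕ}

theorem Comp.gridCoord (n : ℕ) (s : Fin d → Bool) (i : Fin d) :
    Comp (inputs Θ d) 1 {((fun _ x => DeepNet.gridCoord n s x i), 1)} := by
  have hx : Avail (inputs Θ d) (fun _ x => x i) 0 := Avail.of_mem ⟨i, rfl⟩
  refine (Comp.lin hx hx (fun _ => 1 - gridShift n) (fun _ => 0)
    (fun _ => bit (s i) * gridShift n)).weaken ?_
  rintro _ rfl
  refine Avail.of_mem ?_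
  rw [mem_singleton_iff, Prod.mk.injEq]
  refine ⟨?_, rfl⟩
  funext θ x
  simp only [DeepNet.gridCoord]
  ring

/-- The number of iterations of the amplifier. -/
def iterations (d H q J : ℕ) : ℕ := 2 * (q + J) + 8 + d * (q + J) + H

/-- The number of gates. -/
def circuitSize (d k m C H c t q J : ℕ) : ℕ :=
    t * (d * 1 + (d * (6 * (q + J) + 26 + (q + J) * (2 * iterations d H q J + 1)) +
        (((q + J) * (t * (d + 1)) + d * (q + J)) +
      (((q + J + 1) * (c * (d * (k + 1) + 1)) +
        ((2 * t + 2) * 2 ^ (d * q) + 2 * (C * 2 ^ (d * J)) + (C * 2 ^ (d * J)) * (2 * iterations d H q J)) +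
        c * ((2 * t + 2) * 2 ^ (d * q))) + ((c * 1 + (c + 1)) +
        J * (c * (m * ((2 * t + 1) * 2 ^ (d * J)) + (m + 1) + 1) + (c + 1)) + 1 * J))))) +
    (d * 1 + (d * (6 * (q + J) + 26 + (1 + (2 * iterations d H q J + 1))) + t * (d + 1))) +
    (t * 1 + (t + 1))

/-- The depth of the products that are summed up in the end. -/
def circuitDepth (d k m C H c t q J : ℕ) : ℕ :=
    1 + (3 * (q + J) + 15 + 2 * iterations d H q J) + (d + 1) + (q + J) +
        (d * (k + 1) + 1) + (t + 2) * q + 2 * (C * 2 ^ (d * J)) + 2 * iterations d H q J + 1 + (t + 2) * J +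
          (m + 1) + 1 + (c + 1) + 1 * J

/-- Tables give 2^(dq); decoding and corrections give 2^(dJ) times at most linear factors in q + J;
digits with their amplifiers give the quadratic term. -/
theorem dominated_circuitSize (d k m C H c t : ℕ) :
    Dominated (fun q J => 2 ^ (d * q) + 2 ^ (d * J) * (q + J + 1) ^ 2)
      (circuitSize d k m C H c t) := by
  set U : ℕ → ℕ → ℕ := fun q J => 2 ^ (d * q) + 2 ^ (d * J) * (q + J + 1) ^ 2
  have hR1 : ∀ J, 1 ≤ 2 ^ (d * J) := fun J => Nat.one_le_two_pow
  have hle : ∀ q J, (q + J + 1) ^ 2 ≤ U q J := fun q J =>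
    (Nat.le_mul_of_pos_left _ (hR1 J)).trans (Nat.le_add_left _ _)
  have hU1 : ∀ q J, 1 ≤ U q J := fun q J => (Nat.one_le_pow _ _ (by omega)).trans (hle q J)
  have h1 : ∀ c, Dominated U fun _ _ => c := Dominated.const hU1
  have hsq : Dominated U fun q J => (q + J + 1) ^ 2 := ⟨1, fun q J => by simpa using hle q J⟩
  have hn : Dominated U fun q J => q + J := hsq.mono fun q J => by nlinarith
  have hJ : Dominated U fun _ J => J := hn.mono fun q J => Nat.le_add_left _ _
  have hκ' : Dominated U (iterations d H) := ((hn.const_mul (2 + d)).add (h1 (8 + H))).mono fun q J => by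
    simp only [iterations]
    exact le_of_eq (by ring)
  have hnn : Dominated U fun q J => (q + J) * (q + J) := hsq.mono fun q J => by nlinarith
  have hnκ : Dominated U fun q J => (q + J) * iterations d H q J :=
    ((hnn.const_mul (2 + d)).add (hn.const_mul (8 + H))).mono fun q J => by
      simp only [iterations]
      exact le_of_eq (by ring)
  have hP : Dominated U fun q _ => 2 ^ (d * q) :=
    ⟨1, fun q J => by
      rw [one_mul]
      exact Nat.le_add_right _ _⟩
  have hRsq : Dominated U fun q J => 2 ^ (d * J) * (q + J + 1) ^ 2 :=
    ⟨1, fun q J => by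
      rw [one_mul]
      exact Nat.le_add_left _ _⟩
  have hR : Dominated U fun _ J => 2 ^ (d * J) := hRsq.mono fun q J =>
    Nat.le_mul_of_pos_right _ (by positivity)
  have hRn : Dominated U fun q J => 2 ^ (d * J) * (q + J) := hRsq.mono fun q J =>
    Nat.mul_le_mul_left _ (by nlinarith)
  have hRJ : Dominated U fun q J => 2 ^ (d * J) * J := hRn.mono fun q J =>
    Nat.mul_le_mul_left _ (by omega)
  have hRκ : Dominated U fun q J => 2 ^ (d * J) * iterations d H q J :=
    ((hRn.const_mul (2 + d)).add (hR.const_mul (8 + H))).mono fun q J => by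
      simp only [iterations]
      exact le_of_eq (by ring)
  have e1 : Dominated U fun q J => d * (6 * (q + J) + 26 + (q + J) * (2 * iterations d H q J + 1)) :=
    Dominated.const_mul (((hn.const_mul 7).add ((h1 26).add (hnκ.const_mul 2))).mono fun q J =>
      le_of_eq (by ring)) d
  have e2 : Dominated U fun q J => (q + J) * (t * (d + 1)) + d * (q + J) :=
    (hn.const_mul (t * (d + 1) + d)).mono fun q J => le_of_eq (by ring)
  have e3 : Dominated U fun q J => (q + J + 1) * (c * (d * (k + 1) + 1)) :=
    ((hn.add (h1 1)).const_mul (c * (d * (k + 1) + 1))).mono fun q J => le_of_eq (by ring)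
  have e4 : Dominated U fun q J =>
      (2 * t + 2) * 2 ^ (d * q) + 2 * (C * 2 ^ (d * J)) + (C * 2 ^ (d * J)) * (2 * iterations d H q J) :=
    (((hP.const_mul (2 * t + 2)).add (hR.const_mul (2 * C))).add
      (hRκ.const_mul (2 * C))).mono fun q J => le_of_eq (by ring)
  have e5 : Dominated U fun q _ => c * ((2 * t + 2) * 2 ^ (d * q)) :=
    (hP.const_mul _).const_mul _
  have e6 : Dominated U fun _ J =>
      J * (c * (m * ((2 * t + 1) * 2 ^ (d * J)) + (m + 1) + 1) + (c + 1)) + 1 * J :=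
    ((hRJ.const_mul (c * m * (2 * t + 1))).add (hJ.const_mul (c * (m + 2) + (c + 1) + 1))).mono
      fun q J => le_of_eq (by ring)
  have e7 : Dominated U fun q J => d * (6 * (q + J) + 26 + (1 + (2 * iterations d H q J + 1))) :=
    Dominated.const_mul (((hn.const_mul 6).add ((h1 28).add (hκ'.const_mul 2))).mono fun q J =>
      le_of_eq (by ring)) d
  have e8 : Dominated U fun q J =>
      t * (d * 1 + (d * (6 * (q + J) + 26 + (q + J) * (2 * iterations d H q J + 1)) +
      (((q + J) * (t * (d + 1)) + d * (q + J)) +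
    (((q + J + 1) * (c * (d * (k + 1) + 1)) +
      ((2 * t + 2) * 2 ^ (d * q) + 2 * (C * 2 ^ (d * J)) + (C * 2 ^ (d * J)) * (2 * iterations d H q J)) +
      c * ((2 * t + 2) * 2 ^ (d * q))) + ((c * 1 + (c + 1)) +
      J * (c * (m * ((2 * t + 1) * 2 ^ (d * J)) + (m + 1) + 1) + (c + 1)) + 1 * J))))) :=
    Dominated.const_mul ((h1 (d * 1)).add (e1.add (e2.add (((e3.add e4).add e5).add
      (((h1 (c * 1 + (c + 1))).add e6).mono fun q J => le_of_eq (by ring)))))) t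
  exact (e8.add ((h1 (d * 1)).add (e7.add (h1 _)))).add (h1 _)

theorem dominated_circuitDepth (d k m C H c t : ℕ) :
    Dominated (fun q J => 2 ^ (d * J) + (q + J) + 1) (circuitDepth d k m C H c t) := by
  set V : ℕ → ℕ → ℕ := fun q J => 2 ^ (d * J) + (q + J) + 1 with hV
  have hV1 : ∀ q J, 1 ≤ V q J := fun q J => Nat.le_add_left _ _
  have h1 : ∀ c, Dominated V fun _ _ => c := Dominated.const hV1
  have hn : Dominated V fun q J => q + J := ⟨1, fun q J => by
    simp only [hV]
    generalize 2 ^ (d * J) = R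
    omega⟩
  have hq : Dominated V fun q _ => q := hn.mono fun q J => Nat.le_add_right _ _
  have hJ : Dominated V fun _ J => J := hn.mono fun q J => Nat.le_add_left _ _
  have hR : Dominated V fun _ J => 2 ^ (d * J) := ⟨1, fun q J => by
    simp only [hV]
    generalize 2 ^ (d * J) = R
    omega⟩
  have hκ' : Dominated V (iterations d H) := ((hn.const_mul (2 + d)).add (h1 (8 + H))).mono fun q J => by
    simp only [iterations]
    exact le_of_eq (by ring)
  refine ((hn.const_mul 4).add ((hκ'.const_mul 4).add ((hR.const_mul (2 * C)).add
    ((hq.const_mul (t + 2)).add ((hJ.const_mul (t + 3)).add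
      (h1 (16 + (d + 1) + (d * (k + 1) + 1) + 1 + (m + 1) + 1 + (c + 1)))))))).mono fun q J => ?_
  simp only [circuitDepth]
  exact le_of_eq (by ring)

/-- E is fixed before q and J, and Θ is arbitrary: the tables enter only through coefficients of
constant gates, so one circuit serves all functions. -/
theorem exists_comp_netApprox (hd : 0 < d) (k m C H : ℕ) : ∃ E : ℕ, ∀ (r A : ℝ) (q J : ℕ)
    (idx : List (Fin d → Bool) × (Fin d → Fin (k + 1)) × Fin m → ℕ),
    (∀ p, p.1.length ≤ J → idx p < C * 2 ^ (d * J)) → ∀ (Θ : Type)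
    (val : Θ → (Fin d → Bool) → List (Fin d → Bool) → (Fin d → Fin (k + 1)) → ℝ)
    (code : Θ → (Fin d → Bool) → List (Fin d → Bool) → ℝ),
    Comp (inputs Θ d) (E * (2 ^ (d * q) + 2 ^ (d * J) * (q + J + 1) ^ 2))
      {((fun θ x => netApprox k m r A q J (iterations d H q J) (val θ) (code θ) idx x),
        E * (2 ^ (d * J) + (q + J) + 1))} := by
  classical
  set c := (k + 1) ^ d
  set t := 2 ^ d
  obtain ⟨E₁, hE₁⟩ := dominated_circuitSize d k m C H c t
  obtain ⟨E₂, hE₂⟩ := ((dominated_circuitDepth d k m C H c t).add (Dominated.const (fun q J => Nat.le_add_left _ _) (t + 2)))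
  refine ⟨max E₁ E₂, fun r A q J idx hidx Θ val code => ?_⟩
  have hsize : circuitSize d k m C H c t q J ≤ max E₁ E₂ * (2 ^ (d * q) + 2 ^ (d * J) * (q + J + 1) ^ 2) :=
    (hE₁ q J).trans (Nat.mul_le_mul_right _ (le_max_left _ _))
  have hdepth : circuitDepth d k m C H c t q J + (t + 2) ≤ max E₁ E₂ * (2 ^ (d * J) + (q + J) + 1) :=
    (hE₂ q J).trans (Nat.mul_le_mul_right _ (le_max_right _ _))
  have ht : (Finset.univ : Finset (Fin d → Bool)).card = t := by simp [t]
  have hcoord : ∀ s : Fin d → Bool, Comp (inputs Θ d) (d * 1)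
      (⋃ i ∈ (Finset.univ : Finset (Fin d)),
        {((fun _ x => DeepNet.gridCoord (q + J) s x i), 1)}) := fun s => by
    have := Comp.family (S := inputs Θ d) (Finset.univ : Finset (Fin d)) fun i _ =>
      Comp.gridCoord (q + J) s i
    rwa [Finset.card_univ, Fintype.card_fin] at this
  set F : (Fin d → Bool) → Θ → EuclideanSpace ℝ (Fin d) → ℝ := fun s θ x =>
    netPart k m r A q (iterations d H q J) (fun j i => netDigit (q + J) (iterations d H q J) (DeepNet.gridCoord (q + J) s x i) j)
      (DeepNet.gridCoord (q + J) s x) (val θ s) (code θ s) idx J with hF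
  set w : (Fin d → Bool) → Θ → EuclideanSpace ℝ (Fin d) → ℝ := fun s _ x =>
    pw (fun i => netWeight (q + J) (iterations d H q J) (DeepNet.gridCoord (q + J) (fun _ => false) x i)) s
  have hpart := Comp.family (S := inputs Θ d) (Finset.univ : Finset (Fin d → Bool))
    (T := fun s => {(F s, circuitDepth d k m C H c t q J)}) fun s _ => by
      refine ((hcoord s).bind fun S₁ hS hT => Comp.netPart_of_coord (D := 1) (q := q) (r := r) (A := A)
        (κ := iterations d H q J) hd
        (y := fun i _ x => DeepNet.gridCoord (q + J) s x i)
        (fun i => Avail.of_mem (hT (mem_biUnion (Finset.mem_univ i) rfl)))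
        (fun θ => val θ s) (fun θ => code θ s) hidx).weaken ?_
      rintro _ rfl
      refine Avail.mono subset_rfl (Avail.of_mem rfl) ?_
      simp only [circuitDepth, c, t]
      omega
  rw [ht] at hpart
  have hweight := (hcoord fun _ => false).bind fun S₁ hS hT => Comp.netWeight (D := 1) hd
    (y := fun i _ x => DeepNet.gridCoord (q + J) (fun _ => false) x i)
    (fun i => Avail.of_mem (hT (mem_biUnion (Finset.mem_univ i) rfl))) (q + J) (iterations d H q J)
  have hall := (hpart.union hweight).bind fun S₁ hS hT => by
    have ho : Avail S₁ (fun _ x => x ⟨0, hd⟩) (circuitDepth d k m C H c t q J + 1) :=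
      ⟨0, Nat.zero_le _, hS ⟨⟨0, hd⟩, rfl⟩⟩
    have h := (Comp.family (S := S₁) (Finset.univ : Finset (Fin d → Bool))
      (T := fun s => {((fun θ x => w s θ x * F s θ x), circuitDepth d k m C H c t q J + 1)}) fun s _ =>
        Comp.mul (D := circuitDepth d k m C H c t q J) (u := w s) (v := F s)
          ⟨1 + (3 * (q + J) + 15 + 2 * iterations d H q J) + (d + 1), by simp only [circuitDepth]; omega,
            hT (Or.inr ⟨s, rfl⟩)⟩
          (Avail.of_mem (hT (Or.inl (mem_biUnion (Finset.mem_univ s) rfl))))).bind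
      fun S₂ hS₂ hT₂ => Comp.sum (Finset.univ : Finset (Fin d → Bool))
        (f := fun s θ x => w s θ x * F s θ x) (ho.mono hS₂ le_rfl)
        (fun s _ => Avail.of_mem (hT₂ (mem_biUnion (Finset.mem_univ s) rfl))) (fun _ _ => 1)
    rw [ht] at h
    exact h
  refine (hall.le hsize).weaken ?_
  rintro _ rfl
  refine ⟨circuitDepth d k m C H c t q J + 1 + (t + 1), by
    simp only at hdepth ⊢
    omega, ?_⟩
  rw [mem_singleton_iff, Prod.mk.injEq]
  refine ⟨?_, rfl⟩
  funext θ x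
  simp only [one_mul]
  rfl

end DeepNet

end

/-! ### Choice of the levels and the final assembly -/

noncomputable section

namespace DeepNet

open Set Filter Asymptotics

/-- The parameter space is the Hölder ball itself: choosing tables and codes for each f turns them
into coefficient functions of a single circuit. The additional ε pays for replacing gates by second
differences. -/
theorem exists_network {d : ℕ} (hd : 0 < d) {r : ℝ} (hr : 0 < r) : ∃ B : ℝ, ∃ E : ℕ, 0 < B ∧ 0 < E ∧
    ∀ σ : ℝ → ℝ, (∃ x₀ s : ℝ, s ≠ 0 ∧ HasSecondDerivAt σ s x₀) → ∀ q J W : ℕ,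
      E * (2 ^ (d * q) + 2 ^ (d * J) * (q + J + 1) ^ 2) + 5 ≤ W →
        ∃ η : Architecture d, η.numWeights = W ∧ η.depth ≤ E * (2 ^ (d * J) + (q + J) + 1) + 1 ∧
          ∀ f ∈ holderBall d r, ∀ ε > 0, ∃ w : η.Param → ℝ, ∀ x ∈ cube d,
            |f x - η.eval σ w x| ≤ B * 2 ^ (-(r * (q + J : ℕ))) + ε := by
  obtain ⟨A, B, m, C, H, hB, happ⟩ := exists_netApprox hd hr
  obtain ⟨E, hE⟩ := exists_comp_netApprox hd (intPart r) m C H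
  -- 36 weights per gate; E + 1 instead of E makes the constant positive, as later divisions
  -- require.
  refine ⟨B, 36 * (E + 1), hB, by omega, ?_⟩
  rintro σ ⟨x₀, s, hs, hσ⟩ q J W hW
  obtain ⟨idx, hidx, hf⟩ := happ q J
  choose val code hvc using fun f : holderBall d r => hf f f.2
  have hle : 36 * (E * (2 ^ (d * q) + 2 ^ (d * J) * (q + J + 1) ^ 2)) + 5 ≤
      36 * (E + 1) * (2 ^ (d * q) + 2 ^ (d * J) * (q + J + 1) ^ 2) + 5 := by
    rw [← mul_assoc]
    gcongr
    omega
  obtain ⟨η, hη, hdepth, hw⟩ := exists_network_of_comp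
    (hE r A q J idx hidx (holderBall d r) val code) (W := W) (hle.trans hW) hs hσ
  refine ⟨η, hη, hdepth.trans (by gcongr; omega), fun f hf ε hε => ?_⟩
  obtain ⟨w, hw⟩ := hw ⟨f, hf⟩ ε hε
  exact ⟨w, fun x hx => (abs_sub_le _ _ _).trans (add_le_add (hvc ⟨f, hf⟩ x hx) (hw x hx))⟩

/-- Powers dominate logarithms. The first part needs a < 1, the second a > 0; here log₂ x will bound
both q and J. -/
theorem eventually_size_le {a : ℝ} (ha : a ∈ Ioo (0 : ℝ) 1) (E : ℝ) : ∀ᶠ x : ℝ in atTop,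
    E * (x ^ a * (2 * (Real.log x / Real.log 2) + 1) ^ 2) + 5 ≤ 1 / 2 * x ∧
      2 * (Real.log x / Real.log 2) + 1 ≤ x ^ a := by
  have hlog : ∀ b : ℝ, 0 < b →
      (fun x : ℝ => 2 * (Real.log x / Real.log 2) + 1) =o[atTop] fun x : ℝ => x ^ b := by
    intro b hb
    have h1 := (isLittleO_log_rpow_atTop hb).const_mul_left (2 / Real.log 2)
    have h2 : (fun _ : ℝ => (1 : ℝ)) =o[atTop] fun x : ℝ => x ^ b :=
      isLittleO_const_left.mpr (Or.inr (tendsto_norm_atTop_atTop.comp (tendsto_rpow_atTop hb)))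
    refine (h1.add h2).congr_left fun x => ?_
    ring
  have h1 : (fun x : ℝ => x ^ a * (2 * (Real.log x / Real.log 2) + 1) ^ 2) =o[atTop]
      fun x : ℝ => x := by
    have h2 := (isBigO_refl (fun x : ℝ => x ^ a) atTop).mul_isLittleO
      ((hlog ((1 - a) / 2) (by linarith [ha.2])).pow two_pos)
    refine h2.congr' EventuallyEq.rfl ?_
    filter_upwards [eventually_gt_atTop 0] with x hx
    rw [← Real.rpow_natCast, ← Real.rpow_mul hx.le, ← Real.rpow_add hx]
    have : a + (1 - a) / 2 * ((2 : ℕ) : ℝ) = 1 := by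
      push_cast
      ring
    rw [this, Real.rpow_one]
  have h3 := (h1.const_mul_left E).add (isLittleO_const_id_atTop (5 : ℝ))
  filter_upwards [h3.bound (show (0 : ℝ) < 1 / 2 by norm_num),
    (hlog a ha.1).bound (show (0 : ℝ) < 1 by norm_num), eventually_gt_atTop 0] with x hx1 hx2 hx
  constructor
  · rw [Real.norm_of_nonneg hx.le] at hx1
    exact (le_abs_self _).trans hx1
  · rw [one_mul, Real.norm_of_nonneg (by positivity : 0 ≤ x ^ a)] at hx2
    exact (le_abs_self _).trans hx2

theorem natCast_le_log_div_log_of_pow_le {d n : ℕ} (hd : 0 < d) {x : ℝ}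
    (h : ((2 : ℝ) ^ d) ^ n ≤ x) : (n : ℝ) ≤ Real.log x / Real.log 2 := by
  have h1 : (2 : ℝ) ^ n ≤ x := by
    refine (pow_le_pow_left₀ two_pos.le ?_ n).trans h
    exact le_self_pow₀ one_le_two hd.ne'
  rw [le_div_iff₀ (Real.log_pos one_lt_two), ← Real.log_pow]
  exact Real.log_le_log (by positivity) h1

/-- The choice of the numbers of levels. -/
theorem exists_levels {d : ℕ} (hd : 0 < d) {r : ℝ} (hr : 0 < r) {E : ℕ} (hE : 0 < E) {p : ℝ}
    (hp : p ∈ Ioo (r / d) (2 * r / d)) : ∃ W₀ : ℕ, ∃ C : ℝ, 0 < C ∧ ∀ W : ℕ, W₀ ≤ W → 1 ≤ W →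
      ∃ q J : ℕ, E * (2 ^ (d * q) + 2 ^ (d * J) * (q + J + 1) ^ 2) + 5 ≤ W ∧
        ((E * (2 ^ (d * J) + (q + J) + 1) + 1 : ℕ) : ℝ) ≤ (2 * E + 1) * (W : ℝ) ^ (p * d / r - 1) ∧
        (2 : ℝ) ^ (-(r * (q + J : ℕ))) ≤ C * (W : ℝ) ^ (-p) := by
  have hd0 : (0 : ℝ) < d := by exact_mod_cast hd
  have hE0 : (0 : ℝ) < E := by exact_mod_cast hE
  obtain ⟨hp1, hp2⟩ := hp
  rw [div_lt_iff₀ hd0] at hp1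
  rw [lt_div_iff₀ hd0] at hp2
  set a := p * d / r - 1 with ha
  have ha0 : 0 < a := by
    rw [ha, sub_pos, lt_div_iff₀ hr]
    linarith
  have ha1 : a < 1 := by
    rw [ha, sub_lt_iff_lt_add, div_lt_iff₀ hr]
    linarith
  have hev := (tendsto_natCast_atTop_atTop (R := ℝ)).eventually
    ((eventually_size_le ⟨ha0, ha1⟩ E).and (eventually_ge_atTop (2 * E : ℝ)))
  obtain ⟨W₀, hW₀⟩ := eventually_atTop.mp hev
  -- Q collects the losses from rounding down: 2E·2^d for q and 2^d for J.
  set Q : ℝ := 2 * E * (2 ^ d * 2 ^ d) with hQ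
  have hQ0 : 0 < Q := by positivity
  refine ⟨W₀, Q ^ (r / d), by positivity, fun W hW hW1 => ?_⟩
  obtain ⟨⟨h1, h2⟩, h3⟩ := hW₀ W hW
  have hWpos : (0 : ℝ) < W := by exact_mod_cast hW1
  have hWone : (1 : ℝ) ≤ W := by exact_mod_cast hW1
  have h2d : (1 : ℝ) < 2 ^ d := one_lt_pow₀ one_lt_two hd.ne'
  have hWa : 1 ≤ (W : ℝ) ^ a := Real.one_le_rpow hWone ha0.le
  -- q is the largest level whose tables use at most half of the W weights; J below is the largest
  -- one with 2^(dJ) ≤ W^a.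
  obtain ⟨q, hq1, hq2⟩ := exists_nat_pow_near (x := (W : ℝ) / (2 * E)) (y := 2 ^ d)
    (by rwa [one_le_div (by positivity)]) h2d
  obtain ⟨J, hJ1, hJ2⟩ := exists_nat_pow_near (x := (W : ℝ) ^ a) (y := 2 ^ d) hWa h2d
  have hWaW : (W : ℝ) ^ a ≤ W := by
    calc (W : ℝ) ^ a ≤ (W : ℝ) ^ (1 : ℝ) := Real.rpow_le_rpow_of_exponent_le hWone ha1.le
      _ = W := Real.rpow_one _
  have hqlog := natCast_le_log_div_log_of_pow_le hd (hq1.trans (div_le_self hWpos.le (by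
    have : (1 : ℝ) ≤ E := by exact_mod_cast hE
    linarith)))
  have hJlog := natCast_le_log_div_log_of_pow_le hd (hJ1.trans hWaW)
  set ℓ := Real.log W / Real.log 2
  refine ⟨q, J, ?_, ?_, ?_⟩
  · have h4 : (E : ℝ) * (2 ^ d) ^ q ≤ 1 / 2 * W := by
      rw [le_div_iff₀ (by positivity)] at hq1
      linarith
    have h5 : (E : ℝ) * ((2 ^ d) ^ J * ((q : ℝ) + J + 1) ^ 2) ≤
        E * ((W : ℝ) ^ a * (2 * ℓ + 1) ^ 2) := by
      gcongr
      linarith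
    rw [pow_mul, pow_mul]
    have h6 : (E : ℝ) * ((2 ^ d) ^ q + (2 ^ d) ^ J * ((q : ℝ) + J + 1) ^ 2) + 5 ≤ W := by
      rw [mul_add]
      linarith
    exact_mod_cast h6
  · rw [pow_mul]
    push_cast
    have h4 : (E : ℝ) * ((2 ^ d) ^ J + ((q : ℝ) + J) + 1) ≤ E * ((W : ℝ) ^ a + (W : ℝ) ^ a) :=
      mul_le_mul_of_nonneg_left (by linarith) hE0.le
    linarith
  · have h4 : (W : ℝ) ^ (p * d / r) ≤ Q * (2 ^ d) ^ (q + J) := by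
      have h5 : (W : ℝ) ^ (p * d / r) = W * (W : ℝ) ^ a := by
        rw [ha, Real.rpow_sub_one hWpos.ne']
        field_simp
      rw [div_lt_iff₀ (by positivity)] at hq2
      calc (W : ℝ) ^ (p * d / r) = W * (W : ℝ) ^ a := h5
        _ ≤ ((2 ^ d) ^ (q + 1) * (2 * E)) * (2 ^ d) ^ (J + 1) := by gcongr
        _ = Q * (2 ^ d) ^ (q + J) := by
          rw [hQ]
          ring
    have h5 : ((2 : ℝ) ^ d) ^ (q + J) = 2 ^ ((d : ℝ) * (q + J : ℕ)) := by
      rw [← pow_mul, ← Real.rpow_natCast]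
      push_cast
      rfl
    have h6 := Real.rpow_le_rpow (by positivity) h4 (show 0 ≤ r / d by positivity)
    rw [h5, Real.mul_rpow hQ0.le (by positivity), ← Real.rpow_mul hWpos.le,
      ← Real.rpow_mul two_pos.le] at h6
    have e1 : p * d / r * (r / d) = p := by field_simp
    have e2 : (d : ℝ) * (q + J : ℕ) * (r / d) = r * (q + J : ℕ) := by field_simp
    rw [e1, e2] at h6
    rw [Real.rpow_neg two_pos.le, Real.rpow_neg hWpos.le, ← div_eq_mul_inv, inv_eq_one_div,
      div_le_div_iff₀ (by positivity) (by positivity)]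
    linarith

end DeepNet

end

theorem theorem5 (d : ℕ) (hd : 0 < d) (r : ℝ) (hr : 0 < r) :
    ∃ cL : ℝ, 0 < cL ∧
      ∀ p ∈ Set.Ioo (r / d) (2 * r / d), ∃ C : ℝ, 0 < C ∧
        ∀ σ : ℝ → ℝ, (∃ x₀ s : ℝ, s ≠ 0 ∧ DeepNet.HasSecondDerivAt σ s x₀) →
          ∀ W : ℕ, 1 ≤ W →
            ∃ η : DeepNet.Architecture d, η.numWeights = W ∧
              (η.depth : ℝ) ≤ cL * (W : ℝ) ^ (p * d / r - 1) ∧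
              ∃ G : DeepNet.holderBall d r → (η.Param → ℝ),
                ∀ f : DeepNet.holderBall d r, ∀ x ∈ DeepNet.cube d,
                  |(f : EuclideanSpace ℝ (Fin d) → ℝ) x - η.eval σ (G f) x| ≤
                    C * (W : ℝ) ^ (-p) := by
  obtain ⟨B, E, hB, hE, hnet⟩ := DeepNet.exists_network hd hr
  refine ⟨2 * E + 1, by positivity, fun p hp => ?_⟩
  obtain ⟨W₀, C, hC, hlev⟩ := DeepNet.exists_levels hd hr hE hp
  have hd0 : (0 : ℝ) < d := by exact_mod_cast hd
  have hp0 : 0 < p := (div_pos hr hd0).trans hp.1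
  have ha0 : 0 ≤ p * d / r - 1 := by
    have := (div_lt_iff₀ hd0).mp hp.1
    rw [sub_nonneg, le_div_iff₀ hr]
    linarith
  -- The summands pay for the approximation rate, for the realization error W^(-p) of the network,
  -- and for the finitely many W < W₀.
  refine ⟨B * C + 1 + (W₀ : ℝ) ^ p, by positivity, fun σ hσ W hW => ?_⟩
  have hWpos : (0 : ℝ) < W := by exact_mod_cast hW
  have hWp : 0 < (W : ℝ) ^ (-p) := by positivity
  by_cases hWW : W₀ ≤ W
  · obtain ⟨q, J, h1, h2, h3⟩ := hlev W hWW hW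
    obtain ⟨η, hη, hdepth, hw⟩ := hnet σ hσ q J W h1
    choose G hG using fun f : DeepNet.holderBall d r => hw f f.2 _ hWp
    refine ⟨η, hη, le_trans (by exact_mod_cast hdepth) h2, G, fun f x hx => (hG f x hx).trans ?_⟩
    have h4 : B * 2 ^ (-(r * (q + J : ℕ))) ≤ B * (C * (W : ℝ) ^ (-p)) := by gcongr
    have h5 : 0 ≤ (W₀ : ℝ) ^ p * (W : ℝ) ^ (-p) := by positivity
    linarith
  -- For small W the zero function suffices, as |f| ≤ 1 ≤ W₀^p·W^(-p).
  · obtain ⟨η, hη, hdepth, w, hw⟩ := DeepNet.exists_zero_network d σ hW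
    have hWa : 1 ≤ (W : ℝ) ^ (p * d / r - 1) := Real.one_le_rpow (by exact_mod_cast hW) ha0
    refine ⟨η, hη, ?_, fun _ => w, fun f x hx => ?_⟩
    · have h1 : (η.depth : ℝ) ≤ 1 := by exact_mod_cast hdepth
      have h2 : (0 : ℝ) ≤ E := by positivity
      nlinarith
    · rw [hw, sub_zero]
      have h1 := DeepNet.abs_le_one_of_mem_holderBall f.2 hx
      have h2 : 1 ≤ (W₀ : ℝ) ^ p * (W : ℝ) ^ (-p) := by
        rw [Real.rpow_neg hWpos.le, ← div_eq_mul_inv, one_le_div (by positivity)]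
        exact Real.rpow_le_rpow hWpos.le (by exact_mod_cast (not_le.mp hWW).le) hp0.le
      have h3 : 0 ≤ (B * C + 1) * (W : ℝ) ^ (-p) := by positivity
      linarith
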